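/- For graphs $F,G$ let $F\times G$ be the tensor product: vertex set $V(F)\times V(G)$, with $(f,g)$ adjacent to $(f',g')$ iff $ff'\in E(F)$ and $gg'\in E(G)$. A graph $H$ is $\epsilon$-near $K_3\times G$ if $H$ is isomorphic to $(V(P),E(P)\setminus E')$, where $P=K_3\times G$ and $E'\subseteq E(P)$ contains, for each vertex $v$ of $P$, at most an $\epsilon$ fraction of the edges of $P$ incident to $v$. All graphs are finite, simple and loopless. **Theorem.** There is a (deterministic, uniform) algorithm with the following property. Its input is a graph $H$, given by its adjacency matrix, and a rational number $\epsilon=p/q\ge 0$. Whenever $H$ is $\epsilon$-near $K_3\times G$ for some graph $G$ on $n$ vertices ($G$ is arbitrary and not given to the algorithm), the algorithm halts after $O(n^6)$ steps on a word RAM whose words have $O(\log(|V(H)|+p+q+2))$ bits, and it outputs a graph $\widetilde H$ with $V(\widetilde H)=V(H)$ and a graph $\widetilde G$ on $n$ vertices, together with an isomorphism $\widetilde H\cong K_3\times\widetilde G$. The implied constants are absolute. If moreover $\epsilon=\Omega(|V(H)|/|E(H)|)$, then $|E(H)\,\Delta\,E(\widetilde H)|=O(\epsilon|E(H)|)$.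 Precisely, for every real $c>0$: if $\epsilon|E(H)|\ge c\,|V(H)|$, then $$|E(H)\,\Delta\,E(\widetilde H)|\le \Bigl(540+\frac1c\Bigr)\,\epsilon\,|E(H)| ,$$ so the constant is at most $550$ as soon as $c\ge 1/10$. -/

import Mathlib

/-! Tensor products of graphs, and graphs near a triangle tensor. -/

/-- The tensor (direct, Kronecker) product `F × G`: `(f, g)` and `(f', g')` are adjacent iff
`f, f'` are adjacent in `F` and `g, g'` are adjacent in `G`. -/
def tensorProd {α β : Type*} (F : SimpleGraph α) (G : SimpleGraph β) : SimpleGraph (α × β) where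
  Adj x y := F.Adj x.1 y.1 ∧ G.Adj x.2 y.2
  symm := ⟨fun _ _ h => ⟨h.1.symm, h.2.symm⟩⟩
  loopless := ⟨fun _ h => F.irrefl h.1⟩

/-- The triangle tensor `K₃ × G`. -/
abbrev triangleTensor {β : Type*} (G : SimpleGraph β) : SimpleGraph (Fin 3 × β) :=
  tensorProd (⊤ : SimpleGraph (Fin 3)) G

/-- `H` is `ε`-near `K₃ × G`: up to isomorphism it arises from `K₃ × G` by deleting a set `E'` of
edges such that at most an `ε` fraction of the edges incident to each vertex is in `E'`. -/
def IsNearTriangleTensor {α β : Type*} (ε : ℝ) (H : SimpleGraph α) (G : SimpleGraph β) : Prop :=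
  ∃ E' : Set (Sym2 (Fin 3 × β)), E' ⊆ (triangleTensor G).edgeSet ∧
    (∀ v, (((triangleTensor G).incidenceSet v ∩ E').ncard : ℝ)
      ≤ ε * ((triangleTensor G).incidenceSet v).ncard) ∧
    Nonempty (H ≃g (triangleTensor G).deleteEdges E')

/-! A word RAM, programmed in structured form. -/

namespace WordRAM

/-- A machine state: registers and a random access memory, both holding natural numbers. -/
structure State where
  reg : ℕ → ℕ
  mem : ℕ → ℕ

def State.setReg (s : State) (r v : ℕ) : State := { s with reg := Function.update s.reg r v }

def State.setMem (s : State) (a v : ℕ) : State := { s with mem := Function.update s.mem a v }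

/-- The binary word operations; `sub` is truncated, `div` rounds down, `lt` returns `0` or `1`. -/
inductive BinOp
  | add
  | sub
  | mul
  | div
  | lt

def BinOp.eval : BinOp → ℕ → ℕ → ℕ
  | .add, x, y => x + y
  | .sub, x, y => x - y
  | .mul, x, y => x * y
  | .div, x, y => x / y
  | .lt, x, y => if x < y then 1 else 0

/-- Programs; registers are named by natural numbers that are fixed in the program text. -/
inductive Prog
  /-- do nothing -/
  | skip
  /-- `r := k` -/
  | const (r k : ℕ)
  /-- `r := a op b` -/
  | op (o : BinOp) (r a b : ℕ)
  /-- `r := mem[a]` (indirect read) -/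
  | load (r a : ℕ)
  /-- `mem[a] := b` (indirect write) -/
  | store (a b : ℕ)
  /-- `P; Q` -/
  | seq (P Q : Prog)
  /-- if `r ≠ 0` then `P` else `Q` -/
  | branch (r : ℕ) (P Q : Prog)
  /-- while `r ≠ 0` do `P` -/
  | loop (r : ℕ) (P : Prog)

/-- `Exec W P s t s'`: on a machine whose words hold the numbers `0, …, W`, the program `P` started
in the state `s` halts after exactly `t` steps in the state `s'`. Every instruction and every test
of a branch or a loop is one step. A program that produces a number larger than `W` does not halt
properly. -/
inductive Exec (W : ℕ) : Prog → State → ℕ → State → Prop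
  | skip (s : State) : Exec W .skip s 1 s
  | const (s : State) (r k : ℕ) (hk : k ≤ W) : Exec W (.const r k) s 1 (s.setReg r k)
  | op (s : State) (o : BinOp) (r a b : ℕ) (hv : o.eval (s.reg a) (s.reg b) ≤ W) :
      Exec W (.op o r a b) s 1 (s.setReg r (o.eval (s.reg a) (s.reg b)))
  | load (s : State) (r a : ℕ) : Exec W (.load r a) s 1 (s.setReg r (s.mem (s.reg a)))
  | store (s : State) (a b : ℕ) : Exec W (.store a b) s 1 (s.setMem (s.reg a) (s.reg b))
  | seq {P Q : Prog} {s s' s'' : State} {t t' : ℕ} (hP : Exec W P s t s')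
      (hQ : Exec W Q s' t' s'') : Exec W (.seq P Q) s (t + t') s''
  | branch_pos {r : ℕ} {P Q : Prog} {s s' : State} {t : ℕ} (hr : s.reg r ≠ 0)
      (hP : Exec W P s t s') : Exec W (.branch r P Q) s (t + 1) s'
  | branch_zero {r : ℕ} {P Q : Prog} {s s' : State} {t : ℕ} (hr : s.reg r = 0)
      (hQ : Exec W Q s t s') : Exec W (.branch r P Q) s (t + 1) s'
  | loop_step {r : ℕ} {P : Prog} {s s' s'' : State} {t t' : ℕ} (hr : s.reg r ≠ 0)
      (hP : Exec W P s t s') (hL : Exec W (.loop r P) s' t' s'') :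
      Exec W (.loop r P) s (t + t' + 1) s''
  | loop_done {r : ℕ} {P : Prog} {s : State} (hr : s.reg r = 0) : Exec W (.loop r P) s 1 s

end WordRAM

open Classical in
/-- Entry `(i, j)` of the adjacency matrix of a graph on `0, …, N - 1`, as a number. -/
noncomputable def adjBit {N : ℕ} (H : SimpleGraph (Fin N)) (i j : Fin N) : ℕ :=
  if H.Adj i j then 1 else 0

open Classical in
/-- The initial state for the input `(H, ε)` with `ε = p / q`: registers `0, 1, 2` hold `N, p, q`,
the memory holds the adjacency matrix of `H` row by row, and everything else is `0`. -/
noncomputable def inputState {N : ℕ} (H : SimpleGraph (Fin N)) (p q : ℕ) : WordRAM.State where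
  reg r := if r = 0 then N else if r = 1 then p else if r = 2 then q else 0
  mem a := if ∃ i j : Fin N, a = i * N + j ∧ H.Adj i j then 1 else 0

/-- The memory of `s` holds, one after the other, the adjacency matrix of `Ht`, the first and the
second coordinates of the isomorphism `φ` from `Ht` to `K₃ × Gt`, and the adjacency matrix
of `Gt`. -/
def IsOutput (s : WordRAM.State) {N n : ℕ} (Ht : SimpleGraph (Fin N)) (Gt : SimpleGraph (Fin n))
    (φ : Ht ≃g triangleTensor Gt) : Prop :=
  (∀ u v : Fin N, s.mem (u * N + v) = adjBit Ht u v) ∧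
  (∀ v : Fin N, s.mem (N * N + v) = (φ v).1) ∧
  (∀ v : Fin N, s.mem (N * N + N + v) = (φ v).2) ∧
  (∀ i j : Fin n, s.mem (N * N + 2 * N + i * n + j) = adjBit Gt i j)

/-!
Why the algorithm works. Write `ε = p / q`, let `N = 3 n` be the number of vertices of `H`, and call
two vertices of `H` mates if the number of their common neighbours is at least half of either
degree, up to a factor `1 - O(ε)`. Suppose first that `ε < 1 / 540`. Two vertices of the same true
triple `K₃ × {h}` are mates, and mates with distinct labels have nearly the same neighbourhoods in
`G`. The converse of the first statement fails, so the true triples cannot be read off from `H`.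

*Components.* Link two triples of pairwise mates if all six edges between entries at different
places are present. Links determine labels: an entry of the second triple is adjacent to two entries
of the first one with different labels. Hence if a triple carries the three labels of `K₃` in order,
so does every triple in its component. Such a component contains, along with a triple, the true
triples of its three entries (`Near.trueTriple_mem`), because they have a common linked triple. It
therefore labels exactly the vertices of `K₃ × U` for a set `U` of vertices of `G`, and few edges
leave these vertices (`Near.card_leave_le`). The true triples in it cannot be told from the others,
but *any* perfect matching of mates between consecutive colour classes is good enough: it gives a
`Block` (`Near.block`). There is one, namely that of the true triples, and one is found by an
auction: as long as some bidder is without an item, he can take a cheapest item of his at a price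
less than `N` (`Auction.exists_price_lt`), and the sum of the prices, at most `N * N`, increases.

*Soundness.* The algorithm does not know which components are those of true triples. It tests for
each component whether its colours and matching form a `Block`, which is a property of `H` alone,
and uses all blocks that pass. The components of the true triples pass, so that every vertex that is
not isolated belongs to an accepted block.

*Few edges are lost.* The new graph keeps the edges of `H` that lie in complete 6-cycles between two
triples. The triples used are those of the accepted blocks that avoid all earlier blocks; the
vertices that are left over form arbitrary triples. In a block, few vertices have exactly one
neighbour in a given triple (`Block.bad_card_le`), and without such vertices the edges between two
triples form a complete 6-cycle or there are none. Few edges leave a block, and the vertices whose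
triple meets an earlier block have a fixed part of their edges leaving a block
(`codeg_le_of_not_intact`). Together with the at most `N` edges inside triples this bounds the loss
by `496 ε |E(H)| + N` (`card_not_kept_le`), and `N ≤ ε |E(H)| / c`. For `ε ≥ 1 / 540` the bound
holds for every subgraph of `H`.

*Running time.* The algorithm is written in a language with loops of `N ^ d` rounds, whose commands
are total functions on stores, and compiled to the word RAM (`Imp.exists_prog`). The cost of a
command is bounded by a polynomial in `N` whose degree is the nesting depth of its loops weighted by
`d` (`Imp.Cmd.exists_maxCost_le`). This depth is 6: the search for the components has `N ^ 3` rounds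
that look at `N ^ 3` triples, and for each of at most `N ^ 3` components the auction has `N ^ 2`
rounds that look at `N` vertices.
-/

/-! ### A small imperative language with bounded loops -/

namespace Imp

open WordRAM

/-- Expressions. `n` is the size parameter `N`, `arr a e` reads entry `e` of the array `a`, and
`io e` reads cell `e` of the input/output area. -/
inductive Exp
  | n
  | lit (k : ℕ)
  | var (v : ℕ)
  | bin (o : BinOp) (a b : Exp)
  | arr (a : Fin 16) (e : Exp)
  | io (e : Exp)

/-- Commands. `put a i e` writes the array `a`, `out i e` writes the input/output area, and
`loop v d c` runs `c` for `v = 0, …, N ^ d - 1`. -/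
inductive Cmd
  | skip
  | set (v : ℕ) (e : Exp)
  | put (a : Fin 16) (i e : Exp)
  | out (i e : Exp)
  | seq (c c' : Cmd)
  | ite (e : Exp) (c c' : Cmd)
  | loop (v d : ℕ) (c : Cmd)

/-- The variables, the sixteen unbounded arrays and the input/output area. -/
@[ext] structure Store where
  var : ℕ → ℕ
  arr : Fin 16 → ℕ → ℕ
  io : ℕ → ℕ

/-- Assignment to a variable. -/
def Store.setVar (s : Store) (v x : ℕ) : Store := { s with var := Function.update s.var v x }

/-- Assignment to an entry of an array. -/
def Store.setArr (s : Store) (a : Fin 16) (i x : ℕ) : Store :=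
  { s with arr := Function.update s.arr a (Function.update (s.arr a) i x) }

/-- Assignment to a cell of the input/output area. -/
def Store.setIo (s : Store) (i x : ℕ) : Store := { s with io := Function.update s.io i x }

/-- Values above the bound `B` are replaced by `0` whenever they are stored; this keeps the words
short without any side condition. -/
def clamp (B x : ℕ) : ℕ := if B < x then 0 else x

theorem clamp_le (B x : ℕ) : clamp B x ≤ B := by unfold clamp; split <;> omega

theorem clamp_of_le {B x : ℕ} (h : x ≤ B) : clamp B x = x := by unfold clamp; split <;> omega

/-- The value of an expression; the input/output area consists of the cells below `B`. -/
def Exp.eval (N B : ℕ) : Exp → Store → ℕ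
  | .n, _ => N
  | .lit k, _ => k
  | .var v, s => s.var v
  | .bin o a b, s => o.eval (a.eval N B s) (b.eval N B s)
  | .arr a e, s => s.arr a (e.eval N B s)
  | .io e, s => if e.eval N B s < B then s.io (e.eval N B s) else 0

/-- The state before round `i` of the iteration of `f`. -/
def iter {σ : Type} (f : ℕ → σ → σ) (s : σ) : ℕ → σ
  | 0 => s
  | i + 1 => f i (iter f s i)

/-- The effect of a command, a total function. -/
def Cmd.run (N B : ℕ) : Cmd → Store → Store
  | .skip, s => s
  | .set v e, s => s.setVar v (clamp B (e.eval N B s))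
  | .put a i e, s => s.setArr a (i.eval N B s) (clamp B (e.eval N B s))
  | .out i e, s =>
      if i.eval N B s < B then s.setIo (i.eval N B s) (clamp B (e.eval N B s)) else s
  | .seq c c', s => c'.run N B (c.run N B s)
  | .ite e c c', s => if e.eval N B s = 0 then c'.run N B s else c.run N B s
  | .loop v d c, s => iter (fun i s => c.run N B (s.setVar v i)) s (N ^ d)

/-- The number of elementary commands that are executed. -/
def Cmd.cost (N B : ℕ) : Cmd → Store → ℕ
  | .skip, _ => 1
  | .set _ _, _ => 1
  | .put _ _ _, _ => 1
  | .out _ _, _ => 1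
  | .seq c c', s => c.cost N B s + c'.cost N B (c.run N B s)
  | .ite e c c', s => 1 + if e.eval N B s = 0 then c'.cost N B s else c.cost N B s
  | .loop v d c, s => 1 + ∑ i ∈ Finset.range (N ^ d),
      (1 + c.cost N B ((iter (fun i s => c.run N B (s.setVar v i)) s i).setVar v i))

/-! ### Compilation to the word RAM -/

/-- Register `2 k + 4` is the `k`-th temporary register; register `2 v + 3` holds the variable `v`,
and the registers `0, 1, 2` hold `B`, `0`, `N`. -/
def tmp (k : ℕ) : ℕ := 2 * k + 4

/-- Code that puts the value of an expression into the `k`-th temporary register and uses no earlier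
one. Memory below `B` is the input/output area, and entry `i` of the array `a` is at the address
`B + 16 i + a`. -/
def Exp.compile : Exp → ℕ → Prog
  | .n, k => .op .add (tmp k) 2 1
  | .lit c, k => .const (tmp k) c
  | .var v, k => .op .add (tmp k) (2 * v + 3) 1
  | .bin o a b, k =>
      .seq (a.compile k) (.seq (b.compile (k + 1)) (.op o (tmp k) (tmp k) (tmp (k + 1))))
  | .arr a e, k =>
      .seq (e.compile k) (.seq (.const (tmp (k + 1)) 16) (.seq (.op .mul (tmp k) (tmp k) (tmp (k + 1)))
        (.seq (.const (tmp (k + 1)) a) (.seq (.op .add (tmp k) (tmp k) (tmp (k + 1)))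
          (.seq (.op .add (tmp k) (tmp k) 0) (.load (tmp k) (tmp k)))))))
  | .io e, k =>
      .seq (e.compile k) (.seq (.op .lt (tmp (k + 1)) (tmp k) 0)
        (.branch (tmp (k + 1)) (.load (tmp k) (tmp k)) (.const (tmp k) 0)))

/-- `N ^ d`, by repeated multiplication. -/
def powProg (k : ℕ) : ℕ → Prog
  | 0 => .const (tmp k) 1
  | d + 1 => .seq (powProg k d) (.op .mul (tmp k) (tmp k) 2)

/-- Code for a command that uses only the temporary registers from the `k`-th on; a loop keeps its
bound and its counter in the `k`-th and the next one. -/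
def Cmd.compile : Cmd → ℕ → Prog
  | .skip, _ => .skip
  | .set v e, k =>
      .seq (e.compile k) (.seq (.op .lt (tmp (k + 1)) 0 (tmp k))
        (.branch (tmp (k + 1)) (.const (2 * v + 3) 0) (.op .add (2 * v + 3) (tmp k) 1)))
  | .put a i e, k =>
      .seq (i.compile k) (.seq (.const (tmp (k + 1)) 16) (.seq (.op .mul (tmp k) (tmp k) (tmp (k + 1)))
        (.seq (.const (tmp (k + 1)) a) (.seq (.op .add (tmp k) (tmp k) (tmp (k + 1)))
          (.seq (.op .add (tmp k) (tmp k) 0) (.seq (e.compile (k + 1))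
            (.seq (.op .lt (tmp (k + 2)) 0 (tmp (k + 1)))
              (.seq (.branch (tmp (k + 2)) (.const (tmp (k + 1)) 0) .skip)
                (.store (tmp k) (tmp (k + 1)))))))))))
  | .out i e, k =>
      .seq (i.compile k) (.seq (e.compile (k + 1)) (.seq (.op .lt (tmp (k + 2)) 0 (tmp (k + 1)))
        (.seq (.branch (tmp (k + 2)) (.const (tmp (k + 1)) 0) .skip)
          (.seq (.op .lt (tmp (k + 2)) (tmp k) 0)
            (.branch (tmp (k + 2)) (.store (tmp k) (tmp (k + 1))) .skip)))))
  | .seq c c', k => .seq (c.compile k) (c'.compile k)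
  | .ite e c c', k => .seq (e.compile k) (.branch (tmp k) (c.compile k) (c'.compile k))
  | .loop v d c, k =>
      .seq (powProg k d) (.seq (.const (tmp (k + 1)) 0)
        (.seq (.op .lt (tmp (k + 2)) (tmp (k + 1)) (tmp k))
          (.loop (tmp (k + 2)) (.seq (.op .add (2 * v + 3) (tmp (k + 1)) 1) (.seq (c.compile (k + 3))
            (.seq (.const (tmp (k + 2)) 1) (.seq (.op .add (tmp (k + 1)) (tmp (k + 1)) (tmp (k + 2)))
              (.op .lt (tmp (k + 2)) (tmp (k + 1)) (tmp k)))))))))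

/-- An exponent such that all intermediate values are at most `B ^ deg`. -/
def Exp.deg : Exp → ℕ
  | .n => 1
  | .lit k => k + 1
  | .var _ => 1
  | .bin _ a b => a.deg + b.deg + 1
  | .arr _ e => e.deg + 3
  | .io e => e.deg + 1

/-- The analogue of `Exp.deg` for commands. -/
def Cmd.deg : Cmd → ℕ
  | .skip => 1
  | .set _ e => e.deg + 1
  | .put _ i e => i.deg + e.deg + 3
  | .out i e => i.deg + e.deg + 1
  | .seq c c' => c.deg + c'.deg
  | .ite e c c' => e.deg + c.deg + c'.deg
  | .loop _ _ c => c.deg + 4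

/-- A bound for the running time of a compiled expression. -/
def Exp.fac : Exp → ℕ
  | .n => 1
  | .lit _ => 1
  | .var _ => 1
  | .bin _ a b => a.fac + b.fac + 1
  | .arr _ e => e.fac + 6
  | .io e => e.fac + 3

/-- A bound for the running time of a compiled command per unit of `cost`. -/
def Cmd.fac : Cmd → ℕ
  | .skip => 1
  | .set _ e => e.fac + 3
  | .put _ i e => i.fac + e.fac + 9
  | .out i e => i.fac + e.fac + 6
  | .seq c c' => c.fac + c'.fac
  | .ite e c c' => e.fac + 1 + c.fac + c'.fac
  | .loop _ _ c => c.fac + 9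

/-- Every loop runs at most `N ^ 3` times. -/
def Cmd.Wf : Cmd → Prop
  | .seq c c' => c.Wf ∧ c'.Wf
  | .ite _ c c' => c.Wf ∧ c'.Wf
  | .loop _ d c => d ≤ 3 ∧ c.Wf
  | _ => True

/-- `P`, started in `st`, halts within `T` steps in a state that satisfies `Φ`. -/
def Does (W : ℕ) (P : Prog) (st : State) (T : ℕ) (Φ : State → Prop) : Prop :=
  ∃ t st', Exec W P st t st' ∧ t ≤ T ∧ Φ st'

section Does

variable {W : ℕ} {P Q : Prog} {st : State} {T T' : ℕ} {Φ Ψ : State → Prop}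

theorem Does.mono (h : Does W P st T Φ) (hT : T ≤ T') (hΦ : ∀ st', Φ st' → Ψ st') :
    Does W P st T' Ψ := by
  obtain ⟨t, st', h1, h2, h3⟩ := h
  exact ⟨t, st', h1, h2.trans hT, hΦ _ h3⟩

theorem Does.seq (h : Does W P st T Φ) (h' : ∀ st', Φ st' → Does W Q st' T' Ψ) :
    Does W (.seq P Q) st (T + T') Ψ := by
  obtain ⟨t, st', h1, h2, h3⟩ := h
  obtain ⟨t', st'', h1', h2', h3'⟩ := h' st' h3
  exact ⟨_, _, .seq h1 h1', by omega, h3'⟩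

theorem Does.const {r k : ℕ} (hk : k ≤ W) (h : Φ (st.setReg r k)) :
    Does W (.const r k) st 1 Φ := ⟨1, _, .const st r k hk, le_rfl, h⟩

theorem Does.op {o : BinOp} {r a b : ℕ} (hk : o.eval (st.reg a) (st.reg b) ≤ W)
    (h : Φ (st.setReg r (o.eval (st.reg a) (st.reg b)))) :
    Does W (.op o r a b) st 1 Φ := ⟨1, _, .op st o r a b hk, le_rfl, h⟩

theorem Does.load {r a : ℕ} (h : Φ (st.setReg r (st.mem (st.reg a)))) :
    Does W (.load r a) st 1 Φ := ⟨1, _, .load st r a, le_rfl, h⟩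

theorem Does.store {a b : ℕ} (h : Φ (st.setMem (st.reg a) (st.reg b))) :
    Does W (.store a b) st 1 Φ := ⟨1, _, .store st a b, le_rfl, h⟩

theorem Does.skip (h : Φ st) : Does W .skip st 1 Φ := ⟨1, _, .skip st, le_rfl, h⟩

theorem Does.branch {r : ℕ} (h : st.reg r ≠ 0 → Does W P st T Φ)
    (h' : st.reg r = 0 → Does W Q st T Φ) : Does W (.branch r P Q) st (T + 1) Φ := by
  by_cases hr : st.reg r = 0
  · obtain ⟨t, st', h1, h2, h3⟩ := h' hr
    exact ⟨_, _, .branch_zero hr h1, by omega, h3⟩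
  · obtain ⟨t, st', h1, h2, h3⟩ := h hr
    exact ⟨_, _, .branch_pos hr h1, by omega, h3⟩

end Does

@[simp] theorem setReg_reg_same (st : State) (r x : ℕ) : (st.setReg r x).reg r = x := by
  simp [State.setReg]

theorem setReg_reg_ne (st : State) {r r' : ℕ} (x : ℕ) (h : r' ≠ r) :
    (st.setReg r x).reg r' = st.reg r' := by
  simp [State.setReg, h]

@[simp] theorem setReg_mem (st : State) (r x : ℕ) : (st.setReg r x).mem = st.mem := rfl

@[simp] theorem setMem_reg (st : State) (r x : ℕ) : (st.setMem r x).reg = st.reg := rfl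

/-- The machine state `st` represents the store `s`; the entry `i` of the array `a` is kept in the
cell `16 i + a + B`. -/
structure Rep (N B : ℕ) (s : Store) (st : State) : Prop where
  reg0 : st.reg 0 = B
  reg1 : st.reg 1 = 0
  reg2 : st.reg 2 = N
  var : ∀ v, st.reg (2 * v + 3) = s.var v
  arr : ∀ (a : Fin 16) i, st.mem (i * 16 + a + B) = s.arr a i
  io : ∀ i < B, st.mem i = s.io i

/-- All stored values are at most `B`. -/
structure Bdd (B : ℕ) (s : Store) : Prop where
  var : ∀ v, s.var v ≤ B
  arr : ∀ a i, s.arr a i ≤ B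
  io : ∀ i, s.io i ≤ B

theorem Rep.congr {N B : ℕ} {s : Store} {st st' : State} (h : Rep N B s st)
    (hm : st'.mem = st.mem) {k : ℕ} (hr : ∀ r, (∀ j ≥ k, r ≠ tmp j) → st'.reg r = st.reg r) :
    Rep N B s st' := by
  constructor
  · rw [hr 0 (by unfold tmp; omega), h.reg0]
  · rw [hr 1 (by unfold tmp; omega), h.reg1]
  · rw [hr 2 (by unfold tmp; omega), h.reg2]
  · intro v; rw [hr _ (by unfold tmp; omega), h.var]
  · intro a i; rw [hm, h.arr]
  · intro i hi; rw [hm, h.io i hi]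

theorem Exp.one_le_deg (e : Exp) : 1 ≤ e.deg := by cases e <;> simp [Exp.deg]

theorem Cmd.one_le_deg (c : Cmd) : 1 ≤ c.deg := by
  induction c <;> simp [Cmd.deg] <;> omega

theorem Cmd.one_le_cost (N B : ℕ) (c : Cmd) (s : Store) : 1 ≤ c.cost N B s := by
  induction c generalizing s with
  | seq c c' ih ih' => have := ih s; simp only [Cmd.cost]; omega
  | _ => simp [Cmd.cost]

theorem Exp.eval_le {N B : ℕ} (hB : 16 ≤ B) (hN : N ≤ B) {s : Store} (hs : Bdd B s) (e : Exp) :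
    e.eval N B s ≤ B ^ e.deg := by
  have h1 : ∀ k, 1 ≤ k → B ≤ B ^ k := fun k hk => by
    calc B = B ^ 1 := (pow_one B).symm
      _ ≤ B ^ k := Nat.pow_le_pow_right (by omega) hk
  induction e with
  | n => exact hN.trans (h1 _ le_rfl)
  | lit k =>
    calc k ≤ 2 ^ k := Nat.lt_two_pow_self.le
      _ ≤ B ^ k := Nat.pow_le_pow_left (by omega) k
      _ ≤ B ^ (k + 1) := Nat.pow_le_pow_right (by omega) (by omega)
  | var v => exact (hs.var v).trans (h1 _ le_rfl)
  | bin o a b iha ihb =>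
    simp only [Exp.eval, Exp.deg]
    have ha : B ^ a.deg ≤ B ^ (a.deg + b.deg) := Nat.pow_le_pow_right (by omega) (by omega)
    have hb : B ^ b.deg ≤ B ^ (a.deg + b.deg) := Nat.pow_le_pow_right (by omega) (by omega)
    have hab : B ^ (a.deg + b.deg + 1) = B ^ (a.deg + b.deg) * B := pow_succ _ _
    have h2 : B ^ (a.deg + b.deg) * 2 ≤ B ^ (a.deg + b.deg) * B :=
      Nat.mul_le_mul_left _ (by omega)
    cases o with
    | add => simp only [BinOp.eval]; omega
    | sub => simp only [BinOp.eval]; omega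
    | mul =>
      simp only [BinOp.eval]
      calc _ ≤ B ^ a.deg * B ^ b.deg := Nat.mul_le_mul iha ihb
        _ = B ^ (a.deg + b.deg) := (pow_add _ _ _).symm
        _ ≤ _ := Nat.pow_le_pow_right (by omega) (by omega)
    | div =>
      simp only [BinOp.eval]
      have := Nat.div_le_self (a.eval N B s) (b.eval N B s)
      omega
    | lt =>
      simp only [BinOp.eval]
      have := Nat.one_le_pow (a.deg + b.deg + 1) B (by omega)
      split <;> omega
  | arr a e ih => exact (hs.arr _ _).trans (h1 _ (by simp [Exp.deg]))
  | io e ih =>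
    simp only [Exp.eval]
    split
    · exact (hs.io _).trans (h1 _ (by simp [Exp.deg]))
    · omega

theorem Exp.addr_le {N B : ℕ} (hB : 16 ≤ B) (hN : N ≤ B) {s : Store} (hs : Bdd B s) (e : Exp) :
    e.eval N B s * 16 + 16 + B ≤ B ^ (e.deg + 3) := by
  have h := e.eval_le hB hN hs
  have h1 : B ≤ B ^ e.deg := by
    calc B = B ^ 1 := (pow_one B).symm
      _ ≤ B ^ e.deg := Nat.pow_le_pow_right (by omega) e.one_le_deg
  have h2 : B ^ (e.deg + 3) = B ^ e.deg * (B * B * B) := by ring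
  have h3 : 16 * 16 * 1 ≤ B * B * B := Nat.mul_le_mul (Nat.mul_le_mul hB hB) (by omega)
  have h4 := Nat.mul_le_mul_left (B ^ e.deg) h3
  omega

theorem tmp_ne {j k : ℕ} (h : j ≠ k) : tmp j ≠ tmp k := by unfold tmp; omega

theorem Exp.compile_spec {N B W : ℕ} (hB : 16 ≤ B) (hN : N ≤ B) {s : Store} (hs : Bdd B s)
    (e : Exp) : ∀ (k : ℕ) (st : State), B ^ e.deg ≤ W → Rep N B s st →
      Does W (e.compile k) st e.fac fun st' => st'.mem = st.mem ∧
        st'.reg (tmp k) = e.eval N B s ∧ ∀ r, (∀ j ≥ k, r ≠ tmp j) → st'.reg r = st.reg r := by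
  induction e with
  | n =>
    intro k st hW h
    refine Does.op ?_ ⟨rfl, ?_, fun r hr => setReg_reg_ne _ _ (hr k le_rfl)⟩
    · simp only [Exp.deg, pow_one] at hW
      simp only [BinOp.eval, h.reg1, h.reg2]; omega
    · simp [BinOp.eval, h.reg1, h.reg2, Exp.eval]
  | lit c =>
    intro k st hW h
    refine Does.const ((Exp.eval_le hB hN hs (.lit c)).trans hW)
      ⟨rfl, ?_, fun r hr => setReg_reg_ne _ _ (hr k le_rfl)⟩
    simp [Exp.eval]
  | var v =>
    intro k st hW h
    refine Does.op ?_ ⟨rfl, ?_, fun r hr => setReg_reg_ne _ _ (hr k le_rfl)⟩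
    · simp only [Exp.deg, pow_one] at hW
      simp only [BinOp.eval, h.reg1, h.var]
      have := hs.var v
      omega
    · simp [BinOp.eval, h.reg1, h.var, Exp.eval]
  | bin o a b iha ihb =>
    intro k st hW h
    have hWa : B ^ a.deg ≤ W := (Nat.pow_le_pow_right (by omega) (by simp [Exp.deg]; omega)).trans hW
    have hWb : B ^ b.deg ≤ W := (Nat.pow_le_pow_right (by omega) (by simp [Exp.deg]; omega)).trans hW
    have hv := (Exp.eval_le hB hN hs (.bin o a b)).trans hW
    refine ((iha k st hWa h).seq (T' := b.fac + 1) ?_).mono (by simp [Exp.fac]; omega) fun _ h => h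
    rintro st1 ⟨hm1, hv1, hr1⟩
    refine (ihb (k + 1) st1 hWb (h.congr hm1 hr1)).seq ?_
    rintro st2 ⟨hm2, hv2, hr2⟩
    have e1 : st2.reg (tmp k) = a.eval N B s := by
      rw [hr2 _ fun j hj => tmp_ne (by omega), hv1]
    refine Does.op ?_ ⟨by simp [hm1, hm2], ?_, fun r hr => ?_⟩
    · rw [e1, hv2]; exact hv
    · simp [e1, hv2, Exp.eval]
    · rw [setReg_reg_ne _ _ (hr k le_rfl), hr2 r fun j hj => hr j (by omega), hr1 r hr]
  | arr a e ih =>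
    intro k st hW h
    have hWe : B ^ e.deg ≤ W := (Nat.pow_le_pow_right (by omega) (by simp [Exp.deg])).trans hW
    have hv := (Exp.addr_le hB hN hs e).trans hW
    have ha := a.isLt
    refine ((ih k st hWe h).seq (T' := 1 + (1 + (1 + (1 + (1 + 1))))) ?_).mono
      (by simp [Exp.fac]) fun _ h => h
    rintro st1 ⟨hm1, hv1, hr1⟩
    have n1 : tmp k ≠ tmp (k + 1) := tmp_ne (by omega)
    have e0 : st1.reg 0 = B := by rw [hr1 0 (by unfold tmp; omega), h.reg0]
    have n0 : 0 ≠ tmp k := by unfold tmp; omega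
    have n0' : 0 ≠ tmp (k + 1) := by unfold tmp; omega
    refine (Does.const (by omega) rfl).seq ?_
    rintro _ rfl
    refine (Does.op ?_ rfl).seq ?_
    · simp [setReg_reg_ne, n1, hv1, BinOp.eval]; omega
    rintro _ rfl
    refine (Does.const (by omega) rfl).seq ?_
    rintro _ rfl
    refine (Does.op ?_ rfl).seq ?_
    · simp [setReg_reg_ne, n1, hv1, BinOp.eval]; omega
    rintro _ rfl
    refine (Does.op ?_ rfl).seq ?_
    · simp [setReg_reg_ne, n1, hv1, BinOp.eval, n0, n0', e0]; omega
    rintro _ rfl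
    refine Does.load ⟨by simp [hm1], ?_, fun r hr => ?_⟩
    · simp [setReg_reg_ne, n1, hv1, BinOp.eval, n0, n0', e0, hm1, h.arr, Exp.eval]
    · simp [setReg_reg_ne, hr k le_rfl, hr (k + 1) (by omega), hr1 r hr]
  | io e ih =>
    intro k st hW h
    have hWe : B ^ e.deg ≤ W := (Nat.pow_le_pow_right (by omega) (by simp [Exp.deg])).trans hW
    have hW1 : 1 ≤ W := (Nat.one_le_pow _ B (by omega)).trans hW
    refine ((ih k st hWe h).seq (T' := 1 + (1 + 1)) ?_).mono (by simp [Exp.fac]) fun _ h => h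
    rintro st1 ⟨hm1, hv1, hr1⟩
    have n1 : tmp k ≠ tmp (k + 1) := tmp_ne (by omega)
    have e0 : st1.reg 0 = B := by rw [hr1 0 (by unfold tmp; omega), h.reg0]
    have key : ∀ r, (∀ j ≥ k, r ≠ tmp j) → r ≠ tmp k ∧ r ≠ tmp (k + 1) :=
      fun r hr => ⟨hr k le_rfl, hr (k + 1) (by omega)⟩
    refine (Does.op ?_ rfl).seq ?_
    · simp only [BinOp.eval]; split <;> omega
    rintro _ rfl
    refine Does.branch (fun hc => Does.load ⟨by simp [hm1], ?_, fun r hr => ?_⟩)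
      fun hc => Does.const (by omega) ⟨by simp [hm1], ?_, fun r hr => ?_⟩
    · simp [BinOp.eval, hv1, e0] at hc
      simp [setReg_reg_ne, n1, hv1, hm1, Exp.eval, hc, h.io _ hc]
    · simp [setReg_reg_ne, key r hr, hr1 r hr]
    · simp [BinOp.eval, hv1, e0] at hc
      simp [Exp.eval, hc]
    · simp [setReg_reg_ne, key r hr, hr1 r hr]

end Imp

/-! ### Correctness of the compiled programs -/

namespace Imp

open WordRAM

theorem Bdd.setVar {B : ℕ} {s : Store} (h : Bdd B s) (v : ℕ) {x : ℕ} (hx : x ≤ B) :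
    Bdd B (s.setVar v x) := by
  refine ⟨fun w => ?_, h.arr, h.io⟩
  simp only [Store.setVar, Function.update_apply]
  split
  · exact hx
  · exact h.var w

theorem Bdd.setArr {B : ℕ} {s : Store} (h : Bdd B s) (a : Fin 16) (i : ℕ) {x : ℕ} (hx : x ≤ B) :
    Bdd B (s.setArr a i x) := by
  refine ⟨h.var, fun b j => ?_, h.io⟩
  simp only [Store.setArr, Function.update_apply]
  split
  · rw [Function.update_apply]
    split
    · exact hx
    · exact h.arr _ _
  · exact h.arr _ _

theorem Bdd.setIo {B : ℕ} {s : Store} (h : Bdd B s) (i : ℕ) {x : ℕ} (hx : x ≤ B) :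
    Bdd B (s.setIo i x) := by
  refine ⟨h.var, h.arr, fun j => ?_⟩
  simp only [Store.setIo, Function.update_apply]
  split
  · exact hx
  · exact h.io _

theorem pow_le_of_le_three {N d B : ℕ} (hd : d ≤ 3) (hB : 1 ≤ B) (hN : N ^ 3 ≤ B) : N ^ d ≤ B := by
  rcases Nat.eq_zero_or_pos N with rfl | h
  · rcases d with _ | d
    · simpa using hB
    · simp
  · exact (Nat.pow_le_pow_right h hd).trans hN

theorem Bdd.iter {B : ℕ} {f : ℕ → Store → Store} {n : ℕ}
    (hf : ∀ i < n, ∀ s, Bdd B s → Bdd B (f i s)) {s : Store} (hs : Bdd B s) :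
    ∀ i ≤ n, Bdd B (Imp.iter f s i)
  | 0, _ => hs
  | i + 1, hi => hf i (by omega) _ (Bdd.iter hf hs i (by omega))

theorem Bdd.run {N B : ℕ} (hB : 1 ≤ B) (hN : N ^ 3 ≤ B) (c : Cmd) (hc : c.Wf) :
    ∀ s, Bdd B s → Bdd B (c.run N B s) := by
  induction c with
  | skip => exact fun s hs => hs
  | set v e => exact fun s hs => hs.setVar v (clamp_le _ _)
  | put a i e => exact fun s hs => hs.setArr a _ (clamp_le _ _)
  | out i e =>
    intro s hs
    simp only [Cmd.run]
    split
    · exact hs.setIo _ (clamp_le _ _)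
    · exact hs
  | seq c c' ih ih' => exact fun s hs => ih' hc.2 _ (ih hc.1 s hs)
  | ite e c c' ih ih' =>
    intro s hs
    simp only [Cmd.run]
    split
    · exact ih' hc.2 s hs
    · exact ih hc.1 s hs
  | loop v d c ih =>
    intro s hs
    have hd := pow_le_of_le_three hc.1 hB hN
    exact Bdd.iter (fun i hi s hs => ih hc.2 _ (hs.setVar v (by omega))) hs _ le_rfl

theorem Rep.setVar {N B : ℕ} {s : Store} {st st' : State} (h : Rep N B s st) (v x : ℕ)
    (hm : st'.mem = st.mem) (hv : st'.reg (2 * v + 3) = x) {k : ℕ}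
    (hr : ∀ r, r ≠ 2 * v + 3 → (∀ j ≥ k, r ≠ tmp j) → st'.reg r = st.reg r) :
    Rep N B (s.setVar v x) st' := by
  constructor
  · rw [hr 0 (by omega) (by unfold tmp; omega), h.reg0]
  · rw [hr 1 (by omega) (by unfold tmp; omega), h.reg1]
  · rw [hr 2 (by omega) (by unfold tmp; omega), h.reg2]
  · intro w
    by_cases hw : w = v
    · subst hw; simp [Store.setVar, hv]
    · rw [hr _ (by omega) (by unfold tmp; omega), h.var]; simp [Store.setVar, hw]
  · intro a i; rw [hm, h.arr]; rfl
  · intro i hi; rw [hm, h.io i hi]; rfl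

theorem lt_eval_le (x y : ℕ) : BinOp.lt.eval x y ≤ 1 := by
  simp only [BinOp.eval]; split <;> omega

theorem powProg_spec {N W : ℕ} (k : ℕ) (st : State) (h2 : st.reg 2 = N) :
    ∀ d, (∀ i ≤ d, N ^ i ≤ W) → Does W (powProg k d) st (d + 1) fun st' => st'.mem = st.mem ∧
      st'.reg (tmp k) = N ^ d ∧ ∀ r, r ≠ tmp k → st'.reg r = st.reg r
  | 0, hW => Does.const (by simpa using hW 0 le_rfl)
      ⟨rfl, by simp, fun r hr => setReg_reg_ne _ _ hr⟩
  | d + 1, hW => by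
    refine (powProg_spec k st h2 d fun i hi => hW i (by omega)).seq ?_
    rintro st1 ⟨hm, hv, hr⟩
    have e2 : st1.reg 2 = N := by rw [hr 2 (by unfold tmp; omega), h2]
    have := hW (d + 1) le_rfl
    refine Does.op ?_ ⟨by simp [hm], ?_, fun r hr' => ?_⟩
    · simpa [WordRAM.BinOp.eval, hv, e2, ← pow_succ] using this
    · simp [WordRAM.BinOp.eval, hv, e2, ← pow_succ]
    · rw [setReg_reg_ne _ _ hr', hr r hr']

/-- The compiled commands do what `Cmd.run` says; the temporary registers below `k` are kept, which
is what protects the counters of the enclosing loops. -/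
theorem Cmd.compile_spec {N B W : ℕ} (hB : 16 ≤ B) (hN : N ≤ B) (hN3 : N ^ 3 ≤ B) (c : Cmd)
    (hc : c.Wf) : ∀ (k : ℕ) (s : Store) (st : State), Bdd B s → B ^ c.deg ≤ W → Rep N B s st →
      Does W (c.compile k) st (c.fac * c.cost N B s) fun st' =>
        Rep N B (c.run N B s) st' ∧ ∀ j < k, st'.reg (tmp j) = st.reg (tmp j) := by
  have hexp : ∀ (i j : ℕ), i ≤ j → B ^ j ≤ W → B ^ i ≤ W := fun i j hij h =>
    (Nat.pow_le_pow_right (by omega) hij).trans h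
  have hexpB : ∀ j, 1 ≤ j → B ^ j ≤ W → B ≤ W := fun j hij h => by
    simpa using hexp 1 j hij h
  induction c with
  | skip => exact fun k s st hs hW h => (Does.skip ⟨h, fun _ _ => rfl⟩)
  | set v e =>
    intro k s st hs hW h
    have hBW := hexpB _ (Cmd.one_le_deg _) hW
    simp only [Cmd.deg] at hW
    simp only [Cmd.fac, Cmd.cost, mul_one, Cmd.run]
    refine (e.compile_spec hB hN hs k st (hexp _ _ (by omega) hW) h).seq (T' := 1 + (1 + 1)) ?_
    rintro st1 ⟨hm1, hv1, hr1⟩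
    have n1 : tmp k ≠ tmp (k + 1) := tmp_ne (by omega)
    have nv : ∀ j, tmp j ≠ 2 * v + 3 := fun j => by unfold tmp; omega
    have e0 : st1.reg 0 = B := by rw [hr1 0 (by unfold tmp; omega), h.reg0]
    have e1 : st1.reg 1 = 0 := by rw [hr1 1 (by unfold tmp; omega), h.reg1]
    have m1 : 1 ≠ tmp (k + 1) := by unfold tmp; omega
    refine (Does.op ?_ rfl).seq ?_
    · exact (lt_eval_le _ _).trans (by omega)
    rintro _ rfl
    refine Does.branch (fun hr => ?_) fun hr => ?_
    · simp [BinOp.eval, e0, hv1] at hr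
      refine Does.const (by omega) ⟨h.setVar v _ (by simp [hm1]) (by simp [clamp, hr]) (k := k) ?_, ?_⟩
      · intro r h1 h2
        rw [setReg_reg_ne _ _ h1, setReg_reg_ne _ _ (h2 _ (by omega)), hr1 r h2]
      · intro j hj
        rw [setReg_reg_ne _ _ (nv j), setReg_reg_ne _ _ (tmp_ne (by omega)), hr1 _ fun i hi =>
          tmp_ne (by omega)]
    · simp [BinOp.eval, e0, hv1] at hr
      refine Does.op ?_ ⟨h.setVar v _ (by simp [hm1]) ?_ (k := k) ?_, ?_⟩
      · simp [BinOp.eval, setReg_reg_ne, n1, m1, hv1, e1]; omega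
      · simp [BinOp.eval, setReg_reg_ne, n1, m1, hv1, e1, clamp_of_le hr]
      · intro r h1 h2
        rw [setReg_reg_ne _ _ h1, setReg_reg_ne _ _ (h2 _ (by omega)), hr1 r h2]
      · intro j hj
        rw [setReg_reg_ne _ _ (nv j), setReg_reg_ne _ _ (tmp_ne (by omega)), hr1 _ fun i hi =>
          tmp_ne (by omega)]
  | put a i e =>
    intro k s st hs hW h
    have hBW := hexpB _ (Cmd.one_le_deg _) hW
    simp only [Cmd.deg] at hW
    simp only [Cmd.fac, Cmd.cost, mul_one, Cmd.run]
    have ha := a.isLt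
    have hv := (i.addr_le hB hN hs).trans (hexp _ _ (by omega) hW)
    refine ((i.compile_spec hB hN hs k st (hexp _ _ (by omega) hW) h).seq
      (T' := 1 + (1 + (1 + (1 + (1 + (e.fac + (1 + ((1 + 1) + 1)))))))) ?_).mono
      (by omega) fun _ h => h
    rintro st1 ⟨hm1, hv1, hr1⟩
    have n1 : tmp k ≠ tmp (k + 1) := tmp_ne (by omega)
    have e0 : st1.reg 0 = B := by rw [hr1 0 (by unfold tmp; omega), h.reg0]
    have n0 : ∀ j, 0 ≠ tmp j := fun j => by unfold tmp; omega
    refine (Does.const (by omega) rfl).seq ?_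
    rintro _ rfl
    refine (Does.op ?_ rfl).seq ?_
    · simp [setReg_reg_ne, n1, hv1, BinOp.eval]; omega
    rintro _ rfl
    refine (Does.const (by omega) rfl).seq ?_
    rintro _ rfl
    refine (Does.op ?_ rfl).seq ?_
    · simp [setReg_reg_ne, n1, hv1, BinOp.eval]; omega
    rintro _ rfl
    refine (Does.op (Φ := fun st' => st'.mem = st.mem ∧
      st'.reg (tmp k) = i.eval N B s * 16 + a + B ∧
      ∀ r, (∀ j ≥ k, r ≠ tmp j) → st'.reg r = st.reg r) ?_ ⟨by simp [hm1], ?_, ?_⟩).seq ?_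
    · simp [setReg_reg_ne, n1, hv1, BinOp.eval, n0, e0]; omega
    · simp [setReg_reg_ne, n1, hv1, BinOp.eval, n0, e0]
    · intro r hr
      simp [setReg_reg_ne, hr k le_rfl, hr (k + 1) (by omega), hr1 r hr]
    rintro st2 ⟨hm2, hv2, hr2⟩
    refine (e.compile_spec hB hN hs (k + 1) st2 (hexp _ _ (by omega) hW) (h.congr hm2 hr2)).seq ?_
    rintro st3 ⟨hm3, hv3, hr3⟩
    have n2 : tmp (k + 1) ≠ tmp (k + 2) := tmp_ne (by omega)
    have n3 : tmp k ≠ tmp (k + 2) := tmp_ne (by omega)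
    have e0' : st3.reg 0 = B := by
      rw [hr3 0 fun j _ => n0 j, hr2 0 fun j _ => n0 j, h.reg0]
    have ek : st3.reg (tmp k) = i.eval N B s * 16 + a + B := by
      rw [hr3 _ fun j hj => tmp_ne (by omega), hv2]
    refine (Does.op ?_ rfl).seq ?_
    · exact (lt_eval_le _ _).trans (by omega)
    rintro _ rfl
    refine (Does.branch (T := 1) (Φ := fun st' => st'.mem = st.mem ∧
      st'.reg (tmp k) = i.eval N B s * 16 + a + B ∧
      st'.reg (tmp (k + 1)) = clamp B (e.eval N B s) ∧
      ∀ r, (∀ j ≥ k, r ≠ tmp j) → st'.reg r = st.reg r) (fun hr => ?_) fun hr => ?_).seq ?_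
    · simp [BinOp.eval, e0', hv3] at hr
      refine Does.const (by omega) ⟨by simp [hm3, hm2], ?_, ?_, ?_⟩
      · simp [setReg_reg_ne, n1, n3, ek]
      · simp [clamp, hr]
      · intro r hr'
        simp [setReg_reg_ne, hr' (k + 1) (by omega), hr' (k + 2) (by omega),
          hr3 r fun j hj => hr' j (by omega), hr2 r hr']
    · simp [BinOp.eval, e0', hv3] at hr
      refine Does.skip ⟨by simp [hm3, hm2], ?_, ?_, ?_⟩
      · simp [setReg_reg_ne, n3, ek]
      · simp [setReg_reg_ne, n2, clamp_of_le hr, hv3]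
      · intro r hr'
        simp [setReg_reg_ne, hr' (k + 2) (by omega),
          hr3 r fun j hj => hr' j (by omega), hr2 r hr']
    rintro st4 ⟨hm4, ha4, hv4, hr4⟩
    refine Does.store ⟨⟨?_, ?_, ?_, fun v => ?_, fun b j => ?_, fun j hj => ?_⟩, fun j hj => ?_⟩
    · rw [setMem_reg, hr4 0 fun j _ => n0 j, h.reg0]
    · rw [setMem_reg, hr4 1 (by unfold tmp; omega), h.reg1]
    · rw [setMem_reg, hr4 2 (by unfold tmp; omega), h.reg2]
    · rw [setMem_reg, hr4 _ (by unfold tmp; omega), h.var]; rfl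
    · have hb := b.isLt
      simp only [State.setMem, ha4, hv4, hm4, Store.setArr, Function.update_apply]
      by_cases hba : b = a
      · subst hba
        by_cases hj : j = i.eval N B s
        · simp [hj]
        · have : ¬ (j * 16 + (b : ℕ) + B = i.eval N B s * 16 + b + B) := by omega
          simp [hj, h.arr]
      · have : (b : ℕ) ≠ a := fun hh => hba (Fin.ext hh)
        have : ¬ (j * 16 + (b : ℕ) + B = i.eval N B s * 16 + a + B) := by omega
        simp [hba, h.arr]
        omega
    · have : ¬ (j = i.eval N B s * 16 + (a : ℕ) + B) := by omega
      simp [State.setMem, ha4, hv4, hm4, this, h.io j hj, Store.setArr]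
    · rw [setMem_reg, hr4 _ fun i hi => tmp_ne (by omega)]
  | out i e =>
    intro k s st hs hW h
    have hBW := hexpB _ (Cmd.one_le_deg _) hW
    simp only [Cmd.deg] at hW
    simp only [Cmd.fac, Cmd.cost, mul_one, Cmd.run]
    refine ((i.compile_spec hB hN hs k st (hexp _ _ (by omega) hW) h).seq
      (T' := e.fac + (1 + ((1 + 1) + (1 + (1 + 1))))) ?_).mono
      (by omega) fun _ h => h
    rintro st2 ⟨hm2, hv2, hr2⟩
    have n0 : ∀ j, 0 ≠ tmp j := fun j => by unfold tmp; omega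
    have n1 : tmp k ≠ tmp (k + 1) := tmp_ne (by omega)
    refine (e.compile_spec hB hN hs (k + 1) st2 (hexp _ _ (by omega) hW) (h.congr hm2 hr2)).seq ?_
    rintro st3 ⟨hm3, hv3, hr3⟩
    have n2 : tmp (k + 1) ≠ tmp (k + 2) := tmp_ne (by omega)
    have n3 : tmp k ≠ tmp (k + 2) := tmp_ne (by omega)
    have e0' : st3.reg 0 = B := by
      rw [hr3 0 fun j _ => n0 j, hr2 0 fun j _ => n0 j, h.reg0]
    have ek : st3.reg (tmp k) = i.eval N B s := by
      rw [hr3 _ fun j hj => tmp_ne (by omega), hv2]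
    refine (Does.op ?_ rfl).seq ?_
    · exact (lt_eval_le _ _).trans (by omega)
    rintro _ rfl
    refine (Does.branch (T := 1) (Φ := fun st' => st'.mem = st.mem ∧
      st'.reg (tmp k) = i.eval N B s ∧
      st'.reg (tmp (k + 1)) = clamp B (e.eval N B s) ∧
      ∀ r, (∀ j ≥ k, r ≠ tmp j) → st'.reg r = st.reg r) (fun hr => ?_) fun hr => ?_).seq ?_
    · simp [BinOp.eval, e0', hv3] at hr
      refine Does.const (by omega) ⟨by simp [hm3, hm2], ?_, ?_, ?_⟩
      · simp [setReg_reg_ne, n1, n3, ek]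
      · simp [clamp, hr]
      · intro r hr'
        simp [setReg_reg_ne, hr' (k + 1) (by omega), hr' (k + 2) (by omega),
          hr3 r fun j hj => hr' j (by omega), hr2 r hr']
    · simp [BinOp.eval, e0', hv3] at hr
      refine Does.skip ⟨by simp [hm3, hm2], ?_, ?_, ?_⟩
      · simp [setReg_reg_ne, n3, ek]
      · simp [setReg_reg_ne, n2, clamp_of_le hr, hv3]
      · intro r hr'
        simp [setReg_reg_ne, hr' (k + 2) (by omega),
          hr3 r fun j hj => hr' j (by omega), hr2 r hr']
    rintro st4 ⟨hm4, ha4, hv4, hr4⟩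
    refine (Does.op ?_ rfl).seq ?_
    · exact (lt_eval_le _ _).trans (by omega)
    rintro _ rfl
    have e4 : st4.reg 0 = B := by rw [hr4 0 fun j _ => n0 j, h.reg0]
    have hr5 : ∀ (x r : ℕ), (∀ j ≥ k, r ≠ tmp j) →
        (st4.setReg (tmp (k + 2)) x).reg r = st.reg r := fun x r hr => by
      rw [setReg_reg_ne _ _ (hr _ (by omega)), hr4 r hr]
    refine Does.branch (fun hr => ?_) fun hr => ?_
    · simp [BinOp.eval, ha4, e4] at hr
      rw [if_pos hr]
      refine Does.store ⟨⟨?_, ?_, ?_, fun v => ?_, fun b j => ?_, fun j hj => ?_⟩, fun j hj => ?_⟩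
      · rw [setMem_reg, hr5 _ 0 fun j _ => n0 j, h.reg0]
      · rw [setMem_reg, hr5 _ 1 (by unfold tmp; omega), h.reg1]
      · rw [setMem_reg, hr5 _ 2 (by unfold tmp; omega), h.reg2]
      · rw [setMem_reg, hr5 _ _ (by unfold tmp; omega), h.var]; rfl
      · rw [setReg_reg_ne _ _ n3, setReg_reg_ne _ _ n2, ha4, hv4]
        have : ¬ (j * 16 + (b : ℕ) + B = i.eval N B s) := by omega
        simp [State.setMem, hm4, this, h.arr, Store.setIo]
      · rw [setReg_reg_ne _ _ n3, setReg_reg_ne _ _ n2, ha4, hv4]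
        simp [State.setMem, hm4, Function.update_apply, Store.setIo, h.io j hj]
      · rw [setMem_reg, hr5 _ _ fun i hi => tmp_ne (by omega)]
    · simp [BinOp.eval, ha4, e4] at hr
      rw [if_neg (by omega)]
      exact Does.skip ⟨h.congr (by simp [hm4]) (hr5 _), fun j hj => hr5 _ _ fun i hi =>
        tmp_ne (by omega)⟩
  | seq c c' ih ih' =>
    intro k s st hs hW h
    simp only [Cmd.deg] at hW
    refine ((ih hc.1 k s st hs (hexp _ _ (by omega) hW) h).seq
      (T' := c'.fac * c'.cost N B (c.run N B s)) ?_).mono ?_ fun _ h => h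
    · rintro st1 ⟨h1, hr1⟩
      refine (ih' hc.2 k _ st1 (hs.run (by omega) hN3 c hc.1) (hexp _ _ (by omega) hW) h1).mono le_rfl ?_
      rintro st2 ⟨h2, hr2⟩
      exact ⟨h2, fun j hj => by rw [hr2 j hj, hr1 j hj]⟩
    · simp only [Cmd.fac, Cmd.cost]
      nlinarith [Nat.zero_le (c.fac * c'.cost N B (c.run N B s)),
        Nat.zero_le (c'.fac * c.cost N B s)]
  | ite e c c' ih ih' =>
    intro k s st hs hW h
    simp only [Cmd.deg] at hW
    simp only [Cmd.run, Cmd.cost, Cmd.fac]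
    refine ((e.compile_spec hB hN hs k st (hexp _ _ (by omega) hW) h).seq
      (T' := (if e.eval N B s = 0 then c'.fac * c'.cost N B s else c.fac * c.cost N B s) + 1)
      ?_).mono ?_ fun _ h => h
    · rintro st1 ⟨hm1, hv1, hr1⟩
      have h1 := h.congr hm1 hr1
      refine Does.branch (fun hr => ?_) fun hr => ?_
      · rw [hv1] at hr
        rw [if_neg hr, if_neg hr]
        refine (ih hc.1 k s st1 hs (hexp _ _ (by omega) hW) h1).mono le_rfl ?_
        rintro st2 ⟨h2, hr2⟩
        exact ⟨h2, fun j hj => by rw [hr2 j hj, hr1 _ fun i hi => tmp_ne (by omega)]⟩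
      · rw [hv1] at hr
        rw [if_pos hr, if_pos hr]
        refine (ih' hc.2 k s st1 hs (hexp _ _ (by omega) hW) h1).mono le_rfl ?_
        rintro st2 ⟨h2, hr2⟩
        exact ⟨h2, fun j hj => by rw [hr2 j hj, hr1 _ fun i hi => tmp_ne (by omega)]⟩
    · split
      · nlinarith [Nat.zero_le ((e.fac + 1 + c.fac) * c'.cost N B s), Nat.zero_le (c.fac + c'.fac)]
      · nlinarith [Nat.zero_le ((e.fac + 1 + c'.fac) * c.cost N B s), Nat.zero_le (c.fac + c'.fac)]
  | loop v d c ih =>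
    intro k s st hs hW h
    obtain ⟨hd, hc⟩ := hc
    have hBW := hexpB _ (Cmd.one_le_deg _) hW
    simp only [Cmd.deg] at hW
    simp only [Cmd.run, Cmd.cost, Cmd.fac]
    have hdB := pow_le_of_le_three hd (by omega) hN3
    set f : ℕ → Store → Store := fun i s => c.run N B (s.setVar v i) with hf
    have hfB : ∀ i ≤ N ^ d, Bdd B (iter f s i) :=
      Bdd.iter (fun i hi s hs => Bdd.run (by omega) hN3 c hc _ (hs.setVar v (by omega))) hs
    set C : ℕ → ℕ := fun i => 1 + c.cost N B ((iter f s i).setVar v i) with hC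
    have n0 : ∀ j, 0 ≠ tmp j := fun j => by unfold tmp; omega
    have n1 : tmp k ≠ tmp (k + 1) := tmp_ne (by omega)
    have n2 : tmp (k + 1) ≠ tmp (k + 2) := tmp_ne (by omega)
    have n3 : tmp k ≠ tmp (k + 2) := tmp_ne (by omega)
    have h1k : 1 ≠ tmp k := by unfold tmp; omega
    have h1k1 : 1 ≠ tmp (k + 1) := by unfold tmp; omega
    have h1k2 : 1 ≠ tmp (k + 2) := by unfold tmp; omega
    refine ((powProg_spec k st h.reg2 d fun i hi =>
      (pow_le_of_le_three (hi.trans hd) (by omega) hN3).trans hBW).seq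
      (T' := 1 + (1 + ((c.fac + 8) * ∑ i ∈ Finset.range (N ^ d), C i + 1))) ?_).mono ?_ fun _ h => h
    · rintro st1 ⟨hm1, hv1, hr1⟩
      refine (Does.const (by omega) rfl).seq ?_
      rintro _ rfl
      refine (Does.op ?_ rfl).seq ?_
      · exact (lt_eval_le _ _).trans (by omega)
      rintro _ rfl
      -- The rounds that are left, by induction on their number.
      have main : ∀ m i, i + m = N ^ d → ∀ st', Rep N B (iter f s i) st' →
          st'.reg (tmp k) = N ^ d → st'.reg (tmp (k + 1)) = i →
          st'.reg (tmp (k + 2)) = (if i < N ^ d then 1 else 0) →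
          (∀ j < k, st'.reg (tmp j) = st.reg (tmp j)) →
          Does W (.loop (tmp (k + 2)) (.seq (.op .add (2 * v + 3) (tmp (k + 1)) 1)
            (.seq (c.compile (k + 3)) (.seq (.const (tmp (k + 2)) 1)
              (.seq (.op .add (tmp (k + 1)) (tmp (k + 1)) (tmp (k + 2)))
                (.op .lt (tmp (k + 2)) (tmp (k + 1)) (tmp k))))))) st'
            ((c.fac + 8) * ∑ j ∈ Finset.Ico i (N ^ d), C j + 1) fun st' =>
            Rep N B (iter f s (N ^ d)) st' ∧ ∀ j < k, st'.reg (tmp j) = st.reg (tmp j) := by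
        intro m
        induction m with
        | zero =>
          intro i hi st' hrep _ _ hk2 hj
          rw [if_neg (by omega)] at hk2
          obtain rfl : i = N ^ d := by omega
          exact ⟨1, st', .loop_done hk2, by simp, hrep, hj⟩
        | succ m ihm =>
          intro i hi st' hrep hk hk1 hk2 hj
          rw [if_pos (by omega)] at hk2
          have hbody : Does W (.seq (.op .add (2 * v + 3) (tmp (k + 1)) 1)
            (.seq (c.compile (k + 3)) (.seq (.const (tmp (k + 2)) 1)
              (.seq (.op .add (tmp (k + 1)) (tmp (k + 1)) (tmp (k + 2)))
                (.op .lt (tmp (k + 2)) (tmp (k + 1)) (tmp k)))))) st'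
              (1 + (c.fac * c.cost N B ((iter f s i).setVar v i) + (1 + (1 + 1)))) fun st'' =>
              Rep N B (iter f s (i + 1)) st'' ∧ st''.reg (tmp k) = N ^ d ∧
              st''.reg (tmp (k + 1)) = i + 1 ∧
              st''.reg (tmp (k + 2)) = (if i + 1 < N ^ d then 1 else 0) ∧
              ∀ j < k, st''.reg (tmp j) = st.reg (tmp j) := by
            have nv : ∀ j, tmp j ≠ 2 * v + 3 := fun j => by unfold tmp; omega
            refine (Does.op (Φ := fun st'' => Rep N B ((iter f s i).setVar v i) st'' ∧
              ∀ j, st''.reg (tmp j) = st'.reg (tmp j)) ?_ ⟨?_, ?_⟩).seq ?_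
            · simp only [BinOp.eval, hk1, hrep.reg1]; omega
            · refine hrep.setVar v i rfl ?_ (k := 0) fun r hr _ => setReg_reg_ne _ _ hr
              simp [BinOp.eval, hk1, hrep.reg1]
            · exact fun j => setReg_reg_ne _ _ (nv j)
            rintro st2 ⟨hrep2, ht2⟩
            refine (ih hc (k + 3) _ st2 ((hfB i (by omega)).setVar v (by omega))
              (hexp _ _ (by omega) hW) hrep2).seq ?_
            rintro st3 ⟨hrep3, ht3⟩
            refine (Does.const (by omega) rfl).seq ?_
            rintro _ rfl
            have ek : st3.reg (tmp k) = N ^ d := by rw [ht3 k (by omega), ht2, hk]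
            have ek1 : st3.reg (tmp (k + 1)) = i := by rw [ht3 _ (by omega), ht2, hk1]
            refine (Does.op ?_ rfl).seq ?_
            · simp [BinOp.eval, setReg_reg_ne, n2, ek1]; omega
            rintro _ rfl
            refine Does.op ?_ ⟨?_, ?_, ?_, ?_, ?_⟩
            · exact (lt_eval_le _ _).trans (by omega)
            · refine hrep3.congr rfl (k := k) fun r hr => ?_
              simp [setReg_reg_ne, hr (k + 1) (by omega), hr (k + 2) (by omega)]
            · simp [setReg_reg_ne, n1, n3, ek]
            · simp [setReg_reg_ne, n2, ek1, BinOp.eval]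
            · simp [setReg_reg_ne, n1, n2, n3, ek1, ek, BinOp.eval]
            · intro j hjk
              rw [setReg_reg_ne _ _ (tmp_ne (by omega)), setReg_reg_ne _ _ (tmp_ne (by omega)),
                setReg_reg_ne _ _ (tmp_ne (by omega)), ht3 j (by omega), ht2, hj j hjk]
          obtain ⟨t, st'', hex, ht, hrep', hk', hk1', hk2', hj'⟩ := hbody
          obtain ⟨t', st3, hex', ht', hfin⟩ := ihm (i + 1) (by omega) st'' hrep' hk' hk1' hk2' hj'
          refine ⟨t + t' + 1, st3, .loop_step (by rw [hk2]; omega) hex hex', ?_, hfin⟩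
          rw [Finset.sum_eq_sum_Ico_succ_bot (by omega)]
          simp only [hC] at ht' ⊢
          nlinarith
      refine (main (N ^ d) 0 (by omega) _ (h.congr (k := k) (by simp [hm1]) fun r hr => ?_)
        ?_ ?_ ?_ fun j hj => ?_).mono (by simp) fun _ h => h
      · rw [setReg_reg_ne _ _ (hr _ (by omega)), setReg_reg_ne _ _ (hr _ (by omega)),
          hr1 _ (hr _ le_rfl)]
      · simp [setReg_reg_ne, n1, n3, hv1]
      · simp [setReg_reg_ne, n2]
      · simp [setReg_reg_ne, n1, hv1, BinOp.eval]
      · rw [setReg_reg_ne _ _ (tmp_ne (by omega)), setReg_reg_ne _ _ (tmp_ne (by omega)),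
          hr1 _ (tmp_ne (by omega))]
    · have : (c.fac + 8) * ∑ i ∈ Finset.range (N ^ d), C i ≤
        (c.fac + 9) * ∑ i ∈ Finset.range (N ^ d), C i := Nat.mul_le_mul_right _ (by omega)
      nlinarith

end Imp

namespace Imp

open WordRAM

/-! ### Running compiled commands on the input -/

/-- Moves the input to the places that `Rep` prescribes and computes `B = (N + p + q + 2) ^ 4`. -/
def prelude : Prog :=
  .seq (.op .add 3 1 4) (.seq (.op .add 5 2 4) (.seq (.op .add 2 0 4) (.seq (.op .add 0 0 1)
    (.seq (.op .add 0 0 5) (.seq (.const 4 2) (.seq (.op .add 0 0 4) (.seq (.op .mul 0 0 0)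
      (.seq (.op .mul 0 0 0) (.const 1 0)))))))))

/-- The bound for stored values. -/
def bound (N p q : ℕ) : ℕ := (N + p + q + 2) ^ 4

/-- The store that represents the input. -/
noncomputable def inputStore {N : ℕ} (H : SimpleGraph (Fin N)) (p q : ℕ) : Store where
  var v := if v = 0 then p else if v = 1 then q else 0
  arr _ _ := 0
  io := (inputState H p q).mem

theorem inputState_mem_le {N : ℕ} (H : SimpleGraph (Fin N)) (p q i : ℕ) :
    (inputState H p q).mem i ≤ 1 := by
  simp only [inputState]; split <;> omega

theorem inputState_mem_of_ge {N : ℕ} (H : SimpleGraph (Fin N)) (p q i : ℕ) (h : N * N ≤ i) :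
    (inputState H p q).mem i = 0 := by
  simp only [inputState]
  rw [if_neg]
  rintro ⟨a, b, rfl, -⟩
  have := Nat.mul_le_mul_right N (Nat.succ_le_of_lt a.isLt)
  have := b.isLt
  rw [Nat.succ_mul] at *
  omega

theorem inputState_mem {N : ℕ} (H : SimpleGraph (Fin N)) (p q : ℕ) (u v : Fin N) :
    (inputState H p q).mem (u * N + v) = adjBit H u v := by
  simp only [inputState, adjBit]
  congr 1
  refine propext ⟨?_, fun h => ⟨u, v, rfl, h⟩⟩
  rintro ⟨a, b, hab, h⟩
  have hN : 0 < N := u.pos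
  have h1 : (u : ℕ) = a := by
    have := congrArg (· / N) hab
    simpa [Nat.add_div_of_dvd_right, Nat.mul_div_cancel _ hN, Nat.div_eq_of_lt u.isLt,
      Nat.div_eq_of_lt v.isLt, Nat.div_eq_of_lt b.isLt] using this
  have h2 : (v : ℕ) = b := by rw [h1] at hab; omega
  rw [Fin.ext h1, Fin.ext h2]; exact h

theorem mul_self_le_bound (N p q : ℕ) : N * N + 2 * N + N * N ≤ bound N p q := by
  unfold bound
  have h : N + 2 ≤ N + p + q + 2 := by omega
  calc N * N + 2 * N + N * N ≤ (N + 2) ^ 4 := by nlinarith [Nat.zero_le (N ^ 4), Nat.zero_le (N ^ 3)]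
    _ ≤ _ := Nat.pow_le_pow_left h 4

theorem pow_three_le_bound (N p q : ℕ) : N ^ 3 ≤ bound N p q := by
  unfold bound
  calc N ^ 3 ≤ (N + p + q + 2) ^ 3 := Nat.pow_le_pow_left (by omega) 3
    _ ≤ _ := Nat.pow_le_pow_right (by omega) (by omega)

theorem le_bound (N p q : ℕ) : N + p + q + 2 ≤ bound N p q := by
  unfold bound
  exact Nat.le_self_pow (by omega) _

/-- A command gives rise to a word RAM program whose running time is the cost of the command up to
a constant factor, on words of logarithmic length. -/
theorem exists_prog (c : Cmd) (hc : c.Wf) : ∃ (A : Prog) (K : ℕ), ∀ (N p q : ℕ)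
    (H : SimpleGraph (Fin N)), ∃ (t : ℕ) (st : State),
      Exec (K * (N + p + q + 1) ^ K) A (inputState H p q) t st ∧
      t ≤ K * c.cost N (bound N p q) (inputStore H p q) ∧
      ∀ i < bound N p q, st.mem i = (c.run N (bound N p q) (inputStore H p q)).io i := by
  refine ⟨.seq prelude (c.compile 0), 16 ^ (c.deg + 1) + 4 * c.deg + c.fac + 10, ?_⟩
  intro N p q H
  set K := 16 ^ (c.deg + 1) + 4 * c.deg + c.fac + 10 with hK
  set W := K * (N + p + q + 1) ^ K with hW
  have hB16 : 16 ≤ bound N p q := by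
    unfold bound
    exact Nat.pow_le_pow_left (show 2 ≤ N + p + q + 2 by omega) 4
  have hpow : ∀ d, d ≤ c.deg → bound N p q ^ d ≤ W := fun d hd => by
    have h1 : N + p + q + 2 ≤ 2 * (N + p + q + 1) := by omega
    calc bound N p q ^ d ≤ ((2 * (N + p + q + 1)) ^ 4) ^ d :=
          Nat.pow_le_pow_left (Nat.pow_le_pow_left h1 4) d
      _ = 16 ^ d * (N + p + q + 1) ^ (4 * d) := by
          rw [mul_pow, mul_pow, ← pow_mul (N + p + q + 1)]; norm_num
      _ ≤ K * (N + p + q + 1) ^ K := by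
          have hpos : 0 < 16 ^ (c.deg + 1) := by positivity
          refine Nat.mul_le_mul ?_ (Nat.pow_le_pow_right (by omega) (by omega))
          have : 16 ^ d ≤ 16 ^ (c.deg + 1) := Nat.pow_le_pow_right (by omega) (by omega)
          omega
  have hBW : bound N p q ≤ W := by simpa using hpow 1 c.one_le_deg
  have hle := le_bound N p q
  have hN : N ≤ bound N p q := by omega
  have hN3 := pow_three_le_bound N p q
  have hNN := mul_self_le_bound N p q
  have hsq : (N + p + q + 2) * (N + p + q + 2) ≤ bound N p q := by
    unfold bound
    calc _ = (N + p + q + 2) ^ 2 := by ring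
      _ ≤ _ := Nat.pow_le_pow_right (by omega) (by omega)
  have hs : Bdd (bound N p q) (inputStore H p q) := by
    refine ⟨fun v => ?_, fun a i => Nat.zero_le _, fun i => ?_⟩
    · simp only [inputStore]; split
      · omega
      · split <;> omega
    · exact (inputState_mem_le H p q i).trans (by omega)
  have hpre : Does W prelude (inputState H p q) 10 fun st =>
      Rep N (bound N p q) (inputStore H p q) st := by
    set st := inputState H p q with hst
    have r0 : st.reg 0 = N := rfl
    have r1 : st.reg 1 = p := rfl
    have r2 : st.reg 2 = q := rfl
    have r4 : st.reg 4 = 0 := rfl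
    refine Does.mono (Does.seq (T' := 1 + (1 + (1 + (1 + (1 + (1 + (1 + (1 + 1))))))))
      (Does.op ?_ rfl) ?_) (by omega) fun _ h => h
    · simp [BinOp.eval, r1, r4]; omega
    rintro _ rfl
    refine (Does.op ?_ rfl).seq ?_
    · simp [BinOp.eval, setReg_reg_ne, r2, r4]; omega
    rintro _ rfl
    refine (Does.op ?_ rfl).seq ?_
    · simp [BinOp.eval, setReg_reg_ne, r0, r4]; omega
    rintro _ rfl
    refine (Does.op ?_ rfl).seq ?_
    · simp [BinOp.eval, setReg_reg_ne, r0, r1]; omega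
    rintro _ rfl
    refine (Does.op ?_ rfl).seq ?_
    · simp [BinOp.eval, setReg_reg_ne, r0, r1, r2, r4]; omega
    rintro _ rfl
    refine (Does.const (by omega) rfl).seq ?_
    rintro _ rfl
    refine (Does.op ?_ rfl).seq ?_
    · simp [BinOp.eval, setReg_reg_ne, r0, r1, r2, r4]; omega
    rintro _ rfl
    refine (Does.op ?_ rfl).seq ?_
    · simp [BinOp.eval, setReg_reg_ne, r0, r1, r2, r4]; omega
    rintro _ rfl
    have e4 : (N + p + q + 2) * (N + p + q + 2) * ((N + p + q + 2) * (N + p + q + 2)) =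
        bound N p q := by unfold bound; ring
    refine (Does.op ?_ rfl).seq ?_
    · simp [BinOp.eval, setReg_reg_ne, r0, r1, r2, r4, e4, hBW]
    rintro _ rfl
    refine Does.const (by omega) ⟨?_, ?_, ?_, fun v => ?_, fun a i => ?_, fun i hi => ?_⟩
    · simp [BinOp.eval, setReg_reg_ne, r0, r1, r2, r4, e4]
    · simp
    · simp [BinOp.eval, setReg_reg_ne, r0, r4]
    · rcases v with _ | _ | v
      · simp [BinOp.eval, setReg_reg_ne, r1, r4, inputStore]
      · simp [BinOp.eval, setReg_reg_ne, r2, r4, inputStore]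
      · have h4 : 2 * (v + 1 + 1) + 3 ≠ 4 := by omega
        have h5 : 2 * (v + 1 + 1) + 3 ≠ 5 := by omega
        have h3 : 2 * (v + 1 + 1) + 3 ≠ 3 := by omega
        have h2 : 2 * (v + 1 + 1) + 3 ≠ 2 := by omega
        have h1 : 2 * (v + 1 + 1) + 3 ≠ 1 := by omega
        have h0 : 2 * (v + 1 + 1) + 3 ≠ 0 := by omega
        rw [setReg_reg_ne _ _ h1, setReg_reg_ne _ _ h0, setReg_reg_ne _ _ h0, setReg_reg_ne _ _ h0,
          setReg_reg_ne _ _ h4, setReg_reg_ne _ _ h0, setReg_reg_ne _ _ h0, setReg_reg_ne _ _ h2,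
          setReg_reg_ne _ _ h5, setReg_reg_ne _ _ h3]
        simp only [hst, inputState, inputStore, if_neg h2, if_neg h1, if_neg h0]
        simp
    · simp only [setReg_mem]
      exact inputState_mem_of_ge H p q _ (by omega)
    · rfl
  obtain ⟨t, st, h1, h2, h3⟩ := Does.seq hpre fun st h =>
    (c.compile_spec hB16 hN hN3 hc 0 _ st hs (hpow _ le_rfl) h).mono le_rfl fun st' h => h.1
  refine ⟨t, st, h1, h2.trans ?_, h3.io⟩
  have := c.one_le_cost N (bound N p q) (inputStore H p q)
  have : 0 < 16 ^ (c.deg + 1) := by positivity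
  nlinarith

/-! ### Reasoning about commands -/

@[simp] theorem setVar_var (s : Store) (v x w : ℕ) :
    (s.setVar v x).var w = if w = v then x else s.var w := by
  simp [Store.setVar, Function.update_apply]

@[simp] theorem setVar_io (s : Store) (v x : ℕ) : (s.setVar v x).io = s.io := rfl

@[simp] theorem setVar_arr (s : Store) (v x : ℕ) : (s.setVar v x).arr = s.arr := rfl

@[simp] theorem setArr_var (s : Store) (a : Fin 16) (i x : ℕ) : (s.setArr a i x).var = s.var := rfl

@[simp] theorem setArr_io (s : Store) (a : Fin 16) (i x : ℕ) : (s.setArr a i x).io = s.io := rfl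

@[simp] theorem setArr_arr (s : Store) (a : Fin 16) (i x : ℕ) (b : Fin 16) (j : ℕ) :
    (s.setArr a i x).arr b j = if b = a then if j = i then x else s.arr b j else s.arr b j := by
  by_cases h : b = a
  · subst h; simp [Store.setArr, Function.update_apply]
  · simp [Store.setArr, h]

@[simp] theorem setIo_var (s : Store) (i x : ℕ) : (s.setIo i x).var = s.var := rfl

@[simp] theorem setIo_arr (s : Store) (i x : ℕ) : (s.setIo i x).arr = s.arr := rfl

@[simp] theorem setIo_io (s : Store) (i x j : ℕ) :
    (s.setIo i x).io j = if j = i then x else s.io j := by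
  simp [Store.setIo, Function.update_apply]

/-- The command does not write the variable `w`. -/
def Cmd.keepsVar (w : ℕ) : Cmd → Bool
  | .set v _ => v != w
  | .seq c c' => c.keepsVar w && c'.keepsVar w
  | .ite _ c c' => c.keepsVar w && c'.keepsVar w
  | .loop v _ c => v != w && c.keepsVar w
  | _ => true

/-- The command does not write the array `b`. -/
def Cmd.keepsArr (b : Fin 16) : Cmd → Bool
  | .put a _ _ => a != b
  | .seq c c' => c.keepsArr b && c'.keepsArr b
  | .ite _ c c' => c.keepsArr b && c'.keepsArr b
  | .loop _ _ c => c.keepsArr b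
  | _ => true

/-- The command does not write the input/output area. -/
def Cmd.keepsIo : Cmd → Bool
  | .out _ _ => false
  | .seq c c' => c.keepsIo && c'.keepsIo
  | .ite _ c c' => c.keepsIo && c'.keepsIo
  | .loop _ _ c => c.keepsIo
  | _ => true

/-- Invariant rule for an iteration. -/
theorem iter_inv {σ : Type} {f : ℕ → σ → σ} (I : ℕ → σ → Prop) {s : σ} {n : ℕ} (h0 : I 0 s)
    (hf : ∀ i < n, ∀ s, I i s → I (i + 1) (f i s)) : ∀ i ≤ n, I i (iter f s i)
  | 0, _ => h0
  | i + 1, hi => hf i (by omega) _ (iter_inv I h0 hf i (by omega))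

/-- Invariant rule for a loop. -/
theorem run_loop_inv {N B : ℕ} (I : ℕ → Store → Prop) {v d : ℕ} {c : Cmd} {s : Store} (h0 : I 0 s)
    (hc : ∀ i < N ^ d, ∀ s, I i s → I (i + 1) (c.run N B (s.setVar v i))) :
    I (N ^ d) ((Cmd.loop v d c).run N B s) :=
  iter_inv I h0 hc _ le_rfl

theorem Cmd.var_run {N B w : ℕ} (c : Cmd) : ∀ (s : Store), c.keepsVar w = true →
    (c.run N B s).var w = s.var w := by
  induction c with
  | skip => intros; rfl
  | set v e => intro s h; simp [Cmd.keepsVar] at h; simp [Cmd.run, Ne.symm h]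
  | put a i e => intros; rfl
  | out i e => intro s _; simp only [Cmd.run]; split <;> rfl
  | seq c c' ih ih' =>
    intro s h; simp [Cmd.keepsVar] at h; simp [Cmd.run, ih' _ h.2, ih _ h.1]
  | ite e c c' ih ih' =>
    intro s h; simp [Cmd.keepsVar] at h; simp only [Cmd.run]; split
    · exact ih' _ h.2
    · exact ih _ h.1
  | loop v d c ih =>
    intro s h; simp [Cmd.keepsVar] at h
    refine run_loop_inv (fun _ s' => s'.var w = s.var w) rfl fun i _ s' hs' => ?_
    rw [ih _ h.2]; simp [Ne.symm h.1, hs']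

theorem Cmd.arr_run {N B : ℕ} {b : Fin 16} (c : Cmd) : ∀ (s : Store), c.keepsArr b = true →
    (c.run N B s).arr b = s.arr b := by
  induction c with
  | skip => intros; rfl
  | set v e => intros; rfl
  | put a i e =>
    intro s h; simp [Cmd.keepsArr] at h; funext j; simp [Cmd.run, Ne.symm h]
  | out i e => intro s _; simp only [Cmd.run]; split <;> rfl
  | seq c c' ih ih' =>
    intro s h; simp [Cmd.keepsArr] at h; simp [Cmd.run, ih' _ h.2, ih _ h.1]
  | ite e c c' ih ih' =>
    intro s h; simp [Cmd.keepsArr] at h; simp only [Cmd.run]; split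
    · exact ih' _ h.2
    · exact ih _ h.1
  | loop v d c ih =>
    intro s h; simp [Cmd.keepsArr] at h
    refine run_loop_inv (fun _ s' => s'.arr b = s.arr b) rfl fun i _ s' hs' => ?_
    rw [ih _ h]; exact hs'

theorem Cmd.io_run {N B : ℕ} (c : Cmd) : ∀ (s : Store), c.keepsIo = true →
    (c.run N B s).io = s.io := by
  induction c with
  | skip => intros; rfl
  | set v e => intros; rfl
  | put a i e => intros; rfl
  | out i e => intro s h; simp [Cmd.keepsIo] at h
  | seq c c' ih ih' =>
    intro s h; simp [Cmd.keepsIo] at h; simp [Cmd.run, ih' _ h.2, ih _ h.1]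
  | ite e c c' ih ih' =>
    intro s h; simp [Cmd.keepsIo] at h; simp only [Cmd.run]; split
    · exact ih' _ h.2
    · exact ih _ h.1
  | loop v d c ih =>
    intro s h; simp [Cmd.keepsIo] at h
    refine run_loop_inv (fun _ s' => s'.io = s.io) rfl fun i _ s' hs' => ?_
    rw [ih _ h]; exact hs'

/-- The worst-case cost, a polynomial in `N`. -/
def Cmd.maxCost (N : ℕ) : Cmd → ℕ
  | .seq c c' => c.maxCost N + c'.maxCost N
  | .ite _ c c' => 1 + (c.maxCost N + c'.maxCost N)
  | .loop _ d c => 1 + N ^ d * (1 + c.maxCost N)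
  | _ => 1

theorem Cmd.cost_le {N B : ℕ} (c : Cmd) : ∀ s, c.cost N B s ≤ c.maxCost N := by
  induction c with
  | seq c c' ih ih' => exact fun s => Nat.add_le_add (ih _) (ih' _)
  | ite e c c' ih ih' =>
    intro s
    have := ih s
    have := ih' s
    simp only [Cmd.cost, Cmd.maxCost]
    split <;> omega
  | loop v d c ih =>
    intro s
    simp only [Cmd.cost, Cmd.maxCost]
    refine Nat.add_le_add_left ((Finset.sum_le_card_nsmul _ _ (1 + c.maxCost N) fun i _ =>
      Nat.add_le_add_left (ih _) 1).trans ?_) 1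
    simp
  | _ => exact fun s => le_rfl

instance (k : ℕ) : OfNat Exp k := ⟨.lit k⟩
instance : Add Exp := ⟨.bin .add⟩
instance : Sub Exp := ⟨.bin .sub⟩
instance : Mul Exp := ⟨.bin .mul⟩
instance : Div Exp := ⟨.bin .div⟩

/-- `a < b`, as `0` or `1`. -/
def Exp.lt (a b : Exp) : Exp := .bin .lt a b

/-- Negation. -/
def Exp.not (a : Exp) : Exp := 1 - a

/-- `a = b`, as `0` or `1`. -/
def Exp.eq (a b : Exp) : Exp := (Exp.lt a b).not * (Exp.lt b a).not

section Eval

variable (N B : ℕ) (s : Store) (a b : Exp)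

@[simp] theorem eval_n : Exp.n.eval N B s = N := rfl
@[simp] theorem eval_lit (k : ℕ) : (no_index (OfNat.ofNat k) : Exp).eval N B s = k := rfl
@[simp] theorem eval_var (v : ℕ) : (Exp.var v).eval N B s = s.var v := rfl
@[simp] theorem eval_add : (a + b).eval N B s = a.eval N B s + b.eval N B s := rfl
@[simp] theorem eval_sub : (a - b).eval N B s = a.eval N B s - b.eval N B s := rfl
@[simp] theorem eval_mul : (a * b).eval N B s = a.eval N B s * b.eval N B s := rfl
@[simp] theorem eval_div : (a / b).eval N B s = a.eval N B s / b.eval N B s := rfl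
@[simp] theorem eval_arr (x : Fin 16) : (Exp.arr x a).eval N B s = s.arr x (a.eval N B s) := rfl

@[simp] theorem eval_not_eq_zero : a.not.eval N B s = 0 ↔ a.eval N B s ≠ 0 := by
  simp [Exp.not]; omega

@[simp] theorem eval_lt_eq_zero : (a.lt b).eval N B s = 0 ↔ ¬ a.eval N B s < b.eval N B s := by
  simp [Exp.lt, Exp.eval, BinOp.eval]

@[simp] theorem eval_eq_eq_zero : (a.eq b).eval N B s = 0 ↔ ¬ a.eval N B s = b.eval N B s := by
  simp [Exp.eq]

end Eval

section Run

variable (N B : ℕ) (s : Store)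

theorem run_seq (c c' : Cmd) : (c.seq c').run N B s = c'.run N B (c.run N B s) := rfl

theorem run_set (v : ℕ) (e : Exp) {x : ℕ} (he : e.eval N B s = x) (hx : x ≤ B) :
    (Cmd.set v e).run N B s = s.setVar v x := by
  rw [Cmd.run, he, clamp_of_le hx]

theorem run_put (a : Fin 16) (i e : Exp) {x y : ℕ} (hi : i.eval N B s = x) (he : e.eval N B s = y)
    (hy : y ≤ B) : (Cmd.put a i e).run N B s = s.setArr a x y := by
  rw [Cmd.run, he, hi, clamp_of_le hy]

theorem run_out (i e : Exp) {x y : ℕ} (hi : i.eval N B s = x) (he : e.eval N B s = y)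
    (hx : x < B) (hy : y ≤ B) : (Cmd.out i e).run N B s = s.setIo x y := by
  rw [Cmd.run, he, hi, clamp_of_le hy, if_pos hx]

theorem run_ite_pos {e : Exp} (c c' : Cmd) (h : e.eval N B s ≠ 0) :
    (Cmd.ite e c c').run N B s = c.run N B s := if_neg h

theorem run_ite_neg {e : Exp} (c c' : Cmd) (h : e.eval N B s = 0) :
    (Cmd.ite e c c').run N B s = c'.run N B s := if_pos h

end Run

end Imp

/-! ### Mates, triples and blocks -/

section Blocks

open Finset Classical

variable {V : Type*} [Fintype V]

/-- The number of common neighbours; `codeg H v v` is the degree of `v`. -/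
noncomputable def codeg (H : SimpleGraph V) (u v : V) : ℕ :=
  #{w | H.Adj u w ∧ H.Adj v w}

/-- The common neighbours of `u` and `v` make up half of either neighbourhood, up to a fraction
`κ p / q`. -/
def Mate (H : SimpleGraph V) (p q κ : ℕ) (u v : V) : Prop :=
  (q - κ * p) * codeg H u u ≤ 2 * q * codeg H u v ∧ (q - κ * p) * codeg H v v ≤ 2 * q * codeg H u v

theorem codeg_comm (H : SimpleGraph V) (u v : V) : codeg H u v = codeg H v u := by
  simp only [codeg, and_comm]

theorem Mate.symm {H : SimpleGraph V} {p q κ : ℕ} {u v : V} (h : Mate H p q κ u v) :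
    Mate H p q κ v u := by
  unfold Mate at *; rw [codeg_comm H v u]; exact h.symm

theorem codeg_self (H : SimpleGraph V) (v : V) : codeg H v v = #{w | H.Adj v w} := by
  simp [codeg]

/-- `w` has exactly one neighbour among `a, b, c`. -/
def OneNbr (H : SimpleGraph V) (w a b c : V) : Prop :=
  (H.Adj w a ∧ ¬ H.Adj w b ∧ ¬ H.Adj w c) ∨ (¬ H.Adj w a ∧ H.Adj w b ∧ ¬ H.Adj w c) ∨
    (¬ H.Adj w a ∧ ¬ H.Adj w b ∧ H.Adj w c)

omit [Fintype V] in
theorem OneNbr.rotate {H : SimpleGraph V} {w a b c : V} : OneNbr H w b c a ↔ OneNbr H w a b c := by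
  unfold OneNbr; tauto

/-- A colouring `col` of some of the vertices (those with `col v ≠ 0`) by `1, 2, 3` with a map `g`
that permutes them in 3-cycles of differently coloured mates. The colouring is proper, and few
edges leave the coloured vertices. -/
structure Block (H : SimpleGraph V) (p q : ℕ) (col : V → ℕ) (g : V → V) : Prop where
  col_next : ∀ v, col v ≠ 0 → col (g v) = col v % 3 + 1
  cyc : ∀ v, col v ≠ 0 → g (g (g v)) = v
  mate : ∀ v, col v ≠ 0 → Mate H p q 16 v (g v)
  leave : ∀ v, col v ≠ 0 → q * #{w | H.Adj v w ∧ col w = 0} ≤ 8 * p * codeg H v v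
  proper : ∀ v w, col v ≠ 0 → H.Adj v w → col w ≠ col v

namespace Block

variable {H : SimpleGraph V} {p q : ℕ} {col : V → ℕ} {g : V → V} (b : Block H p q col g)
include b

theorem col_g_ne {v : V} (hv : col v ≠ 0) : col (g v) ≠ 0 := by
  rw [b.col_next v hv]; omega

theorem col_le {v : V} (hv : col v ≠ 0) : col v ≤ 3 := by
  have h := b.col_next _ (b.col_g_ne (b.col_g_ne hv))
  rw [b.cyc v hv] at h
  omega

/-- Few vertices of the block have exactly one neighbour in a given triple: as no vertex of the block
is adjacent to all three, the degree sum of the triple exceeds twice the sum of its codegrees by at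
least their number, while the codegrees are about half of the degrees. -/
theorem bad_card_le (hpq : 16 * p ≤ q) {v : V} (hv : col v ≠ 0) :
    q * #{w | col w ≠ 0 ∧ OneNbr H w v (g v) (g (g v))} ≤
      24 * p * (codeg H v v + codeg H (g v) (g v) + codeg H (g (g v)) (g (g v))) := by
  have hv1 := b.col_g_ne hv
  have hv2 := b.col_g_ne hv1
  have m0 := (b.mate v hv).1
  have m1 := (b.mate _ hv1).1
  have m2 := (b.mate _ hv2).1
  rw [b.cyc v hv] at m2
  have l0 := b.leave v hv
  have l1 := b.leave _ hv1
  have l2 := b.leave _ hv2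
  have c0 := b.col_le hv
  have e1 := b.col_next v hv
  have e2 := b.col_next _ hv1
  set v1 := g v
  set v2 := g v1
  set L0 := #{w | H.Adj v w ∧ col w = 0} with hL0
  set L1 := #{w | H.Adj v1 w ∧ col w = 0} with hL1
  set L2 := #{w | H.Adj v2 w ∧ col w = 0} with hL2
  set bad := #{w | col w ≠ 0 ∧ OneNbr H w v v1 v2} with hbad
  have key : bad + 2 * (codeg H v v1 + codeg H v1 v2 + codeg H v2 v) ≤
      (codeg H v v + codeg H v1 v1 + codeg H v2 v2) + (L0 + L1 + L2) := by
    simp only [hbad, hL0, hL1, hL2, codeg, card_filter, mul_sum, mul_add, ← sum_add_distrib]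
    refine sum_le_sum fun w _ => ?_
    -- a coloured vertex is not adjacent to the vertex of its own colour
    have hp : col w ≠ 0 → ¬ (H.Adj v w ∧ H.Adj v1 w ∧ H.Adj v2 w) := by
      rintro hw ⟨a0, a1, a2⟩
      have := b.proper _ _ hv a0
      have := b.proper _ _ hv1 a1
      have := b.proper _ _ hv2 a2
      have := b.col_le hw
      omega
    simp only [OneNbr, H.adj_comm w]
    by_cases a0 : H.Adj v w <;> by_cases a1 : H.Adj v1 w <;> by_cases a2 : H.Adj v2 w <;>
      by_cases hw : col w = 0 <;> simp_all
  zify [hpq] at *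
  nlinarith

end Block

end Blocks

/-! ### The edges that are lost -/

section Lost

open Finset Classical

variable {V : Type*}

/-- The first of the `m` blocks that contains `v`, and `m` if there is none. -/
noncomputable def stage (m : ℕ) (col : ℕ → V → ℕ) (v : V) : ℕ :=
  if h : ∃ i, i < m ∧ col i v ≠ 0 then Nat.find h else m

theorem stage_le_of_ne {m : ℕ} {col : ℕ → V → ℕ} {v : V} {i : ℕ} (hi : i < m) (h : col i v ≠ 0) :
    stage m col v ≤ i := by
  have hex : ∃ i, i < m ∧ col i v ≠ 0 := ⟨i, hi, h⟩
  rw [stage, dif_pos hex]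
  exact Nat.find_min' hex ⟨hi, h⟩

theorem col_stage_ne {m : ℕ} {col : ℕ → V → ℕ} {v : V} (h : stage m col v < m) :
    col (stage m col v) v ≠ 0 := by
  by_cases hex : ∃ i, i < m ∧ col i v ≠ 0
  · rw [stage, dif_pos hex]; exact (Nat.find_spec hex).2
  · rw [stage, dif_neg hex] at h; omega

theorem stage_le {m : ℕ} {col : ℕ → V → ℕ} {v : V} : stage m col v ≤ m := by
  by_cases hex : ∃ i, i < m ∧ col i v ≠ 0
  · rw [stage, dif_pos hex]; exact (Nat.find_spec hex).1.le
  · rw [stage, dif_neg hex]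

theorem col_eq_zero_of_lt {m : ℕ} {col : ℕ → V → ℕ} {v : V} {i : ℕ} (h : i < stage m col v) :
    col i v = 0 := by
  by_contra hne
  have := stage_le_of_ne (h.trans_le stage_le) hne
  omega

/-- The triple of `v` in its block avoids all earlier blocks. -/
def Intact (m : ℕ) (col : ℕ → V → ℕ) (g : ℕ → V → V) (v : V) : Prop :=
  stage m col v < m ∧ stage m col (g (stage m col v) v) = stage m col v ∧
    stage m col (g (stage m col v) (g (stage m col v) v)) = stage m col v

/-- The edge `uv` joins differently labelled vertices of two triples between which all the six edges
are present; the triple and the label of `v` are the quotient and the remainder of `pos v` by 3. -/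
def Kept (H : SimpleGraph V) (pos : V → ℕ) (u v : V) : Prop :=
  pos u / 3 ≠ pos v / 3 ∧ pos u % 3 ≠ pos v % 3 ∧ ∀ a b, pos a / 3 = pos u / 3 →
    pos b / 3 = pos v / 3 → pos a % 3 ≠ pos b % 3 → H.Adj a b

/-- A subgraph of a 6-cycle between two triples that has an edge, and no vertex of degree one, is
the whole 6-cycle. -/
theorem six_cycle {A : V → V → Prop} {x0 x1 x2 y0 y1 y2 : V}
    (n0 : ¬ A x0 y0) (n1 : ¬ A x1 y1) (n2 : ¬ A x2 y2)
    (hx0 : A x0 y1 ↔ A x0 y2) (hx1 : A x1 y0 ↔ A x1 y2) (hx2 : A x2 y0 ↔ A x2 y1)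
    (hy0 : A x1 y0 ↔ A x2 y0) (hy1 : A x0 y1 ↔ A x2 y1) (hy2 : A x0 y2 ↔ A x1 y2)
    (h : A x0 y0 ∨ A x0 y1 ∨ A x0 y2 ∨ A x1 y0 ∨ A x1 y1 ∨ A x1 y2 ∨ A x2 y0 ∨ A x2 y1 ∨ A x2 y2) :
    A x0 y1 ∧ A x0 y2 ∧ A x1 y0 ∧ A x1 y2 ∧ A x2 y0 ∧ A x2 y1 := by
  tauto

theorem orbit_subset {σ : V → V} (h : ∀ v, σ (σ (σ v)) = v) {a c w : V}
    (ha : a = c ∨ a = σ c ∨ a = σ (σ c)) (hw : w = c ∨ w = σ c ∨ w = σ (σ c)) :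
    w = a ∨ w = σ a ∨ w = σ (σ a) := by
  rcases ha with rfl | rfl | rfl <;> rcases hw with rfl | rfl | rfl <;> simp [h]

variable [Fintype V] {H : SimpleGraph V} {p q m : ℕ} {col : ℕ → V → ℕ} {g : ℕ → V → V}

/-- The darts that leave the block of their first vertex. -/
noncomputable def leavingDarts (H : SimpleGraph V) (m : ℕ) (col : ℕ → V → ℕ) : Finset (V × V) :=
  {x | H.Adj x.1 x.2 ∧ stage m col x.1 < m ∧ col (stage m col x.1) x.2 = 0}

theorem card_filter_prod (P : V → V → Prop) [DecidablePred fun x : V × V => P x.1 x.2]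
    [∀ u, DecidablePred (P u)] : #{x : V × V | P x.1 x.2} = ∑ u, #{v | P u v} := by
  simp only [card_filter]
  rw [Fintype.sum_prod_type]

theorem card_filter_prod' (P : V → V → Prop) [DecidablePred fun x : V × V => P x.1 x.2]
    [∀ u v, Decidable (P u v)] : #{x : V × V | P x.1 x.2} = ∑ v, #{u | P u v} := by
  simp only [card_filter]
  rw [Fintype.sum_prod_type_right]

/-- The preimage of a finite set. -/
noncomputable def pullback {α : Type*} [Fintype α] (f : α → α) (S : Finset α) : Finset α :=
  {x | f x ∈ S}

theorem mem_pullback {α : Type*} [Fintype α] {f : α → α} {S : Finset α} {x : α} :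
    x ∈ pullback f S ↔ f x ∈ S := by
  simp [pullback]

theorem card_pullback_le {α : Type*} [Fintype α] {S : Finset α} {f : α → α}
    (hf : Function.Injective f) : #(pullback f S) ≤ #S :=
  card_le_card_of_injOn f (fun _ hx => mem_pullback.1 hx) hf.injOn

theorem card_union_pullback_le {α : Type*} [Fintype α] [DecidableEq α] {S : Finset α} {f : α → α}
    (hf : Function.Injective f) : #(S ∪ pullback f S) ≤ 2 * #S := by
  have := card_union_le S (pullback f S)
  have := card_pullback_le (S := S) hf
  omega

theorem card_leavingDarts_le (hb : ∀ i < m, Block H p q (col i) (g i)) :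
    q * #(leavingDarts H m col) ≤ 8 * p * ∑ v, codeg H v v := by
  rw [leavingDarts, card_filter_prod fun u v => H.Adj u v ∧ stage m col u < m ∧
    col (stage m col u) v = 0, mul_sum, mul_sum]
  refine sum_le_sum fun v _ => ?_
  by_cases hv : stage m col v < m
  · simpa [hv] using (hb _ hv).leave v (col_stage_ne hv)
  · simp [hv]

/-- A vertex `y` whose triple meets an earlier block is the end of many darts that leave their block:
it has a mate `x` in an earlier block, and most of the common neighbours of `x` and `y`, about half
of the neighbours of `y`, lie in the block of `x` or in even earlier ones. -/
theorem codeg_le_of_not_intact (hpq : 540 * p < q) (hb : ∀ i < m, Block H p q (col i) (g i)) {y : V}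
    (hy : stage m col y < m) (hi : ¬ Intact m col g y) :
    codeg H y y ≤ 3 * #{w | H.Adj w y ∧ stage m col w < m ∧ col (stage m col w) y = 0} := by
  set i := stage m col y with hi_def
  have hc := col_stage_ne hy
  rw [← hi_def] at hc
  have b := hb i hy
  have hc1 := b.col_g_ne hc
  have hc2 := b.col_g_ne hc1
  obtain ⟨x, hx, hxi, hm⟩ : ∃ x, col i x ≠ 0 ∧ stage m col x < i ∧ Mate H p q 16 y x := by
    have h1 := stage_le_of_ne hy hc1
    have h2 := stage_le_of_ne hy hc2
    by_cases h : stage m col (g i y) = i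
    · have : stage m col (g i (g i y)) ≠ i := fun h' => hi ⟨hy, h, h'⟩
      refine ⟨_, hc2, by omega, ?_⟩
      have := b.mate _ hc2
      rw [b.cyc y hc] at this
      exact this.symm
    · exact ⟨_, hc1, by omega, b.mate y hc⟩
  set j := stage m col x with hj
  have hjm : j < m := by omega
  have hl := (hb j hjm).leave x (col_stage_ne hjm)
  set X := #{w | H.Adj w y ∧ stage m col w < m ∧ col (stage m col w) y = 0} with hX
  set L := #{w | H.Adj x w ∧ col j w = 0} with hL
  have hcX : codeg H y x ≤ X + L := by
    rw [hX, hL, codeg]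
    refine (card_le_card ?_).trans (card_union_le _ _)
    intro w hw
    simp only [mem_filter, mem_univ, true_and, mem_union] at hw ⊢
    by_cases hwj : col j w = 0
    · exact Or.inr ⟨hw.2, hwj⟩
    · have := stage_le_of_ne hjm hwj
      exact Or.inl ⟨hw.1.symm, by omega, col_eq_zero_of_lt (m := m) (by omega)⟩
  obtain ⟨h1, h2⟩ := hm
  set c := codeg H y x
  have h16 : 16 * p ≤ q := by omega
  zify [h16] at *
  have hpos : (0 : ℤ) < q - 16 * p := by linarith
  have k1 : (524 : ℤ) * codeg H x x ≤ 1080 * c := by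
    refine le_of_mul_le_mul_left ?_ hpos
    nlinarith [Int.natCast_nonneg c]
  have k2 : (524 : ℤ) * codeg H y y ≤ 1080 * c := by
    refine le_of_mul_le_mul_left ?_ hpos
    nlinarith [Int.natCast_nonneg c]
  have k3 : (508 : ℤ) * c ≤ 524 * X := by
    have hq : (0 : ℤ) < q := by linarith
    refine le_of_mul_le_mul_left ?_ hq
    nlinarith [Int.natCast_nonneg c, Int.natCast_nonneg p]
  linarith

/-- The positions `3 k, 3 k + 1, 3 k + 2` hold the triple `x0, x1, x2`. -/
def Consecutive (pos : V → ℕ) (x0 x1 x2 : V) : Prop :=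
  pos x0 % 3 = 0 ∧ pos x1 % 3 = 1 ∧ pos x2 % 3 = 2 ∧ pos x1 / 3 = pos x0 / 3 ∧
    pos x2 / 3 = pos x0 / 3

omit [Fintype V] in
theorem Consecutive.eq_of_div_eq {pos : V → ℕ} (hinj : Function.Injective pos) {x0 x1 x2 a : V}
    (h : Consecutive pos x0 x1 x2) (ha : pos a / 3 = pos x0 / 3) : a = x0 ∨ a = x1 ∨ a = x2 := by
  obtain ⟨h0, h1, h2, h3, h4⟩ := h
  obtain h' | h' | h' : pos a % 3 = 0 ∨ pos a % 3 = 1 ∨ pos a % 3 = 2 := by omega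
  · exact Or.inl (hinj (by omega))
  · exact Or.inr (Or.inl (hinj (by omega)))
  · exact Or.inr (Or.inr (hinj (by omega)))

omit [Fintype V] in
/-- An edge between two properly coloured triples is kept if no vertex of either has exactly one
neighbour in the other. -/
theorem kept_of_not_oneNbr {pos : V → ℕ} (hinj : Function.Injective pos) {x0 x1 x2 y0 y1 y2 : V}
    (px : Consecutive pos x0 x1 x2) (py : Consecutive pos y0 y1 y2)
    (n0 : ¬ H.Adj x0 y0) (n1 : ¬ H.Adj x1 y1) (n2 : ¬ H.Adj x2 y2)
    (hx : ∀ w, (w = x0 ∨ w = x1 ∨ w = x2) → ¬ OneNbr H w y0 y1 y2)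
    (hy : ∀ w, (w = y0 ∨ w = y1 ∨ w = y2) → ¬ OneNbr H w x0 x1 x2)
    {u v : V} (hu : u = x0 ∨ u = x1 ∨ u = x2) (hv : v = y0 ∨ v = y1 ∨ v = y2) (huv : H.Adj u v)
    (hne : pos u / 3 ≠ pos v / 3) : Kept H pos u v := by
  have iff3 : ∀ {w a b c : V}, ¬ H.Adj w a → ¬ OneNbr H w a b c → (H.Adj w b ↔ H.Adj w c) := by
    intro w a b c ha h; unfold OneNbr at h; tauto
  have hx0 := iff3 n0 (hx x0 (by simp))
  have hx1 := iff3 n1 (OneNbr.rotate.not.2 (hx x1 (by simp)))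
  have hx2 := iff3 n2 (OneNbr.rotate.not.1 (hx x2 (by simp)))
  have hy0 := iff3 (fun h => n0 h.symm) (hy y0 (by simp))
  have hy1 := iff3 (fun h => n1 h.symm) (OneNbr.rotate.not.2 (hy y1 (by simp)))
  have hy2 := iff3 (fun h => n2 h.symm) (OneNbr.rotate.not.1 (hy y2 (by simp)))
  rw [H.adj_comm _ x1, H.adj_comm _ x2] at hy0
  rw [H.adj_comm _ x2, H.adj_comm _ x0] at hy1
  rw [H.adj_comm _ x0, H.adj_comm _ x1] at hy2
  clear hx hy iff3
  obtain ⟨k01, k02, k10, k12, k20, k21⟩ := six_cycle (A := H.Adj) n0 n1 n2 hx0 hx1.symm hx2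
    hy0 hy1.symm hy2
    (by rcases hu with rfl | rfl | rfl <;> rcases hv with rfl | rfl | rfl <;> simp [huv])
  have hpu : pos u / 3 = pos x0 / 3 := by
    unfold Consecutive at px; rcases hu with rfl | rfl | rfl <;> omega
  have hpv : pos v / 3 = pos y0 / 3 := by
    unfold Consecutive at py; rcases hv with rfl | rfl | rfl <;> omega
  refine ⟨hne, fun h => ?_, fun a c ha hc hac => ?_⟩
  · unfold Consecutive at px py
    rcases hu with rfl | rfl | rfl <;> rcases hv with rfl | rfl | rfl <;>
      first | omega | exact n0 huv | exact n1 huv | exact n2 huv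
  · rw [hpu] at ha
    rw [hpv] at hc
    have pa := px.eq_of_div_eq hinj ha
    have pc := py.eq_of_div_eq hinj hc
    unfold Consecutive at px py
    rcases pa with rfl | rfl | rfl <;> rcases pc with rfl | rfl | rfl <;>
      first | assumption | omega

set_option maxHeartbeats 400000 in
/-- The number of edges (counted with both orientations) that do not survive when only the complete
6-cycles between the triples are kept, apart from two for every vertex. A lost dart inside a block
whose ends lie in different intact triples is charged to a vertex with exactly one neighbour in the
triple of the other end. -/
theorem card_not_kept_le (hpq : 540 * p < q) (hb : ∀ i < m, Block H p q (col i) (g i))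
    (hcov : ∀ u v, H.Adj u v → stage m col u < m) {pos : V → ℕ} (hinj : Function.Injective pos)
    (hpos : ∀ v, Intact m col g v → pos v % 3 + 1 = col (stage m col v) v ∧
      pos (g (stage m col v) v) / 3 = pos v / 3) :
    q * #{x : V × V | H.Adj x.1 x.2 ∧ ¬ Kept H pos x.1 x.2} ≤
      496 * p * (∑ v, codeg H v v) + 2 * q * Fintype.card V := by
  set st := stage m col with hst
  -- a permutation of all vertices that cycles the intact triples
  set σ : V → V := fun v => if Intact m col g v then g (st v) v else v with hσ
  have hσI : ∀ v, Intact m col g v → σ v = g (st v) v := fun v hv => if_pos hv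
  have hcol : ∀ v, Intact m col g v → col (st v) v ≠ 0 := fun v hv => col_stage_ne hv.1
  have hI1 : ∀ v, Intact m col g v → Intact m col g (σ v) ∧ st (σ v) = st v := by
    intro v hv
    have hv' := hv
    obtain ⟨h1, h2, h3⟩ := hv
    rw [hσI v hv']
    refine ⟨⟨?_, ?_, ?_⟩, h2⟩
    · rw [h2]; exact h1
    · rw [h2]; exact h3
    · rw [h2, (hb _ h1).cyc v (hcol v hv')]
  have hσσ : ∀ v, Intact m col g v → σ (σ v) = g (st v) (g (st v) v) := by
    intro v hv
    rw [hσI _ (hI1 v hv).1, (hI1 v hv).2, hσI v hv]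
  have hσ3 : ∀ v, σ (σ (σ v)) = v := by
    intro v
    by_cases hv : Intact m col g v
    · rw [hσI _ (hI1 _ (hI1 v hv).1).1, (hI1 _ (hI1 v hv).1).2, (hI1 v hv).2, hσσ v hv,
        (hb _ hv.1).cyc v (hcol v hv)]
    · simp [hσ, hv]
  have hσinj : Function.Injective σ := fun a b h => by
    rw [← hσ3 a, ← hσ3 b, h]
  set bad : V → V → Prop := fun w v => OneNbr H w v (σ v) (σ (σ v)) with hbad
  set RP : V → V → Prop := fun w v => Intact m col g v ∧ col (st v) w ≠ 0 ∧ bad w v with hRP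
  -- the pairs of a triple and a vertex of its block with exactly one neighbour in it
  set R : Finset (V × V) := {x | RP x.1 x.2} with hR
  set E := ∑ v, codeg H v v with hE
  have hRle : q * #R ≤ 72 * p * E := by
    have h1 : ∀ v, q * #{w | RP w v} ≤
        24 * p * (codeg H v v + codeg H (σ v) (σ v) + codeg H (σ (σ v)) (σ (σ v))) := by
      intro v
      by_cases hv : Intact m col g v
      · have := (hb _ hv.1).bad_card_le (by omega) (hcol v hv)
        simp only [hRP, hbad, hv, true_and]
        rw [hσσ v hv, hσI v hv]
        exact this
      · simp [hRP, hv]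
    have h2 : ∑ v, codeg H (σ v) (σ v) = E :=
      Fintype.sum_bijective σ (Finite.injective_iff_bijective.1 hσinj) _ _ fun _ => rfl
    have h3 : ∑ v, codeg H (σ (σ v)) (σ (σ v)) = E :=
      Fintype.sum_bijective (σ ∘ σ) (Finite.injective_iff_bijective.1 (hσinj.comp hσinj)) _ _
        fun _ => rfl
    rw [hR, card_filter_prod' RP, mul_sum]
    refine (sum_le_sum fun v _ => h1 v).trans ?_
    rw [← mul_sum, sum_add_distrib, sum_add_distrib, h2, h3]
    nlinarith
  set X := leavingDarts H m col with hX
  have hXle : q * #X ≤ 8 * p * E := card_leavingDarts_le hb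
  -- the darts that start at a broken triple
  set Y : Finset (V × V) := {x | H.Adj x.1 x.2 ∧ st x.1 < m ∧ ¬ Intact m col g x.1} with hY
  have hYle : #Y ≤ 3 * #X := by
    rw [hY, hX, leavingDarts, card_filter_prod fun u v => H.Adj u v ∧ st u < m ∧ ¬ Intact m col g u,
      card_filter_prod' fun u v => H.Adj u v ∧ st u < m ∧ col (st u) v = 0, mul_sum]
    refine sum_le_sum fun v _ => ?_
    by_cases hv : st v < m ∧ ¬ Intact m col g v
    · have := codeg_le_of_not_intact hpq hb hv.1 hv.2
      rw [codeg_self] at this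
      simpa [hv] using this
    · simp [hv]
  -- the darts inside a triple of positions
  set Z : Finset (V × V) := {x | pos x.1 / 3 = pos x.2 / 3 ∧ x.1 ≠ x.2} with hZ
  have hZle : #Z ≤ 2 * Fintype.card V := by
    rw [hZ, card_filter_prod fun u v => pos u / 3 = pos v / 3 ∧ u ≠ v]
    calc _ ≤ ∑ u : V, 2 := sum_le_sum fun u _ => ?_
      _ = _ := by simp [mul_comm]
    calc _ ≤ #((Finset.range 3).erase (pos u % 3)) := by
            refine card_le_card_of_injOn (fun v => pos v % 3) (fun v hv => ?_) fun v hv w hw hvw => ?_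
            · simp only [coe_filter, mem_univ, true_and, Set.mem_ofPred_eq] at hv
              simp only [coe_erase, coe_range, Set.mem_sdiff, Set.mem_Iio, Set.mem_singleton_iff]
              refine ⟨by omega, fun h => hv.2 (hinj ?_)⟩
              omega
            · simp only [coe_filter, mem_univ, true_and, Set.mem_ofPred_eq] at hv hw hvw
              apply hinj
              omega
      _ = 2 := by
            rw [card_erase_of_mem (by simp; omega)]; simp
  have i1 : Function.Injective fun x : V × V => (σ x.1, x.2) := fun x y h => by
    simp only [Prod.mk.injEq] at h; exact Prod.ext (hσinj h.1) h.2
  have i2 : Function.Injective fun x : V × V => (σ (σ x.1), x.2) := fun x y h => by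
    simp only [Prod.mk.injEq] at h; exact Prod.ext (hσinj (hσinj h.1)) h.2
  have hsw : Function.Injective (Prod.swap : V × V → V × V) := Prod.swap_injective
  -- the pairs for which the triple of the first vertex meets that of the second one badly
  set S : Finset (V × V) := R ∪ (pullback (fun x => (σ x.1, x.2)) R ∪
    pullback (fun x => (σ (σ x.1), x.2)) R) with hS
  have hSle : #S ≤ 3 * #R := by
    rw [hS]
    have := card_union_le R (pullback (fun x => (σ x.1, x.2)) R ∪
      pullback (fun x => (σ (σ x.1), x.2)) R)
    have := card_union_le (pullback (fun x => (σ x.1, x.2)) R) (pullback (fun x => (σ (σ x.1), x.2)) R)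
    have := card_pullback_le (S := R) i1
    have := card_pullback_le (S := R) i2
    omega
  set C : Finset (V × V) := {x | H.Adj x.1 x.2 ∧ ¬ Kept H pos x.1 x.2} with hC
  have hsub : C ⊆ (X ∪ pullback Prod.swap X) ∪ ((Y ∪ pullback Prod.swap Y) ∪
      (Z ∪ (S ∪ pullback Prod.swap S))) := by
    rintro ⟨u, v⟩ huv
    by_contra hnot
    simp only [hC, mem_filter, mem_univ, true_and] at huv
    simp only [mem_union, mem_pullback, mem_filter, mem_univ, true_and, not_or, hX, hY, hZ, hS, hR,
      leavingDarts, Prod.swap] at hnot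
    obtain ⟨huv, hk⟩ := huv
    obtain ⟨⟨nX, nX'⟩, ⟨nY, nY'⟩, nZ, ⟨nS0, nS1, nS2⟩, nS0', nS1', nS2'⟩ := hnot
    have hu := hcov u v huv
    have hv := hcov v u huv.symm
    have Iu : Intact m col g u := by by_contra h; exact nY ⟨huv, hu, h⟩
    have Iv : Intact m col g v := by by_contra h; exact nY' ⟨huv.symm, hv, h⟩
    have huv_st : st u = st v := by
      rcases lt_trichotomy (st u) (st v) with h | h | h
      · exact absurd ⟨huv, hu, col_eq_zero_of_lt h⟩ nX
      · exact h
      · exact absurd ⟨huv.symm, hv, col_eq_zero_of_lt h⟩ nX'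
    have hne : pos u / 3 ≠ pos v / 3 := fun h => nZ ⟨h, huv.ne⟩
    set i := st u with hi
    have b := hb i hu
    -- the vertex of the triple with the first label
    have hrep : ∀ a, Intact m col g a → st a = i → ∃ x, Intact m col g x ∧ st x = i ∧
        col i x = 1 ∧ (a = x ∨ a = σ x ∨ a = σ (σ x)) := by
      intro a ha hai
      have h1 := hI1 a ha
      have h2 := hI1 _ h1.1
      have c0 := hcol a ha
      have c1 := b.col_next a (by rw [← hai]; exact c0)
      have c2 := b.col_next (σ a) (by have := hcol _ h1.1; rwa [h1.2, hai] at this)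
      rw [hai] at c0
      rw [← hai, ← hσI a ha, hai] at c1
      have hg : g i (σ a) = σ (σ a) := by rw [hσI _ h1.1, h1.2, hai]
      rw [hg] at c2
      have c3 := b.col_le c0
      obtain h | h | h : col i a = 1 ∨ col i a = 2 ∨ col i a = 3 := by omega
      · exact ⟨a, ha, hai, h, Or.inl rfl⟩
      · exact ⟨σ (σ a), h2.1, by rw [h2.2, h1.2, hai], by omega, Or.inr (Or.inl (hσ3 a).symm)⟩
      · exact ⟨σ a, h1.1, by rw [h1.2, hai], by omega, Or.inr (Or.inr (hσ3 a).symm)⟩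
    obtain ⟨x, Ix, sx, cx, hux⟩ := hrep u Iu rfl
    obtain ⟨y, Iy, sy, cy, hvy⟩ := hrep v Iv huv_st.symm
    -- labels and positions of the triple of such a vertex
    have hcp : ∀ a, Intact m col g a → st a = i → col i a = 1 →
        (col i (σ a) = 2 ∧ col i (σ (σ a)) = 3) ∧ Consecutive pos a (σ a) (σ (σ a)) := by
      intro a ha hai hca
      have h1 := hI1 a ha
      have h2 := hI1 _ h1.1
      have p0 := hpos a ha
      have p1 := hpos _ h1.1
      have p2 := hpos _ h2.1
      have c1 := b.col_next a (by omega)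
      rw [← hai, ← hσI a ha, hai, hca] at c1
      have c2 := b.col_next (σ a) (by omega)
      have hg : g i (σ a) = σ (σ a) := by rw [hσI _ h1.1, h1.2, hai]
      rw [hg, c1] at c2
      rw [← hσI a ha, hai] at p0
      rw [← hσI _ h1.1, h1.2, hai] at p1
      rw [h2.2, h1.2, hai] at p2
      unfold Consecutive
      omega
    obtain ⟨⟨cx1, cx2⟩, px⟩ := hcp x Ix sx cx
    obtain ⟨⟨cy1, cy2⟩, py⟩ := hcp y Iy sy cy
    -- the nine vertex pairs see no vertex of degree one
    have hrot : ∀ w a, bad w (σ a) ↔ bad w a := fun w a => by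
      simp only [hbad, hσ3, OneNbr.rotate]
    have hbx : ∀ w, (w = u ∨ w = σ u ∨ w = σ (σ u)) → ¬ bad w v := by
      rintro w hw hbw
      have hcw : col (st v) w ≠ 0 := by
        rw [← huv_st]
        have h1 := hI1 u Iu
        have h2 := hI1 _ h1.1
        rcases hw with rfl | rfl | rfl
        · exact hcol _ Iu
        · have := hcol _ h1.1; rwa [h1.2] at this
        · have := hcol _ h2.1; rwa [h2.2, h1.2] at this
      rcases hw with rfl | rfl | rfl
      · exact nS0 ⟨Iv, hcw, hbw⟩
      · exact nS1 ⟨Iv, hcw, hbw⟩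
      · exact nS2 ⟨Iv, hcw, hbw⟩
    have hby : ∀ w, (w = v ∨ w = σ v ∨ w = σ (σ v)) → ¬ bad w u := by
      rintro w hw hbw
      have hcw : col (st u) w ≠ 0 := by
        rw [← hi, huv_st]
        have h1 := hI1 v Iv
        have h2 := hI1 _ h1.1
        rcases hw with rfl | rfl | rfl
        · exact hcol _ Iv
        · have := hcol _ h1.1; rwa [h1.2] at this
        · have := hcol _ h2.1; rwa [h2.2, h1.2] at this
      rcases hw with rfl | rfl | rfl
      · exact nS0' ⟨Iu, hcw, hbw⟩
      · exact nS1' ⟨Iu, hcw, hbw⟩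
      · exact nS2' ⟨Iu, hcw, hbw⟩
    have hvb : ∀ w, bad w v ↔ bad w y := fun w => by
      rcases hvy with rfl | rfl | rfl <;> simp only [hrot]
    have hub : ∀ w, bad w u ↔ bad w x := fun w => by
      rcases hux with rfl | rfl | rfl <;> simp only [hrot]
    have hbx' : ∀ w, (w = x ∨ w = σ x ∨ w = σ (σ x)) → ¬ bad w y := fun w hw =>
      (hvb w).not.1 (hbx w (orbit_subset hσ3 hux hw))
    have hby' : ∀ w, (w = y ∨ w = σ y ∨ w = σ (σ y)) → ¬ bad w x := fun w hw =>
      (hub w).not.1 (hby w (orbit_subset hσ3 hvy hw))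
    have n0 : ¬ H.Adj x y := fun h => b.proper _ _ (by omega) h (by omega)
    have n1 : ¬ H.Adj (σ x) (σ y) := fun h => b.proper _ _ (by omega) h (by omega)
    have n2 : ¬ H.Adj (σ (σ x)) (σ (σ y)) := fun h => b.proper _ _ (by omega) h (by omega)
    exact hk (kept_of_not_oneNbr hinj px py n0 n1 n2 hbx' hby' hux hvy huv hne)
  have hCle : #C ≤ 2 * #X + (2 * #Y + (#Z + 2 * #S)) := by
    refine (card_le_card hsub).trans ((card_union_le _ _).trans
      (Nat.add_le_add (card_union_pullback_le hsw) ((card_union_le _ _).trans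
      (Nat.add_le_add (card_union_pullback_le hsw) ((card_union_le _ _).trans
      (Nat.add_le_add_left (card_union_pullback_le hsw) _))))))
  calc q * #C ≤ q * (8 * #X + 2 * Fintype.card V + 6 * #R) := Nat.mul_le_mul_left _ (by omega)
    _ = 8 * (q * #X) + 2 * q * Fintype.card V + 6 * (q * #R) := by ring
    _ ≤ 8 * (8 * p * E) + 2 * q * Fintype.card V + 6 * (72 * p * E) := by omega
    _ = _ := by ring

end Lost

/-! ### The components of the true triples -/

section Components

open Finset Classical

variable {V β : Type*}

/-- Triples of pairwise mates. -/
def IsNode [Fintype V] (H : SimpleGraph V) (p q : ℕ) (t : V × V × V) : Prop :=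
  Mate H p q 4 t.1 t.2.1 ∧ Mate H p q 4 t.2.1 t.2.2 ∧ Mate H p q 4 t.1 t.2.2

/-- All six edges between differently labelled vertices of the two triples are present. -/
def Linked (H : SimpleGraph V) (t t' : V × V × V) : Prop :=
  H.Adj t.1 t'.2.1 ∧ H.Adj t.1 t'.2.2 ∧ H.Adj t.2.1 t'.1 ∧ H.Adj t.2.1 t'.2.2 ∧
    H.Adj t.2.2 t'.1 ∧ H.Adj t.2.2 t'.2.1

theorem Linked.symm {H : SimpleGraph V} {t t' : V × V × V} (h : Linked H t t') : Linked H t' t :=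
  ⟨h.2.2.1.symm, h.2.2.2.2.1.symm, h.1.symm, h.2.2.2.2.2.symm, h.2.1.symm, h.2.2.2.1.symm⟩

/-- A set of triples that is closed under passing to linked triples of mates. -/
def LinkClosed [Fintype V] (H : SimpleGraph V) (p q : ℕ) (S : Set (V × V × V)) : Prop :=
  ∀ t ∈ S, ∀ t', IsNode H p q t' → Linked H t t' → t' ∈ S

/-- The number of neighbours of `h` in `G`. -/
noncomputable def nbrs [Fintype β] (G : SimpleGraph β) (h : β) : ℕ := #{k | G.Adj h k}

/-- Under the bijection `e` of the vertices with those of `K₃ × G`, `H` is a subgraph in which at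
most a fraction `p / q` of the edges at any vertex is missing. -/
structure Near [Fintype V] [Fintype β] (H : SimpleGraph V) (G : SimpleGraph β) (e : V ≃ Fin 3 × β)
    (p q : ℕ) : Prop where
  sub : ∀ u v, H.Adj u v → (e u).1 ≠ (e v).1 ∧ G.Adj (e u).2 (e v).2
  miss : ∀ v, q * #{w | ((e v).1 ≠ (e w).1 ∧ G.Adj (e v).2 (e w).2) ∧ ¬ H.Adj v w} ≤
    2 * p * nbrs G (e v).2

namespace Near

variable [Fintype V] [Fintype β] {H : SimpleGraph V} {G : SimpleGraph β} {e : V ≃ Fin 3 × β}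
  {p q : ℕ}

/-- The number of edges of `K₃ × G` at `v` that are missing in `H`. -/
noncomputable def missing (H : SimpleGraph V) (G : SimpleGraph β) (e : V ≃ Fin 3 × β) (v : V) : ℕ :=
  #{w | ((e v).1 ≠ (e w).1 ∧ G.Adj (e v).2 (e w).2) ∧ ¬ H.Adj v w}

/-- Some edge of `K₃ × G` from `v` to the triple of `k` is missing in `H`. -/
def Misses (H : SimpleGraph V) (G : SimpleGraph β) (e : V ≃ Fin 3 × β) (v : V) (k : β) : Prop :=
  G.Adj (e v).2 k ∧ ∃ j, (e v).1 ≠ j ∧ ¬ H.Adj v (e.symm (j, k))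

theorem card_misses_le (v : V) : #{k | Misses H G e v k} ≤ missing H G e v := by
  have : ({k | Misses H G e v k} : Finset β) ⊆ ({w | ((e v).1 ≠ (e w).1 ∧ G.Adj (e v).2 (e w).2) ∧
      ¬ H.Adj v w} : Finset V).image fun w => (e w).2 := by
    intro k hk
    simp only [mem_filter, mem_univ, true_and] at hk
    obtain ⟨h1, j, hj, h2⟩ := hk
    exact mem_image.2 ⟨e.symm (j, k), by simp [h1, h2, hj], by simp⟩
  exact (card_le_card this).trans card_image_le

/-- The number of common neighbours in `G`. -/
noncomputable def common (G : SimpleGraph β) (h h' : β) : ℕ := #{k | G.Adj h k ∧ G.Adj h' k}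

theorem common_le_left (h h' : β) : common G h h' ≤ nbrs G h :=
  card_le_card fun k hk => by simp only [mem_filter, mem_univ, true_and] at hk ⊢; exact hk.1

theorem common_le_right (h h' : β) : common G h h' ≤ nbrs G h' :=
  card_le_card fun k hk => by simp only [mem_filter, mem_univ, true_and] at hk ⊢; exact hk.2

theorem nbrs_le_common_add (h h' h'' : β) :
    common G h h' + common G h' h'' ≤ common G h h'' + nbrs G h' := by
  simp only [common, nbrs, card_filter, ← sum_add_distrib]
  refine sum_le_sum fun k _ => ?_
  by_cases a : G.Adj h k <;> by_cases b : G.Adj h' k <;> by_cases c : G.Adj h'' k <;> simp [a, b, c]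

variable (N : Near H G e p q)
include N

theorem deg_add_missing (v : V) : codeg H v v + missing H G e v = 2 * nbrs G (e v).2 := by
  have h1 : codeg H v v + missing H G e v = #{w | (e v).1 ≠ (e w).1 ∧ G.Adj (e v).2 (e w).2} := by
    simp only [codeg, missing, card_filter, ← sum_add_distrib]
    refine sum_congr rfl fun w _ => ?_
    by_cases h : H.Adj v w
    · have := N.sub v w h; simp [h, this]
    · simp [h]
  rw [h1]
  have h2 : #{w | (e v).1 ≠ (e w).1 ∧ G.Adj (e v).2 (e w).2} =
      #((univ.erase (e v).1) ×ˢ ({k | G.Adj (e v).2 k} : Finset β)) := by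
    refine card_equiv e fun w => ?_
    simp [eq_comm]
  rw [h2, card_product, card_erase_of_mem (mem_univ _)]
  simp [nbrs]

theorem codeg_le_common {u v : V} (h : (e u).1 ≠ (e v).1) :
    codeg H u v ≤ common G (e u).2 (e v).2 := by
  refine card_le_card_of_injOn (fun w => (e w).2) (fun w hw => ?_) fun w hw w' hw' hww' => ?_
  · simp only [coe_filter, mem_univ, true_and, Set.mem_ofPred_eq] at hw ⊢
    exact ⟨(N.sub _ _ hw.1).2, (N.sub _ _ hw.2).2⟩
  · simp only [coe_filter, mem_univ, true_and, Set.mem_ofPred_eq] at hw hw' hww'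
    have a1 := (N.sub _ _ hw.1).1
    have a2 := (N.sub _ _ hw.2).1
    have a3 := (N.sub _ _ hw'.1).1
    have a4 := (N.sub _ _ hw'.2).1
    refine e.injective (Prod.ext ?_ hww')
    omega

omit N in
theorem common_le_codeg_add {u v : V} (h : (e u).1 ≠ (e v).1) :
    common G (e u).2 (e v).2 ≤ codeg H u v + missing H G e u + missing H G e v := by
  obtain ⟨l, hl, hl'⟩ : ∃ l : Fin 3, (e u).1 ≠ l ∧ (e v).1 ≠ l := by
    generalize (e u).1 = a at h; generalize (e v).1 = b at h; revert a b; decide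
  have h1 : #{k | H.Adj u (e.symm (l, k)) ∧ H.Adj v (e.symm (l, k))} ≤ codeg H u v :=
    card_le_card_of_injOn (fun k => e.symm (l, k)) (fun k hk => by simpa using hk)
      fun k _ k' _ hkk' => by simpa using hkk'
  have h2 := card_misses_le (H := H) (G := G) (e := e) u
  have h3 := card_misses_le (H := H) (G := G) (e := e) v
  have h4 : ({k | G.Adj (e u).2 k ∧ G.Adj (e v).2 k} : Finset β) ⊆
      ({k | H.Adj u (e.symm (l, k)) ∧ H.Adj v (e.symm (l, k))} : Finset β) ∪
      ({k | Misses H G e u k} : Finset β) ∪ ({k | Misses H G e v k} : Finset β) := by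
    intro k hk
    simp only [mem_union, mem_filter, mem_univ, true_and] at hk ⊢
    by_cases a : H.Adj u (e.symm (l, k))
    · by_cases b : H.Adj v (e.symm (l, k))
      · exact Or.inl (Or.inl ⟨a, b⟩)
      · exact Or.inr ⟨hk.2, l, hl', b⟩
    · exact Or.inl (Or.inr ⟨hk.1, l, hl, a⟩)
  have h5 := (card_le_card h4).trans (card_union_le _ _)
  have h6 := card_union_le ({k | H.Adj u (e.symm (l, k)) ∧ H.Adj v (e.symm (l, k))} : Finset β)
    ({k | Misses H G e u k} : Finset β)
  unfold common
  omega

theorem q_missing_le (v : V) : q * missing H G e v ≤ 2 * p * nbrs G (e v).2 := N.miss v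

theorem mate_of_snd_eq (hpq : 4 * p ≤ q) {u v : V} (h : (e u).1 ≠ (e v).1)
    (h' : (e u).2 = (e v).2) : Mate H p q 4 u v := by
  have h1 := common_le_codeg_add (H := H) (G := G) h
  have hu := N.deg_add_missing u
  have hv := N.deg_add_missing v
  have mu := N.q_missing_le u
  have mv := N.q_missing_le v
  have hc : common G (e u).2 (e v).2 = nbrs G (e v).2 := by rw [h']; simp [common, nbrs]
  rw [h'] at hu mu
  rw [hc] at h1
  unfold Mate
  set d := nbrs G (e v).2
  have hz : (0 : ℤ) ≤ q - 4 * p := by omega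
  zify [hpq] at *
  constructor <;> nlinarith [mul_nonneg hz (Int.natCast_nonneg (missing H G e u)),
    mul_nonneg hz (Int.natCast_nonneg (missing H G e v))]

theorem common_ge (hpq : 540 * p < q) {u v : V} (h : (e u).1 ≠ (e v).1) (hm : Mate H p q 4 u v) :
    (q - 5 * p) * nbrs G (e u).2 ≤ q * common G (e u).2 (e v).2 ∧
      (q - 5 * p) * nbrs G (e v).2 ≤ q * common G (e u).2 (e v).2 := by
  have hc := N.codeg_le_common h
  have aux : ∀ w, (q - 4 * p) * codeg H w w ≤ 2 * q * codeg H u v →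
      (q - 5 * p) * nbrs G (e w).2 ≤ q * common G (e u).2 (e v).2 := by
    intro w hw
    have hd := N.deg_add_missing w
    have mw := N.q_missing_le w
    have h4 : 4 * p ≤ q := by omega
    have h5 : 5 * p ≤ q := by omega
    zify [h4, h5] at *
    have hq : (0 : ℤ) < q := by linarith
    set d := (nbrs G (e w).2 : ℤ)
    have hd0 : 0 ≤ d := Int.natCast_nonneg _
    have hD : (codeg H w w : ℤ) = 2 * d - missing H G e w := by linarith
    rw [hD] at hw
    -- (q - 4p)(2d - m) ≥ (q - 4p) 2d - q m ≥ (q - 4p) 2d - 2pd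
    have hm0 : (0 : ℤ) ≤ p * missing H G e w := by positivity
    have k1 : (q : ℤ) * codeg H u v ≤ q * common G (e u).2 (e v).2 := by gcongr
    nlinarith
  exact ⟨aux u hm.1, aux v hm.2⟩

/-- Being mates is transitive for differently labelled vertices, with a worse constant. -/
theorem mate_trans (hpq : 540 * p < q) {u v w : V} (huv : (e u).1 ≠ (e v).1)
    (hvw : (e v).1 ≠ (e w).1) (huw : (e u).1 ≠ (e w).1) (h : Mate H p q 4 u v)
    (h' : Mate H p q 4 v w) : Mate H p q 16 u w := by
  obtain ⟨a1, a2⟩ := N.common_ge hpq huv h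
  obtain ⟨b1, b2⟩ := N.common_ge hpq hvw h'
  have h1 := common_le_codeg_add (H := H) (G := G) huw
  have h2 := nbrs_le_common_add (G := G) (e u).2 (e v).2 (e w).2
  have c1 := common_le_left (G := G) (e u).2 (e v).2
  have c2 := common_le_right (G := G) (e u).2 (e v).2
  have c3 := common_le_left (G := G) (e v).2 (e w).2
  have c4 := common_le_right (G := G) (e v).2 (e w).2
  have du := N.deg_add_missing u
  have dw := N.deg_add_missing w
  have mu := N.q_missing_le u
  have mw := N.q_missing_le w
  unfold Mate
  set x := nbrs G (e u).2
  set y := nbrs G (e v).2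
  set z := nbrs G (e w).2
  have h5 : 5 * p ≤ q := by omega
  have h16 : 16 * p ≤ q := by omega
  have hz16 : (0 : ℤ) ≤ q - 16 * p := by omega
  have hpq' : (540 : ℤ) * p < q := by exact_mod_cast hpq
  zify [h5, h16] at *
  have hp : (0 : ℤ) ≤ p := Int.natCast_nonneg p
  have hq : (0 : ℤ) < q := by linarith
  have step : ∀ a b i : ℤ, 0 ≤ a → (q - 5 * p) * a ≤ q * i → i ≤ b → 535 * a ≤ 540 * b := by
    intro a b i ha h1 h2
    refine le_of_mul_le_mul_left ?_ hq
    have := mul_le_mul_of_nonneg_left h2 hq.le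
    nlinarith
  have hx0 : (0 : ℤ) ≤ x := Int.natCast_nonneg _
  have hy0 : (0 : ℤ) ≤ y := Int.natCast_nonneg _
  have hz0 : (0 : ℤ) ≤ z := Int.natCast_nonneg _
  have yx := step y x _ hy0 a2 c1
  have zy := step z y _ hz0 b2 c3
  have xy := step x y _ hx0 a1 c2
  have yz := step y z _ hy0 b1 c4
  have e1 := mul_le_mul_of_nonneg_left h1 hq.le
  have e2 := mul_le_mul_of_nonneg_left h2 hq.le
  have f1 : (p : ℤ) * (5 * y + 2 * z) ≤ p * (9 * x) := mul_le_mul_of_nonneg_left (by linarith) hp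
  have f2 : (p : ℤ) * (5 * y + 2 * x) ≤ p * (9 * z) := mul_le_mul_of_nonneg_left (by linarith) hp
  have g1 := mul_nonneg hz16 (Int.natCast_nonneg (missing H G e u))
  have g2 := mul_nonneg hz16 (Int.natCast_nonneg (missing H G e w))
  constructor <;> nlinarith

/-- For a triple `u, v, w` of mates with distinct labels, some vertex `k` of `G` has all its edges
to `u`, `v`, `w` and to the true triple of `u`: nearly all neighbours of `u` in `G` are also
neighbours of `v` and of `w`, and few are spoiled by missing edges. -/
theorem exists_common_nbr (hpq : 540 * p < q) {u v w : V} (huv : (e u).1 ≠ (e v).1)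
    (huw : (e u).1 ≠ (e w).1) (h1 : Mate H p q 4 u v) (h3 : Mate H p q 4 u w) (hpos : 0 < nbrs G (e u).2) :
    ∃ k, G.Adj (e u).2 k ∧ G.Adj (e v).2 k ∧ G.Adj (e w).2 k ∧ ¬ Misses H G e u k ∧
      ¬ Misses H G e v k ∧ ¬ Misses H G e w k ∧ ∀ i, ¬ Misses H G e (e.symm (i, (e u).2)) k := by
  obtain ⟨a1, a2⟩ := N.common_ge hpq huv h1
  obtain ⟨b1, b2⟩ := N.common_ge hpq huw h3
  by_contra hno
  push Not at hno
  set u' : Fin 3 → V := fun i => e.symm (i, (e u).2) with hu'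
  have hsub : ({k | G.Adj (e u).2 k} : Finset β) ⊆
      (({k | G.Adj (e u).2 k ∧ ¬ G.Adj (e v).2 k} : Finset β) ∪
      ({k | G.Adj (e u).2 k ∧ ¬ G.Adj (e w).2 k} : Finset β)) ∪
      ((({k | Misses H G e u k} : Finset β) ∪ ({k | Misses H G e v k} : Finset β)) ∪
      (({k | Misses H G e w k} : Finset β) ∪ univ.biUnion fun i => {k | Misses H G e (u' i) k})) := by
    intro k hk
    have := hno k
    simp only [mem_union, mem_filter, mem_univ, true_and, mem_biUnion] at hk ⊢
    by_contra hcon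
    push Not at hcon
    obtain ⟨⟨n1, n2⟩, ⟨n3, n4⟩, n5, n6⟩ := hcon
    obtain ⟨i, hi⟩ := hno k hk (n1 hk) (n2 hk) n3 n4 n5
    exact n6 i hi
  have hcard := (card_le_card hsub).trans ((card_union_le _ _).trans (Nat.add_le_add
    (card_union_le _ _) ((card_union_le _ _).trans (Nat.add_le_add (card_union_le _ _)
      ((card_union_le _ _).trans (Nat.add_le_add_left card_biUnion_le _))))))
  have hdiff : ∀ x, #{k | G.Adj (e u).2 k ∧ ¬ G.Adj (e x).2 k} + common G (e u).2 (e x).2 =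
      nbrs G (e u).2 := by
    intro x
    simp only [common, nbrs, card_filter, ← sum_add_distrib]
    refine sum_congr rfl fun k _ => ?_
    by_cases a : G.Adj (e u).2 k <;> by_cases b : G.Adj (e x).2 k <;> simp [a, b]
  have d1 := hdiff v
  have d2 := hdiff w
  have m1 := card_misses_le (H := H) (G := G) (e := e) u
  have m2 := card_misses_le (H := H) (G := G) (e := e) v
  have m3 := card_misses_le (H := H) (G := G) (e := e) w
  have m4 : ∑ i, #{k | Misses H G e (u' i) k} ≤ missing H G e (u' 0) + missing H G e (u' 1) + missing H G e (u' 2) := by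
    rw [← Fin.sum_univ_three fun i => missing H G e (u' i)]
    exact sum_le_sum fun i _ => card_misses_le _
  have q1 := N.q_missing_le u
  have q2 := N.q_missing_le v
  have q3 := N.q_missing_le w
  have q4 := N.q_missing_le (u' 0)
  have q5 := N.q_missing_le (u' 1)
  have q6 := N.q_missing_le (u' 2)
  simp only [hu', Equiv.apply_symm_apply] at q4 q5 q6
  have c1 := common_le_left (G := G) (e u).2 (e v).2
  have c2 := common_le_left (G := G) (e u).2 (e w).2
  change nbrs G (e u).2 ≤ _ at hcard
  set x := nbrs G (e u).2
  set y := nbrs G (e v).2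
  set z := nbrs G (e w).2
  have tot : x ≤ (x - common G (e u).2 (e v).2) + (x - common G (e u).2 (e w).2) +
      (missing H G e u + missing H G e v + (missing H G e w + (missing H G e (u' 0) + missing H G e (u' 1) + missing H G e (u' 2)))) := by omega
  have h5 : 5 * p ≤ q := by omega
  have hpq' : (540 : ℤ) * p < q := by exact_mod_cast hpq
  clear hno hsub hcard hdiff d1 d2 m1 m2 m3 m4
  have tot' : x + common G (e u).2 (e v).2 + common G (e u).2 (e w).2 ≤ x + x +
      (missing H G e u + missing H G e v + (missing H G e w + (missing H G e (u' 0) + missing H G e (u' 1) + missing H G e (u' 2)))) := by omega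
  clear tot
  simp only [← hu'] at *
  have hx : (0 : ℤ) < x := by exact_mod_cast hpos
  zify [h5] at a1 a2 b1 b2 q1 q2 q3 q4 q5 q6 c1 c2 tot'
  have hp : (0 : ℤ) ≤ p := Int.natCast_nonneg p
  have hq : (0 : ℤ) < q := by linarith
  have step : ∀ a b i : ℤ, 0 ≤ a → (q - 5 * p) * a ≤ q * i → i ≤ b → 535 * a ≤ 540 * b := by
    intro a b i ha h1 h2
    refine le_of_mul_le_mul_left ?_ hq
    have := mul_le_mul_of_nonneg_left h2 hq.le
    nlinarith
  have yx := step y x _ (Int.natCast_nonneg _) a2 c1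
  have zx := step z x _ (Int.natCast_nonneg _) b2 c2
  have e1 := mul_le_mul_of_nonneg_left tot' hq.le
  have f1 : (p : ℤ) * (535 * y + 535 * z) ≤ p * (1080 * x) :=
    mul_le_mul_of_nonneg_left (by linarith) hp
  have f2 := mul_lt_mul_of_pos_right hpq' hx
  nlinarith

end Near

end Components

/-! ### Components of true triples are blocks -/

section Components

open Finset Classical

variable {V β : Type*} [Fintype V]

theorem Mate.mono {H : SimpleGraph V} {p q κ κ' : ℕ} (h : κ ≤ κ') {u v : V} (hm : Mate H p q κ u v) :
    Mate H p q κ' u v := by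
  have : q - κ' * p ≤ q - κ * p := Nat.sub_le_sub_left (Nat.mul_le_mul_right _ h) _
  exact ⟨(Nat.mul_le_mul_right _ this).trans hm.1, (Nat.mul_le_mul_right _ this).trans hm.2⟩

/-- The triple is labelled by the first coordinates in `K₃ × G`, and it is not isolated. -/
def Rainbow (H : SimpleGraph V) (e : V ≃ Fin 3 × β) (t : V × V × V) : Prop :=
  (e t.1).1 = 0 ∧ (e t.2.1).1 = 1 ∧ (e t.2.2).1 = 2 ∧ ∃ w, H.Adj t.1 w

/-- The triple that corresponds to a vertex of `G`. -/
def trueTriple (e : V ≃ Fin 3 × β) (h : β) : V × V × V :=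
  (e.symm (0, h), e.symm (1, h), e.symm (2, h))

namespace Near

variable [Fintype β] {H : SimpleGraph V} {G : SimpleGraph β} {e : V ≃ Fin 3 × β} {p q : ℕ}

theorem nbrs_pos (N : Near H G e p q) {u v : V} (h : H.Adj u v) : 0 < nbrs G (e u).2 :=
  card_pos.2 ⟨(e v).2, by simpa using (N.sub u v h).2⟩

/-- The labels of a triple determine those of the linked triples. -/
theorem rainbow_of_linked (N : Near H G e p q) {t t' : V × V × V} (h : Linked H t t')
    (ht : Rainbow H e t) : Rainbow H e t' := by
  obtain ⟨h1, h2, h3, h4, h5, h6⟩ := h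
  obtain ⟨r1, r2, r3, -⟩ := ht
  have a1 := (N.sub _ _ h1).1
  have a2 := (N.sub _ _ h2).1
  have a3 := (N.sub _ _ h3).1
  have a4 := (N.sub _ _ h4).1
  have a5 := (N.sub _ _ h5).1
  have a6 := (N.sub _ _ h6).1
  refine ⟨?_, ?_, ?_, _, h3.symm⟩ <;> omega

omit [Fintype V] [Fintype β] in
theorem adj_of_not_misses {v : V} {k : β} (hk : G.Adj (e v).2 k) (h : ¬ Misses H G e v k) {j : Fin 3}
    (hj : (e v).1 ≠ j) : H.Adj v (e.symm (j, k)) := by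
  by_contra hne
  exact h ⟨hk, j, hj, hne⟩

theorem isNode_trueTriple (N : Near H G e p q) (hpq : 540 * p < q) (h : β) :
    IsNode H p q (trueTriple e h) := by
  refine ⟨?_, ?_, ?_⟩ <;> exact N.mate_of_snd_eq (by omega) (by simp [trueTriple]) (by simp [trueTriple])

omit [Fintype V] [Fintype β] in
theorem linked_trueTriple {t : V × V × V} {k : β}
    (r1 : (e t.1).1 = 0) (r2 : (e t.2.1).1 = 1) (r3 : (e t.2.2).1 = 2)
    (k1 : G.Adj (e t.1).2 k) (k2 : G.Adj (e t.2.1).2 k) (k3 : G.Adj (e t.2.2).2 k)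
    (m1 : ¬ Misses H G e t.1 k) (m2 : ¬ Misses H G e t.2.1 k) (m3 : ¬ Misses H G e t.2.2 k) :
    Linked H t (trueTriple e k) := by
  refine ⟨adj_of_not_misses k1 m1 ?_, adj_of_not_misses k1 m1 ?_, adj_of_not_misses k2 m2 ?_,
    adj_of_not_misses k2 m2 ?_, adj_of_not_misses k3 m3 ?_, adj_of_not_misses k3 m3 ?_⟩ <;>
  simp [r1, r2, r3]

section Closed

variable {S : Set (V × V × V)} (N : Near H G e p q) (hpq : 540 * p < q)
  (hS : LinkClosed H p q S)
include N hpq hS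

/-- If a triple has a common neighbour `k` as in `exists_common_nbr`, then the true triple of one
of its entries belongs to the same component: both are linked with the true triple of `k`. -/
theorem trueTriple_mem_of_common {t : V × V × V} (ht : t ∈ S) (r : Rainbow H e t) {h k : β}
    (k1 : G.Adj (e t.1).2 k) (k2 : G.Adj (e t.2.1).2 k) (k3 : G.Adj (e t.2.2).2 k)
    (m1 : ¬ Misses H G e t.1 k) (m2 : ¬ Misses H G e t.2.1 k) (m3 : ¬ Misses H G e t.2.2 k)
    (hk : G.Adj h k) (m : ∀ i, ¬ Misses H G e (e.symm (i, h)) k) : trueTriple e h ∈ S := by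
  obtain ⟨r1, r2, r3, -⟩ := r
  have h1 := hS t ht _ (N.isNode_trueTriple hpq k)
    (linked_trueTriple r1 r2 r3 k1 k2 k3 m1 m2 m3)
  refine hS _ h1 _ (N.isNode_trueTriple hpq h) (Linked.symm ?_)
  exact linked_trueTriple (by simp [trueTriple]) (by simp [trueTriple])
    (by simp [trueTriple]) (by simpa [trueTriple]) (by simpa [trueTriple]) (by simpa [trueTriple])
    (m 0) (m 1) (m 2)

theorem trueTriple_mem {t : V × V × V} (ht : t ∈ S) (hn : IsNode H p q t) (r : Rainbow H e t) :
    trueTriple e (e t.1).2 ∈ S ∧ trueTriple e (e t.2.1).2 ∈ S ∧ trueTriple e (e t.2.2).2 ∈ S := by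
  obtain ⟨n1, n2, n3⟩ := hn
  have r' := r
  obtain ⟨r1, r2, r3, x, hx⟩ := r'
  have d12 : (e t.1).1 ≠ (e t.2.1).1 := by rw [r1, r2]; decide
  have d23 : (e t.2.1).1 ≠ (e t.2.2).1 := by rw [r2, r3]; decide
  have d13 : (e t.1).1 ≠ (e t.2.2).1 := by rw [r1, r3]; decide
  have p1 : 0 < nbrs G (e t.1).2 := N.nbrs_pos hx
  have hq5 : 0 < q - 5 * p := by omega
  have p2 : 0 < nbrs G (e t.2.1).2 := by
    have h1 := (N.common_ge hpq d12 n1).1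
    have h2 := common_le_right (G := G) (e t.1).2 (e t.2.1).2
    have h3 := Nat.mul_pos hq5 p1
    by_contra h0
    have : common G (e t.1).2 (e t.2.1).2 = 0 := by omega
    rw [this] at h1; omega
  have p3 : 0 < nbrs G (e t.2.2).2 := by
    have h1 := (N.common_ge hpq d13 n3).1
    have h2 := common_le_right (G := G) (e t.1).2 (e t.2.2).2
    have h3 := Nat.mul_pos hq5 p1
    by_contra h0
    have : common G (e t.1).2 (e t.2.2).2 = 0 := by omega
    rw [this] at h1; omega
  refine ⟨?_, ?_, ?_⟩
  · obtain ⟨k, k1, k2, k3, m1, m2, m3, m⟩ := N.exists_common_nbr hpq d12 d13 n1 n3 p1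
    exact N.trueTriple_mem_of_common hpq hS ht r k1 k2 k3 m1 m2 m3 k1 m
  · obtain ⟨k, k2, k1, k3, m2, m1, m3, m⟩ :=
      N.exists_common_nbr hpq d12.symm d23 n1.symm n2 p2
    exact N.trueTriple_mem_of_common hpq hS ht r k1 k2 k3 m1 m2 m3 k2 m
  · obtain ⟨k, k3, k1, k2, m3, m1, m2, m⟩ :=
      N.exists_common_nbr hpq d13.symm d23.symm n3.symm n2.symm p3
    exact N.trueTriple_mem_of_common hpq hS ht r k1 k2 k3 m1 m2 m3 k3 m

/-- Few edges leave the component: if the true triple of `w` is not in it, then one of the six edges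
between the true triples of `v` and of `w` is missing. -/
theorem card_leave_le {v : V} (hv : trueTriple e (e v).2 ∈ S) :
    q * #{w | H.Adj v w ∧ trueTriple e (e w).2 ∉ S} ≤ 8 * p * codeg H v v := by
  set h := (e v).2 with hh
  set K : Finset β := {k | G.Adj h k ∧ trueTriple e k ∉ S} with hK
  have h1 : #{w | H.Adj v w ∧ trueTriple e (e w).2 ∉ S} ≤ 2 * #K := by
    calc _ ≤ #(((univ : Finset (Fin 3)).erase (e v).1) ×ˢ K) := by
          refine card_le_card_of_injOn e (fun w hw => ?_) e.injective.injOn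
          simp only [coe_filter, mem_univ, true_and, Set.mem_ofPred_eq] at hw
          have := N.sub _ _ hw.1
          simp only [coe_product, Set.mem_prod, mem_coe, mem_erase, mem_univ, and_true, hK,
            mem_filter, true_and]
          exact ⟨this.1.symm, this.2, hw.2⟩
      _ = 2 * #K := by rw [card_product, card_erase_of_mem (mem_univ _)]; simp
  have h2 : K ⊆ univ.biUnion fun i : Fin 3 =>
      ({k | Misses H G e (e.symm (i, h)) k} : Finset β) := by
    intro k hk
    simp only [hK, mem_filter, mem_univ, true_and, mem_biUnion] at hk ⊢
    by_contra hcon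
    push Not at hcon
    refine hk.2 (hS _ hv _ (N.isNode_trueTriple hpq k) ?_)
    exact linked_trueTriple (by simp [trueTriple]) (by simp [trueTriple])
      (by simp [trueTriple]) (by simpa [trueTriple] using hk.1) (by simpa [trueTriple] using hk.1)
      (by simpa [trueTriple] using hk.1) (hcon 0) (hcon 1) (hcon 2)
  have h3 : #K ≤ ∑ i : Fin 3, missing H G e (e.symm (i, h)) :=
    (card_le_card h2).trans (card_biUnion_le.trans (sum_le_sum fun i _ => card_misses_le _))
  rw [Fin.sum_univ_three] at h3
  have q0 := N.q_missing_le (e.symm (0, h))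
  have q1 := N.q_missing_le (e.symm (1, h))
  have q2 := N.q_missing_le (e.symm (2, h))
  have qv := N.q_missing_le v
  have dv := N.deg_add_missing v
  simp only [Equiv.apply_symm_apply] at q0 q1 q2
  rw [← hh] at qv dv
  set L := #{w | H.Adj v w ∧ trueTriple e (e w).2 ∉ S}
  set d := nbrs G h
  have e1 : q * L ≤ 12 * p * d := by
    have := Nat.mul_le_mul_left q (h1.trans (Nat.mul_le_mul_left 2 h3))
    nlinarith
  have e2 : 3 * d ≤ 2 * codeg H v v := by
    have hq : 0 < q := by omega
    have h0 : p * d * 540 ≤ q * d := by nlinarith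
    refine le_of_mul_le_mul_left ?_ hq
    nlinarith
  have e3 := Nat.mul_le_mul_left (4 * p) e2
  nlinarith

/-- In the component of a true triple, every matching of mates gives a block; the third pair of a
triple consists of mates by `mate_trans`. -/
theorem block {col : V → ℕ} (hcol : ∀ v, col v = if trueTriple e (e v).2 ∈ S then ((e v).1 : ℕ) + 1 else 0)
    {g : V → V} (hg : ∀ v, col v = 1 ∨ col v = 2 → col (g v) = col v + 1 ∧ Mate H p q 4 v (g v))
    (hc : ∀ x, col x = 1 → g (g (g x)) = x) (h2 : ∀ y, col y = 2 → ∃ x, col x = 1 ∧ g x = y)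
    (h3 : ∀ z, col z = 3 → ∃ x, col x = 1 ∧ g (g x) = z) : Block H p q col g := by
  have hle : ∀ v, col v ≤ 3 := fun v => by rw [hcol]; split <;> omega
  have h123 : ∀ v, col v ≠ 0 → col v = 1 ∨ col v = 2 ∨ col v = 3 := fun v hv => by
    have := hle v; omega
  have hlab : ∀ v, col v ≠ 0 → ((e v).1 : ℕ) + 1 = col v ∧ trueTriple e (e v).2 ∈ S := fun v hv => by
    rw [hcol] at hv ⊢
    split at hv
    · simp_all
    · omega
  constructor
  · intro v hv
    obtain h | h | h := h123 v hv
    · rw [(hg v (Or.inl h)).1, h]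
    · rw [(hg v (Or.inr h)).1, h]
    · obtain ⟨x, hx, rfl⟩ := h3 v h
      rw [hc x hx, h, hx]
  · intro v hv
    obtain h | h | h := h123 v hv
    · exact hc v h
    · obtain ⟨x, hx, rfl⟩ := h2 v h
      rw [hc x hx]
    · obtain ⟨x, hx, rfl⟩ := h3 v h
      rw [hc x hx]
  · intro v hv
    obtain h | h | h := h123 v hv
    · exact (hg v (Or.inl h)).2.mono (by omega)
    · exact (hg v (Or.inr h)).2.mono (by omega)
    · obtain ⟨x, hx, rfl⟩ := h3 v h
      rw [hc x hx]
      have a1 := hg x (Or.inl hx)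
      have a2 := hg (g x) (Or.inr (by omega))
      have b0 := hlab x (by omega)
      have b1 := hlab (g x) (by omega)
      have b2 := hlab (g (g x)) (by omega)
      exact (N.mate_trans hpq (by omega) (by omega) (by omega) a1.2 a2.2).symm
  · intro v hv
    have : ∀ w, col w = 0 ↔ trueTriple e (e w).2 ∉ S := fun w =>
      ⟨fun h hmem => by have := hcol w; rw [if_pos hmem] at this; omega,
        fun h => by rw [hcol, if_neg h]⟩
    simp only [this]
    exact N.card_leave_le hpq hS (hlab v hv).2
  · intro v w hv hvw hcw
    have h1 := hlab v hv
    have h2 := hlab w (by omega)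
    have := (N.sub v w hvw).1
    omega

end Closed

end Near

end Components

namespace Imp

open Finset Classical

/-! ### The codegree table

Throughout, the variables `0` and `1` hold `p` and `q`. The array `0` holds the codegrees, `1` and `2`
the labels and the marks of the search for the components, `3` the colours, `4`, `5`, `6` the
successors, owners and prices of the matching, `7` marks the vertices of the accepted blocks, and `8`,
`9`, `10` hold the vertex at each position, the position of each vertex, and whether it has one.
Where an entry may be undefined, a number is stored plus one. -/

/-- The two stores agree except for the variables in `l`. -/
structure EqOff (l : List ℕ) (s s' : Store) : Prop where
  var : ∀ w ∉ l, s'.var w = s.var w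
  arr : s'.arr = s.arr
  io : s'.io = s.io

theorem mul_add_lt_sq {N u v : ℕ} (hu : u < N) (hv : v < N) : u * N + v < N * N := by
  have := Nat.mul_le_mul_right N (Nat.succ_le_of_lt hu)
  rw [Nat.succ_mul] at this
  omega

theorem mul_add_inj {N u v u' v' : ℕ} (hv : v < N) (hv' : v' < N) :
    u * N + v = u' * N + v' ↔ u = u' ∧ v = v' := by
  refine ⟨fun h => ?_, fun ⟨h1, h2⟩ => by rw [h1, h2]⟩
  have hN : 0 < N := by omega
  have h1 : u = u' := by
    have := congrArg (· / N) h
    simpa [Nat.add_div_of_dvd_right, Nat.mul_div_cancel _ hN, Nat.div_eq_of_lt hv,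
      Nat.div_eq_of_lt hv'] using this
  subst h1
  exact ⟨rfl, by omega⟩

/-- A loop that counts the `i` with a given property in the variable `c`. -/
theorem run_count {N B : ℕ} (hB : N ≤ B) {v c : ℕ} (hvc : v ≠ c) {e : Exp} {s : Store} (hc : s.var c = 0)
    {P : Fin N → Prop} [DecidablePred P]
    (he : ∀ (i : Fin N) s', EqOff [v, c] s s' → s'.var v = i → (e.eval N B s' ≠ 0 ↔ P i)) :
    ((Cmd.loop v 1 (.ite e (.set c (.var c + 1)) .skip)).run N B s).var c = #{i | P i} := by
  have key := run_loop_inv (N := N) (B := B) (v := v) (d := 1) (c := .ite e (.set c (.var c + 1)) .skip)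
    (s := s) (fun k s' => EqOff [v, c] s s' ∧ s'.var c = #{i : Fin N | (i : ℕ) < k ∧ P i})
    ⟨⟨fun _ _ => rfl, rfl, rfl⟩, by simp [hc]⟩ ?_
  · rw [key.2]
    congr 1
    ext i
    simp
  · intro i hi s' ⟨h1, h2⟩
    rw [pow_one] at hi
    have hoff : EqOff [v, c] s (s'.setVar v i) := by
      refine ⟨fun w hw => ?_, h1.arr, h1.io⟩
      simp only [List.mem_cons, List.not_mem_nil, or_false, not_or] at hw
      simp [hw.1, h1.var w (by simp [hw])]
    have hei := he ⟨i, hi⟩ _ hoff (by simp)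
    have hvc' : (s'.setVar v i).var c = s'.var c := by simp [hvc.symm]
    by_cases hP : P ⟨i, hi⟩
    · have hins : ({j : Fin N | (j : ℕ) < i + 1 ∧ P j} : Finset (Fin N)) =
          insert ⟨i, hi⟩ ({j : Fin N | (j : ℕ) < i ∧ P j} : Finset (Fin N)) := by
        ext j
        simp only [mem_filter, mem_univ, true_and, mem_insert, Fin.ext_iff]
        constructor
        · rintro ⟨h, h'⟩
          by_cases hj : (j : ℕ) = i
          · exact Or.inl hj
          · exact Or.inr ⟨by omega, h'⟩
        · rintro (h | h)
          · have : j = ⟨i, hi⟩ := Fin.ext h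
            exact ⟨by omega, this ▸ hP⟩
          · exact ⟨by omega, h.2⟩
      have hcard : #{j : Fin N | (j : ℕ) < i + 1 ∧ P j} = s'.var c + 1 := by
        rw [hins, card_insert_of_notMem (by simp), h2]
      have hle : s'.var c + 1 ≤ B := by
        rw [← hcard]
        exact ((card_le_univ _).trans (by simp)).trans hB
      rw [run_ite_pos _ _ _ _ _ (hei.2 hP), run_set _ _ _ _ _ (x := s'.var c + 1) (by simp [hvc.symm]) hle]
      refine ⟨⟨fun w hw => ?_, hoff.arr, hoff.io⟩, by rw [hcard, setVar_var, if_pos rfl]⟩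
      simp only [List.mem_cons, List.not_mem_nil, or_false, not_or] at hw
      simp [hw.1, hw.2, h1.var w (by simp [hw])]
    · rw [run_ite_neg _ _ _ _ _ (by by_contra h; exact hP (hei.1 h))]
      refine ⟨hoff, ?_⟩
      rw [Cmd.run, hvc', h2]
      congr 1
      ext j
      simp only [mem_filter, mem_univ, true_and]
      refine ⟨fun ⟨h, h'⟩ => ⟨by omega, h'⟩, fun ⟨h, h'⟩ => ⟨?_, h'⟩⟩
      by_contra hj
      have : j = ⟨i, hi⟩ := Fin.ext (by simp; omega)
      exact hP (this ▸ h')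

/-- Adjacency in the input graph. -/
def adjE (a b : Exp) : Exp := .io (a * .n + b)

/-- The codegree. -/
def codegE (a b : Exp) : Exp := .arr 0 (a * .n + b)

/-- Being `κ`-mates; the variables `0` and `1` hold `p` and `q`. -/
def mateE (κ : ℕ) (a b : Exp) : Exp :=
  ((2 * .var 1 * codegE a b).lt ((.var 1 - .lit κ * .var 0) * codegE a a)).not *
    ((2 * .var 1 * codegE a b).lt ((.var 1 - .lit κ * .var 0) * codegE b b)).not

/-- The input/output area holds the adjacency matrix of `H`, and the variables `0` and `1` hold
`p` and `q`. -/
structure HasInput {N : ℕ} (H : SimpleGraph (Fin N)) (p q : ℕ) (s : Store) : Prop where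
  p : s.var 0 = p
  q : s.var 1 = q
  adj : ∀ u v : Fin N, s.io (u * N + v) = adjBit H u v

/-- Moreover, the array `0` holds the codegrees. -/
structure Ctx {N : ℕ} (H : SimpleGraph (Fin N)) (p q : ℕ) (s : Store) : Prop
    extends HasInput H p q s where
  codeg : ∀ u v : Fin N, s.arr 0 (u * N + v) = codeg H u v

section Spec

variable {N p q : ℕ} {H : SimpleGraph (Fin N)} {B : ℕ}

theorem HasInput.congr {s s' : Store} (h : HasInput H p q s) (h0 : s'.var 0 = s.var 0)
    (h1 : s'.var 1 = s.var 1) (hio : s'.io = s.io) : HasInput H p q s' :=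
  ⟨by rw [h0, h.p], by rw [h1, h.q], by rw [hio]; exact h.adj⟩

theorem Ctx.congr {s s' : Store} (h : Ctx H p q s) (h0 : s'.var 0 = s.var 0)
    (h1 : s'.var 1 = s.var 1) (hio : s'.io = s.io) (ha : s'.arr 0 = s.arr 0) : Ctx H p q s' :=
  ⟨h.toHasInput.congr h0 h1 hio, by rw [ha]; exact h.codeg⟩

/-- The command writes neither the input nor the codegrees. -/
def Cmd.keepsCtx (c : Cmd) : Bool :=
  c.keepsVar 0 && c.keepsVar 1 && c.keepsIo && c.keepsArr 0

theorem Ctx.run {s : Store} (h : Ctx H p q s) {c : Cmd} (hc : c.keepsCtx = true) :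
    Ctx H p q (c.run N B s) := by
  simp only [Cmd.keepsCtx, Bool.and_eq_true] at hc
  exact h.congr (c.var_run s hc.1.1.1) (c.var_run s hc.1.1.2) (c.io_run s hc.1.2) (c.arr_run s hc.2)

theorem Ctx.setVar {s : Store} (h : Ctx H p q s) {v x : ℕ} (hv : v ≠ 0 ∧ v ≠ 1) :
    Ctx H p q (s.setVar v x) :=
  h.congr (by simp [hv.1.symm]) (by simp [hv.2.symm]) rfl rfl

theorem Ctx.setArr {s : Store} (h : Ctx H p q s) {a : Fin 16} {i x : ℕ} (ha : a ≠ 0) :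
    Ctx H p q (s.setArr a i x) :=
  h.congr rfl rfl rfl (by funext j; simp [ha.symm])

theorem eval_adjE (hB : N * N ≤ B) {s : Store} (h : HasInput H p q s) {a b : Exp} {u v : Fin N}
    (ha : a.eval N B s = u) (hb : b.eval N B s = v) : (adjE a b).eval N B s ≠ 0 ↔ H.Adj u v := by
  have := mul_add_lt_sq u.isLt v.isLt
  simp only [adjE, Exp.eval]
  change (if a.eval N B s * N + b.eval N B s < B then s.io (a.eval N B s * N + b.eval N B s) else 0)
    ≠ 0 ↔ _
  rw [ha, hb, if_pos (by omega), h.adj, adjBit]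
  split <;> simp_all

theorem eval_mateE {s : Store} (h : Ctx H p q s) {κ : ℕ} {a b : Exp} {u v : Fin N}
    (ha : a.eval N B s = u) (hb : b.eval N B s = v) :
    (mateE κ a b).eval N B s ≠ 0 ↔ Mate H p q κ u v := by
  have hl : (Exp.lit κ).eval N B s = κ := rfl
  simp [mateE, codegE, ha, hb, h.codeg, h.p, h.q, Mate, hl]

/-- Fills the array `0` with the codegrees. -/
def codegCmd : Cmd :=
  .loop 3 1 (.loop 4 1 (.seq (.set 5 0) (.seq
    (.loop 6 1 (.ite (adjE (.var 3) (.var 6) * adjE (.var 4) (.var 6)) (.set 5 (.var 5 + 1)) .skip))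
    (.put 0 (.var 3 * .n + .var 4) (.var 5)))))

theorem codegCmd_spec (hB : N * N ≤ B) {s : Store} (h : HasInput H p q s) :
    Ctx H p q (codegCmd.run N B s) := by
  have hNB : N ≤ B := (Nat.le_mul_self N).trans hB
  have key := run_loop_inv (N := N) (B := B) (v := 3) (d := 1) (s := s)
    (c := .loop 4 1 (.seq (.set 5 0) (.seq
    (.loop 6 1 (.ite (adjE (.var 3) (.var 6) * adjE (.var 4) (.var 6)) (.set 5 (.var 5 + 1)) .skip))
    (.put 0 (.var 3 * .n + .var 4) (.var 5)))))
    (fun i s => HasInput H p q s ∧ ∀ u v : Fin N, (u : ℕ) < i → s.arr 0 (u * N + v) = codeg H u v)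
    ⟨h, fun u v hu => by omega⟩ ?_
  · exact ⟨key.1, fun u v => key.2 u v (by simp)⟩
  rintro i hi s ⟨h1, h2⟩
  rw [pow_one] at hi
  have key2 := run_loop_inv (N := N) (B := B) (v := 4) (d := 1) (s := s.setVar 3 i)
    (c := .seq (.set 5 0) (.seq
    (.loop 6 1 (.ite (adjE (.var 3) (.var 6) * adjE (.var 4) (.var 6)) (.set 5 (.var 5 + 1)) .skip))
    (.put 0 (.var 3 * .n + .var 4) (.var 5))))
    (fun j s => (HasInput H p q s ∧ s.var 3 = i ∧
      ∀ u v : Fin N, (u : ℕ) < i → s.arr 0 (u * N + v) = codeg H u v) ∧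
      ∀ v : Fin N, (v : ℕ) < j → s.arr 0 (i * N + v) = codeg H ⟨i, hi⟩ v)
    ⟨⟨h1.congr (by simp) (by simp) rfl, by simp, by simpa using h2⟩, fun v hv => by omega⟩ ?_
  · refine ⟨key2.1.1, fun u v hu => ?_⟩
    by_cases hui : (u : ℕ) < i
    · exact key2.1.2.2 u v hui
    · obtain rfl : u = ⟨i, hi⟩ := Fin.ext (by simp; omega)
      exact key2.2 v (by simp)
  rintro j hj s ⟨⟨h3, hv3, h4⟩, h5⟩
  rw [pow_one] at hj
  rw [run_seq, run_set _ _ _ _ _ (x := 0) (by simp) (by omega), run_seq]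
  set s1 := (s.setVar 4 j).setVar 5 0 with hs1
  set s2 := (Cmd.loop 6 1 (.ite (adjE (.var 3) (.var 6) * adjE (.var 4) (.var 6))
    (.set 5 (.var 5 + 1)) .skip)).run N B s1 with hs2
  have hin1 : HasInput H p q s1 := h3.congr (by simp [hs1]) (by simp [hs1]) rfl
  have h50 : s1.var 5 = 0 := by simp [hs1]
  have hcount : s2.var 5 = codeg H ⟨i, hi⟩ ⟨j, hj⟩ := by
    refine run_count (P := fun w => H.Adj ⟨i, hi⟩ w ∧ H.Adj ⟨j, hj⟩ w) hNB (v := 6) (c := 5)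
      (by decide) h50 fun w s' hs' hw => ?_
    have hin' : HasInput H p q s' := hin1.congr (hs'.var 0 (by simp)) (hs'.var 1 (by simp)) hs'.io
    have e3 : s'.var 3 = i := by rw [hs'.var 3 (by simp)]; simp [hs1, hv3]
    have e4 : s'.var 4 = j := by rw [hs'.var 4 (by simp)]; simp [hs1]
    rw [eval_mul, mul_ne_zero_iff, eval_adjE hB hin' (u := ⟨i, hi⟩) (v := w) (by simp [e3]) (by simp [hw]),
      eval_adjE hB hin' (u := ⟨j, hj⟩) (v := w) (by simp [e4]) (by simp [hw])]
  have f3 : s2.var 3 = i := by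
    rw [hs2, Cmd.var_run _ _ (by rfl)]; simp [hs1, hv3]
  have f4 : s2.var 4 = j := by
    rw [hs2, Cmd.var_run _ _ (by rfl)]; simp [hs1]
  have fa : s2.arr 0 = s.arr 0 := by
    rw [hs2, Cmd.arr_run _ _ (by rfl)]; rfl
  have hle : codeg H ⟨i, hi⟩ ⟨j, hj⟩ ≤ B := ((card_le_univ _).trans (by simp)).trans hNB
  rw [run_put _ _ _ _ _ _ (x := i * N + j) (y := codeg H ⟨i, hi⟩ ⟨j, hj⟩) (by simp [f3, f4])
    (by simp [hcount]) hle]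
  refine ⟨⟨?_, by simp [f3], fun u v hu => ?_⟩, fun v hv => ?_⟩
  · refine hin1.congr ?_ ?_ ?_
    · rw [setArr_var, hs2, Cmd.var_run _ _ (by rfl)]
    · rw [setArr_var, hs2, Cmd.var_run _ _ (by rfl)]
    · rw [setArr_io, hs2, Cmd.io_run _ _ (by rfl)]
  · have hne : ¬ ((u : ℕ) * N + v = i * N + j) := fun h => by
      rw [mul_add_inj v.isLt hj] at h; omega
    rw [setArr_arr, if_pos rfl, if_neg hne, fa]; exact h4 u v hu
  · by_cases hvj : (v : ℕ) < j
    · have hne : ¬ (i * N + (v : ℕ) = i * N + j) := by omega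
      rw [setArr_arr, if_pos rfl, if_neg hne, fa]; exact h5 v hvj
    · obtain rfl : v = ⟨j, hj⟩ := Fin.ext (by simp; omega)
      simp

end Spec

/-- A search for an `i` with a given property; the variable `c` becomes `i + 1`, or `0` if there is
none. -/
theorem run_find {N B d : ℕ} (hB : N ^ d ≤ B) {v c : ℕ} (hvc : v ≠ c) {e : Exp} {s : Store}
    (hc : s.var c = 0) {P : ℕ → Prop}
    (he : ∀ i < N ^ d, ∀ s', EqOff [v, c] s s' → s'.var v = i → (e.eval N B s' ≠ 0 ↔ P i)) :
    let s' := (Cmd.loop v d (.ite e (.set c (.var v + 1)) .skip)).run N B s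
    EqOff [v, c] s s' ∧ ((s'.var c = 0 ∧ ∀ i < N ^ d, ¬ P i) ∨
      ∃ i < N ^ d, s'.var c = i + 1 ∧ P i) := by
  refine run_loop_inv (fun k s' => EqOff [v, c] s s' ∧ ((s'.var c = 0 ∧ ∀ i < k, ¬ P i) ∨
      ∃ i < N ^ d, s'.var c = i + 1 ∧ P i)) ⟨⟨fun _ _ => rfl, rfl, rfl⟩, Or.inl ⟨hc, by simp⟩⟩ ?_
  intro i hi s' ⟨h1, h2⟩
  have hoff : EqOff [v, c] s (s'.setVar v i) := by
    refine ⟨fun w hw => ?_, h1.arr, h1.io⟩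
    simp only [List.mem_cons, List.not_mem_nil, or_false, not_or] at hw
    simp [hw.1, h1.var w (by simp [hw])]
  have hei := he i hi _ hoff (by simp)
  by_cases hP : P i
  · rw [run_ite_pos _ _ _ _ _ (hei.2 hP), run_set _ _ _ _ _ (x := i + 1) (by simp) (by omega)]
    refine ⟨⟨fun w hw => ?_, hoff.arr, hoff.io⟩, Or.inr ⟨i, hi, by simp, hP⟩⟩
    simp only [List.mem_cons, List.not_mem_nil, or_false, not_or] at hw
    simp [hw.1, hw.2, h1.var w (by simp [hw])]
  · rw [run_ite_neg _ _ _ _ _ (by by_contra h; exact hP (hei.1 h))]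
    refine ⟨hoff, ?_⟩
    have hvar : (Cmd.skip.run N B (s'.setVar v i)).var c = s'.var c := by simp [Cmd.run, hvc.symm]
    rw [hvar]
    refine h2.imp (fun ⟨h, h'⟩ => ⟨h, fun j hj => ?_⟩) id
    rcases Nat.lt_succ_iff_lt_or_eq.1 hj with hj | rfl
    · exact h' j hj
    · exact hP

/-- The two stores agree except for the variable `v` and the array `a`. -/
structure EqArr (v : ℕ) (a : Fin 16) (s s' : Store) : Prop where
  var : ∀ w, w ≠ v → s'.var w = s.var w
  arr : ∀ b, b ≠ a → s'.arr b = s.arr b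
  io : s'.io = s.io

/-- A loop that writes `x` into the entries of the array `a` with a given property. -/
theorem run_fill {N B d : ℕ} {v : ℕ} {a : Fin 16} {e e' : Exp} {s : Store} {P : ℕ → Prop} {x : ℕ}
    (hx : x ≤ B)
    (he : ∀ i < N ^ d, ∀ s', EqArr v a s s' → s'.var v = i →
      (e.eval N B s' ≠ 0 ↔ P i) ∧ (P i → e'.eval N B s' = x)) :
    let s' := (Cmd.loop v d (.ite e (.put a (.var v) e') .skip)).run N B s
    EqArr v a s s' ∧ ∀ i < N ^ d, s'.arr a i = if P i then x else s.arr a i := by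
  have key := run_loop_inv (N := N) (B := B) (d := d) (v := v) (c := .ite e (.put a (.var v) e') .skip)
    (s := s) (fun k s' => EqArr v a s s' ∧
      ∀ i, s'.arr a i = if i < k ∧ P i then x else s.arr a i)
    ⟨⟨fun _ _ => rfl, fun _ _ => rfl, rfl⟩, by simp⟩ ?_
  · exact ⟨key.1, fun i hi => by rw [key.2]; simp [hi]⟩
  intro i hi s' ⟨h1, h2⟩
  have hoff : EqArr v a s (s'.setVar v i) := 
    ⟨fun w hw => by simp [hw, h1.var w hw], h1.arr, h1.io⟩
  have hei := he i hi _ hoff (by simp)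
  by_cases hP : P i
  · rw [run_ite_pos _ _ _ _ _ (hei.1.2 hP), run_put _ _ _ _ _ _ (x := i) (by simp) (hei.2 hP) hx]
    refine ⟨⟨hoff.var, fun b hb => ?_, hoff.io⟩, fun j => ?_⟩
    · funext j; simp [hb, h1.arr b hb]
    · rw [setArr_arr, if_pos rfl, setVar_arr, h2]
      by_cases hj : j = i
      · subst hj; simp [hP]
      · have : j < i + 1 ↔ j < i := by omega
        simp [hj, this]
  · rw [run_ite_neg _ _ _ _ _ (by by_contra h; exact hP (hei.1.1 h))]
    refine ⟨hoff, fun j => ?_⟩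
    rw [Cmd.run, setVar_arr, h2]
    by_cases hj : j = i
    · subst hj; simp [hP]
    · have : j < i + 1 ↔ j < i := by omega
      simp [this]

end Imp

/-! ### Labelling the components of a graph -/

section Labelling

open Finset

variable {T : Type*}

/-- A state of the search for the components of the graph with the vertices `node` and the edges
`link`: the reached vertices carry the label `lab t ≠ 0` of their component, and `don` says whether
the neighbours of a vertex have been labelled. -/
structure Labelling (node : T → Prop) (link : T → T → Prop) (k : ℕ) (lab : T → ℕ) (don : T → Prop) :
    Prop where
  isNode : ∀ t, lab t ≠ 0 → node t
  reached : ∀ t, don t → lab t ≠ 0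
  closed : ∀ t t', don t → node t' → link t t' → lab t' = lab t
  pending : ∀ t t', lab t ≠ 0 → ¬ don t → lab t' ≠ 0 → ¬ don t' → lab t = lab t'
  le : ∀ t, lab t ≤ k
  conn : ∀ t t', lab t ≠ 0 → lab t = lab t' → ∀ C : Set T,
    (∀ a ∈ C, ∀ b, node b → link a b → b ∈ C) → t ∈ C → t' ∈ C

namespace Labelling

variable {node : T → Prop} {link : T → T → Prop} {k : ℕ} {lab : T → ℕ} {don : T → Prop}

theorem mono (I : Labelling node link k lab don) {k' : ℕ} (h : k ≤ k') :
    Labelling node link k' lab don :=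
  ⟨I.isNode, I.reached, I.closed, I.pending, fun t => (I.le t).trans h, I.conn⟩

/-- A new component is started. -/
theorem seed (I : Labelling node link k lab don) (hp : ∀ t, lab t ≠ 0 → don t) {t : T} (ht : node t)
    (h0 : lab t = 0) {lab' : T → ℕ} (h : ∀ r, (r = t → lab' r = k + 1) ∧ (r ≠ t → lab' r = lab r)) :
    Labelling node link (k + 1) lab' don := by
  have hdt : ¬ don t := fun h => I.reached t h h0
  have e1 : lab' t = k + 1 := (h t).1 rfl
  have key : ∀ r, lab' r ≠ k + 1 → r ≠ t ∧ lab' r = lab r := fun r hr => by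
    have : r ≠ t := fun h' => hr (h' ▸ e1)
    exact ⟨this, (h r).2 this⟩
  have key' : ∀ r, lab' r = k + 1 → r = t := fun r hr => by
    by_contra hne
    have := (h r).2 hne
    have := I.le r
    omega
  have hne : ∀ r, lab r ≠ 0 → lab' r = lab r := fun r hr => (h r).2 fun h' => hr (h' ▸ h0)
  refine ⟨fun r hr => ?_, fun r hr => ?_, fun r r' hr hr' hl => ?_, fun r r' hr hd hr' hd' => ?_,
    fun r => ?_, fun r r' hr he C hC hm => ?_⟩
  · by_cases hk : lab' r = k + 1
    · exact key' r hk ▸ ht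
    · exact I.isNode r (by rwa [← (key r hk).2])
  · rw [hne r (I.reached r hr)]; exact I.reached r hr
  · have := I.closed r r' hr hr' hl
    have h1 := I.reached r hr
    rw [hne r h1, hne r' (by rwa [this]), this]
  · have aux : ∀ r, lab' r ≠ 0 → ¬ don r → r = t := fun r hr hd => by
      by_contra hne'
      exact hd (hp r (by rwa [← (h r).2 hne']))
    rw [aux r hr hd, aux r' hr' hd']
  · by_cases hk : lab' r = k + 1
    · omega
    · have := I.le r
      rw [(key r hk).2]; omega
  · by_cases hk : lab' r = k + 1
    · rw [key' r' (he ▸ hk), ← key' r hk]; exact hm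
    · have h1 := (key r hk).2
      have h2 := (key r' (he ▸ hk)).2
      exact I.conn r r' (h1 ▸ hr) (by rw [← h1, ← h2, he]) C hC hm

/-- The neighbours of `t` are labelled. -/
theorem expand (I : Labelling node link k lab don) (hsymm : ∀ t t', link t t' → link t' t) {t : T}
    (h0 : lab t ≠ 0) (hd : ¬ don t) {lab' : T → ℕ} {don' : T → Prop}
    (h : ∀ r, (node r ∧ link t r → lab' r = lab t) ∧ (¬ (node r ∧ link t r) → lab' r = lab r))
    (hdon : ∀ r, don' r ↔ r = t ∨ don r) :
    Labelling node link k lab' don' := by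
  have ht : node t := I.isNode t h0
  -- the labels that were there before do not change
  have hold : ∀ r, lab r ≠ 0 → lab' r = lab r := fun r hr => by
    by_cases hn : node r ∧ link t r
    · rw [(h r).1 hn]
      by_cases hdr : don r
      · exact I.closed r t hdr ht (hsymm _ _ hn.2)
      · exact I.pending t r h0 hd hr hdr
    · exact (h r).2 hn
  have hnew : ∀ r, lab' r ≠ lab r → lab r = 0 ∧ (node r ∧ link t r) ∧ lab' r = lab t := fun r hr => by
    refine ⟨by by_contra h'; exact hr (hold r h'), ?_⟩
    by_cases hn : node r ∧ link t r
    · exact ⟨hn, (h r).1 hn⟩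
    · exact absurd ((h r).2 hn) hr
  have hconn : ∀ r, lab' r = lab t → ∀ C : Set T, (∀ a ∈ C, ∀ b, node b → link a b → b ∈ C) →
      (r ∈ C ↔ t ∈ C) := fun r hr C hC => by
    by_cases he : lab' r = lab r
    · exact ⟨I.conn r t (by rw [← he, hr]; exact h0) (by rw [← he, hr]) C hC,
        I.conn t r h0 (by rw [← he, hr]) C hC⟩
    · have h' := (hnew r he).2.1
      exact ⟨fun hm => hC r hm t ht (hsymm _ _ h'.2), fun hm => hC t hm r h'.1 h'.2⟩
  refine ⟨fun r hr => ?_, fun r hr => ?_, fun r r' hr hr' hl => ?_, fun r r' hr hd1 hr' hd2 => ?_,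
    fun r => ?_, fun r r' hr he C hC hm => ?_⟩
  · by_cases he : lab' r = lab r
    · exact I.isNode r (he ▸ hr)
    · exact (hnew r he).2.1.1
  · rcases (hdon r).1 hr with rfl | hr
    · rw [hold r h0]; exact h0
    · rw [hold r (I.reached r hr)]; exact I.reached r hr
  · rcases (hdon r).1 hr with rfl | hr
    · rw [(h r').1 ⟨hr', hl⟩, hold r h0]
    · have e := I.closed r r' hr hr' hl
      have h1 := I.reached r hr
      rw [hold r h1, hold r' (by rwa [e]), e]
  · have aux : ∀ r, lab' r ≠ 0 → ¬ don' r → lab' r = lab t := fun r hr hd' => by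
      rw [hdon, not_or] at hd'
      by_cases he : lab' r = lab r
      · rw [he]; exact I.pending r t (he ▸ hr) hd'.2 h0 hd
      · exact (hnew r he).2.2
    rw [aux r hr hd1, aux r' hr' hd2]
  · by_cases he : lab' r = lab r
    · exact he ▸ I.le r
    · rw [(hnew r he).2.2]; exact I.le t
  · by_cases hl : lab' r = lab t
    · exact (hconn r' (he ▸ hl) C hC).2 ((hconn r hl C hC).1 hm)
    · have e1 : lab' r = lab r := by
        by_contra h'; exact hl (hnew r h').2.2
      have e2 : lab' r' = lab r' := by
        by_contra h'; exact hl (he ▸ (hnew r' h').2.2)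
      exact I.conn r r' (e1 ▸ hr) (by rw [← e1, ← e2, he]) C hC hm

end Labelling

end Labelling

namespace Imp

open Finset Classical

section Triples

variable {N : ℕ}

/-- Triples are numbered lexicographically. -/
def code (t : Fin N × Fin N × Fin N) : ℕ := t.1 * (N * N) + (t.2.1 * N + t.2.2)

theorem code_lt (t : Fin N × Fin N × Fin N) : code t < N ^ 3 := by
  have h1 := mul_add_lt_sq t.2.1.isLt t.2.2.isLt
  have h2 := Nat.mul_le_mul_right (N * N) (Nat.succ_le_of_lt t.1.isLt)
  rw [Nat.succ_mul] at h2
  have : N ^ 3 = N * (N * N) := by ring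
  unfold code
  omega

theorem code_injective : Function.Injective (code (N := N)) := by
  intro t t' h
  obtain ⟨h1, h2⟩ := (mul_add_inj (mul_add_lt_sq t.2.1.isLt t.2.2.isLt)
    (mul_add_lt_sq t'.2.1.isLt t'.2.2.isLt)).1 h
  obtain ⟨h2, h3⟩ := (mul_add_inj t.2.2.isLt t'.2.2.isLt).1 h2
  exact Prod.ext (Fin.ext h1) (Prod.ext (Fin.ext h2) (Fin.ext h3))

theorem exists_code {r : ℕ} (hr : r < N ^ 3) : ∃ t : Fin N × Fin N × Fin N, code t = r := by
  have hN : 0 < N := by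
    rcases Nat.eq_zero_or_pos N with rfl | h
    · simp at hr
    · exact h
  have h3 : N ^ 3 = N * N * N := by ring
  refine ⟨(⟨r / (N * N), ?_⟩, ⟨r % (N * N) / N, ?_⟩, ⟨r % (N * N) % N, Nat.mod_lt _ hN⟩), ?_⟩
  · exact Nat.div_lt_of_lt_mul (by rwa [← h3])
  · exact Nat.div_lt_of_lt_mul (Nat.mod_lt _ (by positivity))
  · simp only [code]
    rw [mul_comm (r % (N * N) / N), Nat.div_add_mod, mul_comm, Nat.div_add_mod]

/-- The first coordinate of the triple with a given number. -/
def fstE (r : Exp) : Exp := r / (.n * .n)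

/-- The second coordinate of the triple with a given number. -/
def sndE (r : Exp) : Exp := r / .n - fstE r * .n

/-- The third coordinate of the triple with a given number. -/
def thdE (r : Exp) : Exp := r - r / .n * .n

theorem eval_coords {B : ℕ} {s : Store} {r : Exp} {t : Fin N × Fin N × Fin N}
    (h : r.eval N B s = code t) : (fstE r).eval N B s = t.1 ∧ (sndE r).eval N B s = t.2.1 ∧
      (thdE r).eval N B s = t.2.2 := by
  have hN : 0 < N := t.1.pos
  have h1 : code t / (N * N) = t.1 := by
    rw [code, add_comm, Nat.add_mul_div_right _ _ (by positivity),
      Nat.div_eq_of_lt (mul_add_lt_sq t.2.1.isLt t.2.2.isLt), zero_add]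
  have h2 : code t / N = t.1 * N + t.2.1 := by
    rw [code, show (t.1 : ℕ) * (N * N) + (t.2.1 * N + t.2.2) = t.2.2 + (t.1 * N + t.2.1) * N by ring,
      Nat.add_mul_div_right _ _ hN, Nat.div_eq_of_lt t.2.2.isLt, zero_add]
  have e1 : (fstE r).eval N B s = t.1 := by simp [fstE, h, h1]
  refine ⟨e1, ?_, ?_⟩
  · simp [sndE, h, h2, e1]
  · simp only [thdE, eval_sub, eval_mul, eval_div, eval_n, h, h2]
    rw [code, show (t.1 : ℕ) * (N * N) + (t.2.1 * N + t.2.2) = (t.1 * N + t.2.1) * N + t.2.2 by ring]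
    omega

/-- Being a triple of pairwise mates. -/
def nodeE (r : Exp) : Exp :=
  mateE 4 (fstE r) (sndE r) * mateE 4 (sndE r) (thdE r) * mateE 4 (fstE r) (thdE r)

/-- Being linked triples. -/
def linkE (r r' : Exp) : Exp :=
  adjE (fstE r) (sndE r') * adjE (fstE r) (thdE r') * adjE (sndE r) (fstE r') *
    adjE (sndE r) (thdE r') * adjE (thdE r) (fstE r') * adjE (thdE r) (sndE r')

variable {p q : ℕ} {H : SimpleGraph (Fin N)} {B : ℕ}

theorem eval_nodeE {s : Store} (h : Ctx H p q s) {r : Exp} {t : Fin N × Fin N × Fin N}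
    (hr : r.eval N B s = code t) : (nodeE r).eval N B s ≠ 0 ↔ IsNode H p q t := by
  obtain ⟨h1, h2, h3⟩ := eval_coords hr
  simp only [nodeE, eval_mul, mul_ne_zero_iff, eval_mateE h h1 h2, eval_mateE h h2 h3,
    eval_mateE h h1 h3, IsNode, and_assoc]

theorem eval_linkE (hB : N * N ≤ B) {s : Store} (h : Ctx H p q s) {r r' : Exp}
    {t t' : Fin N × Fin N × Fin N} (hr : r.eval N B s = code t) (hr' : r'.eval N B s = code t') :
    (linkE r r').eval N B s ≠ 0 ↔ Linked H t t' := by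
  obtain ⟨h1, h2, h3⟩ := eval_coords hr
  obtain ⟨h1', h2', h3'⟩ := eval_coords hr'
  have H' := h.toHasInput
  simp only [linkE, eval_mul, mul_ne_zero_iff, eval_adjE hB H' h1 h2', eval_adjE hB H' h1 h3',
    eval_adjE hB H' h2 h1', eval_adjE hB H' h2 h3', eval_adjE hB H' h3 h1', eval_adjE hB H' h3 h2',
    Linked, and_assoc]

/-- Looks for a reached triple whose neighbours have not been labelled, in the variable `3`. -/
def findPendingCmd : Cmd :=
  .loop 4 3 (.ite (nodeE (.var 4) * .arr 1 (.var 4) * (Exp.arr 2 (.var 4)).not)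
    (.set 3 (.var 4 + 1)) .skip)

/-- Looks for a triple that has not been reached. -/
def findSeedCmd : Cmd :=
  .loop 4 3 (.ite (nodeE (.var 4) * (Exp.arr 2 (.var 4)).not) (.set 3 (.var 4 + 1)) .skip)

/-- Labels the neighbours of the triple with the number `x` in the variable `3`. -/
def expandCmd : Cmd :=
  .seq (.set 5 (.arr 1 (.var 3))) (.seq
    (.loop 4 3 (.ite (nodeE (.var 4) * linkE (.var 3) (.var 4)) (.put 1 (.var 4) (.var 5)) .skip))
    (.put 2 (.var 3) 1))

/-- Labels the components of the graph of all triples of mates, in the array `1`. The array `2` marks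
the triples whose neighbours have been labelled. -/
def labelCmd : Cmd :=
  .loop 2 3 (.seq (.set 3 0) (.seq findPendingCmd (.seq (.ite (.var 3) .skip findSeedCmd)
    (.ite (.var 3) (.seq (.set 3 (.var 3 - 1)) (.seq
      (.ite (.arr 1 (.var 3)) .skip (.put 1 (.var 3) (.var 2 + 1))) expandCmd)) .skip))))

/-- `Labelling` for the contents of the arrays. -/
def Lab (H : SimpleGraph (Fin N)) (p q k : ℕ) (s : Store) : Prop :=
  Labelling (IsNode H p q) (Linked H) k (fun t => s.arr 1 (code t)) fun t => s.arr 2 (code t) ≠ 0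

theorem expandCmd_spec (hB : N * N ≤ B) (hB3 : N ^ 3 ≤ B) {s : Store} (h : Ctx H p q s) {k : ℕ}
    (hk : k ≤ N ^ 3) {t : Fin N × Fin N × Fin N} (ht : s.var 3 = code t) (h0 : s.arr 1 (code t) ≠ 0)
    (hd : s.arr 2 (code t) = 0) (I : Lab H p q k s) :
    Lab H p q k (expandCmd.run N B s) ∧ ∀ r : Fin N × Fin N × Fin N,
      ((expandCmd.run N B s).arr 2 (code r) ≠ 0 ↔ r = t ∨ s.arr 2 (code r) ≠ 0) := by
  have hle : s.arr 1 (code t) ≤ B := (I.le t).trans (hk.trans hB3)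
  have hB1 : 1 ≤ B := by omega
  rw [expandCmd, run_seq, run_set _ _ _ _ _ (x := s.arr 1 (code t)) (by simp [ht]) hle, run_seq]
  set s1 := s.setVar 5 (s.arr 1 (code t)) with hs1
  have h1 : Ctx H p q s1 := h.setVar (by decide)
  have key := run_fill (N := N) (B := B) (d := 3) (v := 4) (a := 1) (s := s1)
    (e := nodeE (.var 4) * linkE (.var 3) (.var 4)) (e' := .var 5)
    (P := fun i => ∃ r : Fin N × Fin N × Fin N, code r = i ∧ IsNode H p q r ∧ Linked H t r)
    (x := s.arr 1 (code t)) hle fun i hi s' hs' hv => by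
      obtain ⟨r, rfl⟩ := exists_code hi
      have hc : Ctx H p q s' := h1.congr (hs'.var 0 (by decide)) (hs'.var 1 (by decide)) hs'.io
        (hs'.arr 0 (by decide))
      have hv3 : s'.var 3 = code t := by rw [hs'.var 3 (by decide)]; simpa [hs1] using ht
      refine ⟨?_, fun _ => by simp [hs'.var 5 (by decide), hs1]⟩
      rw [eval_mul, mul_ne_zero_iff, eval_nodeE hc (t := r) (by simpa using hv),
        eval_linkE hB hc (t := t) (t' := r) (by simpa using hv3) (by simpa using hv)]
      exact ⟨fun h => ⟨r, rfl, h⟩, fun ⟨r', hr', h⟩ => code_injective hr' ▸ h⟩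
  set s2 := (Cmd.loop 4 3 (.ite (nodeE (.var 4) * linkE (.var 3) (.var 4)) (.put 1 (.var 4) (.var 5))
    .skip)).run N B s1 with hs2
  obtain ⟨k1, k2⟩ := key
  have hv3 : s2.var 3 = code t := by rw [k1.var 3 (by decide)]; simpa [hs1] using ht
  rw [run_put _ _ _ _ _ _ (x := code t) (y := 1) (by simp [hv3]) (by simp) hB1]
  have ha2 : ∀ r : Fin N × Fin N × Fin N,
      ((s2.setArr 2 (code t) 1).arr 2 (code r) ≠ 0 ↔ r = t ∨ s.arr 2 (code r) ≠ 0) := fun r => by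
    rw [setArr_arr, if_pos rfl, k1.arr 2 (by decide)]
    by_cases hr : r = t
    · simp [hr]
    · rw [if_neg fun h => hr (code_injective h)]; simp [hr, hs1]
  refine ⟨Labelling.expand I (fun _ _ h => h.symm) h0 (by simpa using hd) (fun r => ?_) ha2, ha2⟩
  have := k2 (code r) (code_lt r)
  have e : (∃ r' : Fin N × Fin N × Fin N, code r' = code r ∧ IsNode H p q r' ∧ Linked H t r') ↔
      IsNode H p q r ∧ Linked H t r :=
    ⟨fun ⟨r', hr', h⟩ => code_injective hr' ▸ h, fun h => ⟨r, rfl, h⟩⟩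
  simp only [e] at this
  simp only [setArr_arr, show ¬ ((1 : Fin 16) = 2) by decide, if_false, this]
  exact ⟨fun h => if_pos h, fun h => if_neg h⟩

theorem labelCmd_spec (hB : N * N ≤ B) (hB3 : N ^ 3 ≤ B) {s : Store} (h : Ctx H p q s)
    (h1 : ∀ i, s.arr 1 i = 0) (h2 : ∀ i, s.arr 2 i = 0) :
    Lab H p q (N ^ 3) (labelCmd.run N B s) ∧
      ∀ t, IsNode H p q t → (labelCmd.run N B s).arr 2 (code t) ≠ 0 := by
  have key := run_loop_inv (N := N) (B := B) (v := 2) (d := 3) (s := s)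
    (c := .seq (.set 3 0) (.seq findPendingCmd (.seq (.ite (.var 3) .skip findSeedCmd)
    (.ite (.var 3) (.seq (.set 3 (.var 3 - 1)) (.seq
      (.ite (.arr 1 (.var 3)) .skip (.put 1 (.var 3) (.var 2 + 1))) expandCmd)) .skip))))
    (fun k s => Ctx H p q s ∧ Lab H p q k s ∧ (k ≤ #{t : Fin N × Fin N × Fin N | s.arr 2 (code t) ≠ 0} ∨
      ∀ t, IsNode H p q t → s.arr 2 (code t) ≠ 0))
    ⟨h, ⟨by simp [h1], by simp [h2], by simp [h2], by simp [h1], by simp [h1], by simp [h1]⟩,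
      Or.inl (Nat.zero_le _)⟩ ?_
  · refine ⟨key.2.1, ?_⟩
    rcases key.2.2 with hc | hc
    · have hcard : Fintype.card (Fin N × Fin N × Fin N) = N ^ 3 := by simp; ring
      have := eq_univ_of_card _ (le_antisymm (card_le_univ _) (hcard ▸ hc))
      intro t _
      have ht := mem_univ t
      rw [← this] at ht
      exact (mem_filter.1 ht).2
    · exact hc
  rintro k hk s ⟨hC, I, hcount⟩
  rw [run_seq, run_set _ _ _ _ _ (x := 0) (by simp) (by omega)]
  set s1 := (s.setVar 2 k).setVar 3 0 with hs1
  have hC1 : Ctx H p q s1 := (hC.setVar (by decide)).setVar (by decide)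
  have ha : s1.arr = s.arr := rfl
  have hCt : ∀ s', EqOff [4, 3] s1 s' → Ctx H p q s' := fun s' hs' =>
    hC1.congr (hs'.var 0 (by decide)) (hs'.var 1 (by decide)) hs'.io (by rw [hs'.arr])
  rw [run_seq]
  obtain ⟨f1, f2⟩ := run_find (N := N) (B := B) (d := 3) hB3 (v := 4) (c := 3) (by decide)
    (e := nodeE (.var 4) * .arr 1 (.var 4) * (Exp.arr 2 (.var 4)).not) (s := s1) (by simp [hs1])
    (P := fun i => ∃ r : Fin N × Fin N × Fin N, code r = i ∧ IsNode H p q r ∧ s.arr 1 (code r) ≠ 0 ∧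
      s.arr 2 (code r) = 0) fun i hi s' hs' hv => by
      obtain ⟨r, rfl⟩ := exists_code hi
      rw [eval_mul, mul_ne_zero_iff, eval_mul, mul_ne_zero_iff,
        eval_nodeE (hCt s' hs') (t := r) (by simpa using hv)]
      simp only [ne_eq, eval_not_eq_zero, not_not, eval_arr, eval_var, hv, hs'.arr, ha, and_assoc]
      exact ⟨fun h => ⟨r, rfl, h⟩, fun ⟨r', hr', h⟩ => code_injective hr' ▸ h⟩
  change EqOff [4, 3] s1 (findPendingCmd.run N B s1) at f1
  change ((findPendingCmd.run N B s1).var 3 = 0 ∧ _) ∨ _ at f2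
  set s2 := findPendingCmd.run N B s1 with hs2
  have ha2 : s2.arr = s.arr := f1.arr
  rw [run_seq]
  -- the search for a triple with unlabelled neighbours
  have hsel : ∃ s3, (Cmd.ite (.var 3) .skip findSeedCmd).run N B s2 = s3 ∧ Ctx H p q s3 ∧
      s3.arr = s.arr ∧ s3.var 2 = k ∧
      ((s3.var 3 = 0 ∧ ∀ t, IsNode H p q t → s.arr 2 (code t) ≠ 0) ∨
        ∃ t : Fin N × Fin N × Fin N, s3.var 3 = code t + 1 ∧ IsNode H p q t ∧ s.arr 2 (code t) = 0 ∧
          (s.arr 1 (code t) ≠ 0 ∨ (∀ r : Fin N × Fin N × Fin N, s.arr 1 (code r) ≠ 0 →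
            s.arr 2 (code r) ≠ 0))) := by
    refine ⟨_, rfl, ?_⟩
    rcases f2 with ⟨hz, hall⟩ | ⟨i, hi, hv, r, rfl, hr⟩
    · rw [run_ite_neg _ _ _ _ _ (by simpa using hz)]
      obtain ⟨g1, g2⟩ := run_find (N := N) (B := B) (d := 3) hB3 (v := 4) (c := 3) (by decide)
        (e := nodeE (.var 4) * (Exp.arr 2 (.var 4)).not) (s := s2) hz
        (P := fun i => ∃ r : Fin N × Fin N × Fin N, code r = i ∧ IsNode H p q r ∧
          s.arr 2 (code r) = 0) fun i hi s' hs' hv => by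
          obtain ⟨r, rfl⟩ := exists_code hi
          have hC' : Ctx H p q s' := (hCt s2 f1).congr (hs'.var 0 (by decide)) (hs'.var 1 (by decide))
            hs'.io (by rw [hs'.arr])
          rw [eval_mul, mul_ne_zero_iff, eval_nodeE hC' (t := r) (by simpa using hv)]
          simp only [ne_eq, eval_not_eq_zero, not_not, eval_arr, eval_var, hv, hs'.arr, ha2]
          exact ⟨fun h => ⟨r, rfl, h⟩, fun ⟨r', hr', h⟩ => code_injective hr' ▸ h⟩
      change EqOff [4, 3] s2 (findSeedCmd.run N B s2) at g1
      change ((findSeedCmd.run N B s2).var 3 = 0 ∧ _) ∨ _ at g2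
      refine ⟨(hCt s2 f1).congr (g1.var 0 (by decide)) (g1.var 1 (by decide)) g1.io (by rw [g1.arr]),
        g1.arr.trans ha2, ?_, ?_⟩
      · rw [g1.var 2 (by decide), f1.var 2 (by decide)]; simp [hs1]
      · rcases g2 with ⟨hz', hall'⟩ | ⟨i, hi, hv, r, rfl, hr⟩
        · exact Or.inl ⟨hz', fun t ht h0 => hall' _ (code_lt t) ⟨t, rfl, ht, h0⟩⟩
        · refine Or.inr ⟨r, hv, hr.1, hr.2, Or.inr fun t ht hd => ?_⟩
          exact hall _ (code_lt t) ⟨t, rfl, I.isNode t ht, ht, hd⟩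
    · replace hv : s2.var 3 = code r + 1 := hv
      rw [run_ite_pos _ _ _ _ _ (by simp [hv]), Cmd.run]
      refine ⟨hCt s2 f1, ha2, ?_, Or.inr ⟨r, hv, hr.1, hr.2.2, Or.inl hr.2.1⟩⟩
      rw [f1.var 2 (by decide)]; simp [hs1]
  obtain ⟨s3, e3, hC3, ha3, hv2, hcase⟩ := hsel
  rw [e3]
  rcases hcase with ⟨hz, hall⟩ | ⟨t, hv, hn, hd, hpend⟩
  · rw [run_ite_neg _ _ _ _ _ (by simpa using hz), Cmd.run]
    refine ⟨hC3, ?_, Or.inr (by rwa [ha3])⟩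
    unfold Lab
    rw [ha3]
    exact I.mono (Nat.le_succ k)
  · have hcl := code_lt t
    rw [run_ite_pos _ _ _ _ _ (by simp [hv]), run_seq, run_set _ _ _ _ _ (x := code t) (by simp [hv])
      (by omega), run_seq]
    set s4 := s3.setVar 3 (code t) with hs4
    have hC4 : Ctx H p q s4 := hC3.setVar (by decide)
    have hlab : ∃ s5, (Cmd.ite (.arr 1 (.var 3)) .skip (.put 1 (.var 3) (.var 2 + 1))).run N B s4 = s5 ∧
        Ctx H p q s5 ∧ s5.var 3 = code t ∧ s5.arr 2 = s.arr 2 ∧ s5.arr 1 (code t) ≠ 0 ∧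
        Lab H p q (k + 1) s5 := by
      refine ⟨_, rfl, ?_⟩
      by_cases h0 : s.arr 1 (code t) = 0
      · rw [run_ite_neg _ _ _ _ _ (by simp [hs4, ha3, h0]), run_put _ _ _ _ _ _ (x := code t)
          (y := k + 1) (by simp [hs4]) (by simp [hs4, hv2]) (by omega)]
        have e2 : (s4.setArr 1 (code t) (k + 1)).arr 2 = s.arr 2 := by
          funext i; simp [hs4, ha3]
        refine ⟨hC4.setArr (by decide), by simp [hs4], e2, by simp, ?_⟩
        · have hpend' := hpend.resolve_left (by simp [h0])
          have := Labelling.seed I hpend' hn h0 (lab' := fun r => (s4.setArr 1 (code t) (k + 1)).arr 1 (code r))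
            fun r => ⟨fun hr => by simp [hr], fun hr => by
              simp [hs4, ha3, code_injective.eq_iff, hr]⟩
          unfold Lab
          rwa [e2]
      · rw [run_ite_pos _ _ _ _ _ (by simp [hs4, ha3, h0]), Cmd.run]
        refine ⟨hC4, by simp [hs4], by simp [hs4, ha3], by simpa [hs4, ha3] using h0, ?_⟩
        unfold Lab
        rw [hs4, setVar_arr, ha3]
        exact I.mono (Nat.le_succ k)
    obtain ⟨s5, e5, hC5, hv5, ha5, hl5, I5⟩ := hlab
    rw [e5]
    obtain ⟨I6, hd6⟩ := expandCmd_spec hB hB3 hC5 (by omega) hv5 hl5 (by rw [ha5]; exact hd) I5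
    refine ⟨hC5.run (by rfl), I6, ?_⟩
    rcases hcount with hc | hc
    · refine Or.inl ?_
      have : ({r : Fin N × Fin N × Fin N | (expandCmd.run N B s5).arr 2 (code r) ≠ 0} : Finset _) =
          insert t ({r : Fin N × Fin N × Fin N | s.arr 2 (code r) ≠ 0} : Finset _) := by
        ext r
        rw [mem_filter, hd6 r, ha5]
        simp
      rw [this, card_insert_of_notMem (by simp [hd])]
      omega
    · exact absurd hd (hc t hn)

end Triples

end Imp

/-! ### Bipartite matching by an auction -/

section Auction

open Finset

variable {N : ℕ}

/-- A state of the auction in which the bidders `u` with `A u` look for items `v` with `R u v`;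
`nx u` is `v + 1` if `u` holds the item `v`, `ow v` is `u + 1` if `v` is held by `u`, both are `0`
otherwise, and `pr` are the prices. -/
structure Auction (A : Fin N → Prop) (R : Fin N → Fin N → Prop) (nx ow pr : Fin N → ℕ) : Prop where
  holds : ∀ u v : Fin N, nx u = v + 1 ↔ ow v = u + 1
  item : ∀ u, nx u ≠ 0 → ∃ v : Fin N, nx u = v + 1
  owner : ∀ v, ow v ≠ 0 → ∃ u : Fin N, ow v = u + 1
  /-- Every bidder holds an item that is almost the cheapest one for him. -/
  cheap : ∀ u v : Fin N, nx u = v + 1 → A u ∧ R u v ∧ ∀ v', R u v' → pr v ≤ pr v' + 1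
  owned : ∀ v, pr v ≠ 0 → ow v ≠ 0
  price_le : ∀ v, pr v ≤ N

namespace Auction

variable {A : Fin N → Prop} {R : Fin N → Fin N → Prop} {nx ow pr : Fin N → ℕ}

/-- If all bidders can be satisfied, then a bidder without an item finds one of price less
than `N`: otherwise the owner of his partner in a perfect matching, the owner of the partner of that
bidder and so on form a sequence of distinct bidders, and it has more than `N` members, since the
prices of the partners start at `N` and drop by at most one in each step. -/
theorem exists_price_lt (I : Auction A R nx ow pr) {M : Fin N → Fin N} (hM : ∀ u, A u → R u (M u))
    (hinj : ∀ u u', A u → A u' → M u = M u' → u = u') {u : Fin N} (hA : A u) (hu : nx u = 0) :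
    ∃ v, R u v ∧ pr v < N := by
  by_contra! hcon
  have hstep : ∀ w, A w → 0 < pr (M w) → ∃ w', ow (M w) = w' + 1 := fun w _ hw => by
    obtain ⟨w', h⟩ := I.owner _ (I.owned _ hw.ne')
    exact ⟨w', h⟩
  let f : Fin N → Fin N := fun w => if h : ∃ w' : Fin N, ow (M w) = w' + 1 then h.choose else w
  have hf : ∀ w, A w → 0 < pr (M w) → nx (f w) = M w + 1 := fun w hw hp => by
    obtain ⟨w', h'⟩ := I.owner _ (I.owned _ hp.ne')
    have hex : ∃ w' : Fin N, ow (M w) = w' + 1 := ⟨w', h'⟩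
    have := hex.choose_spec
    simp only [f, dif_pos hex]
    exact (I.holds _ _).2 this
  have hseq : ∀ i ≤ N, A (f^[i] u) ∧ N ≤ pr (M (f^[i] u)) + i := by
    intro i
    induction i with
    | zero => exact fun _ => ⟨hA, by simpa using hcon _ (hM u hA)⟩
    | succ i ih =>
      intro hi
      obtain ⟨h1, h2⟩ := ih (by omega)
      have h3 := I.cheap _ _ (hf _ h1 (by omega))
      rw [Function.iterate_succ_apply']
      have := h3.2.2 _ (hM _ h3.1)
      exact ⟨h3.1, by omega⟩
  have hdist : ∀ i j, i < j → j ≤ N → f^[i] u ≠ f^[j] u := by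
    intro i
    induction i with
    | zero =>
      intro j hj hjN he
      obtain ⟨j, rfl⟩ : ∃ j', j = j' + 1 := ⟨j - 1, by omega⟩
      rw [Function.iterate_succ_apply'] at he
      obtain ⟨h1, h2⟩ := hseq j (by omega)
      have := hf _ h1 (by omega)
      rw [← he] at this
      simp [hu] at this
    | succ i ih =>
      intro j hj hjN he
      obtain ⟨j, rfl⟩ : ∃ j', j = j' + 1 := ⟨j - 1, by omega⟩
      rw [Function.iterate_succ_apply', Function.iterate_succ_apply'] at he
      obtain ⟨h1, h2⟩ := hseq j (by omega)
      obtain ⟨h3, h4⟩ := hseq i (by omega)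
      have e1 := hf _ h1 (by omega)
      have e2 := hf _ h3 (by omega)
      rw [he, e1] at e2
      exact ih j (by omega) (by omega) (hinj _ _ h3 h1 (Fin.ext (by omega)))
  have hcard := Fintype.card_le_of_injective (fun i : Fin (N + 1) => f^[i] u) fun i j he => by
    rcases lt_trichotomy i j with h | h | h
    · exact absurd he (hdist i j h (by omega))
    · exact h
    · exact absurd he.symm (hdist j i h (by omega))
  simp at hcard

/-- The bidder `u` takes the cheapest item `v` from its owner, and its price goes up. -/
theorem bid (I : Auction A R nx ow pr) {u v : Fin N} (hA : A u) (hu : nx u = 0) (hR : R u v)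
    (hmin : ∀ v', R u v' → pr v ≤ pr v') (hlt : pr v < N) {nx' ow' pr' : Fin N → ℕ}
    (hnx : ∀ w, nx' w = if w = u then (v : ℕ) + 1 else if ow v = w + 1 then 0 else nx w)
    (how : ∀ w, ow' w = if w = v then (u : ℕ) + 1 else ow w)
    (hpr : ∀ w, pr' w = if w = v then pr v + 1 else pr w) : Auction A R nx' ow' pr' := by
  have hle : ∀ w, pr w ≤ pr' w := fun w => by rw [hpr]; split <;> simp_all
  refine ⟨fun w x => ?_, fun w hw => ?_, fun x hx => ?_, fun w x hwx => ?_, fun x hx => ?_, fun x => ?_⟩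
  · rw [hnx, how]
    have h1 := I.holds w x
    have h2 := I.holds u x
    have h3 := I.holds w v
    by_cases hw : w = u
    · subst hw
      by_cases hx : x = v
      · simp [hx]
      · have : (v : ℕ) ≠ x := fun h => hx (Fin.ext h.symm)
        simp [hx, ← h2, hu, this]
    · have hw' : (u : ℕ) ≠ w := fun h => hw (Fin.ext h.symm)
      by_cases hx : x = v
      · subst hx
        by_cases ho : ow x = w + 1
        · simp [hw, ho, hw']
        · simp [hw, ho, hw', h1]
      · by_cases ho : ow v = w + 1
        · have e := h3.2 ho
          have : ow x ≠ w + 1 := fun h => by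
            have := h1.2 h
            rw [e] at this
            exact hx (Fin.ext (by omega))
          simp [hw, hx, ho, this]
        · simp [hw, hx, ho, h1]
  · rw [hnx] at hw ⊢
    split at hw
    · next h => rw [if_pos h]; exact ⟨v, rfl⟩
    · next h =>
      split at hw
      · simp at hw
      · next h' => rw [if_neg h, if_neg h']; exact I.item w hw
  · rw [how] at hx ⊢
    split at hx
    · next h => rw [if_pos h]; exact ⟨u, rfl⟩
    · next h => rw [if_neg h]; exact I.owner x hx
  · rw [hnx] at hwx
    by_cases hw : w = u
    · subst hw
      rw [if_pos rfl] at hwx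
      obtain rfl : v = x := Fin.ext (by omega)
      refine ⟨hA, hR, fun v' hv' => ?_⟩
      have := hmin v' hv'
      have := hle v'
      rw [hpr v, if_pos rfl]
      omega
    · rw [if_neg hw] at hwx
      split at hwx
      · omega
      · next ho =>
        obtain ⟨h1, h2, h3⟩ := I.cheap w x hwx
        refine ⟨h1, h2, fun v' hv' => ?_⟩
        have hxv : x ≠ v := fun h => ho (h ▸ (I.holds w x).1 hwx)
        have := h3 v' hv'
        have := hle v'
        rw [hpr x, if_neg hxv]
        omega
  · rw [hpr] at hx
    rw [how]
    split
    · omega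
    · next h => rw [if_neg h] at hx; exact I.owned x hx
  · rw [hpr]
    split
    · omega
    · exact I.price_le x

/-- If all prices have reached the maximum, then all items are held, by as many bidders. -/
theorem matched_of_sum (I : Auction A R nx ow pr) (h : N * N ≤ ∑ v, pr v) (u : Fin N) : nx u ≠ 0 := by
  have h1 : ∀ v, pr v = N := by
    have hs : ∑ v, pr v = ∑ _v : Fin N, N := by
      refine le_antisymm (sum_le_sum fun v _ => I.price_le v) ?_
      simpa using h
    have := (sum_eq_sum_iff_of_le fun v _ => I.price_le v).1 hs
    exact fun v => this v (mem_univ v)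
  have h2 : ∀ v, ∃ u : Fin N, ow v = u + 1 := fun v => 
    I.owner v (I.owned v (by rw [h1]; exact u.pos.ne'))
  choose o ho using h2
  have hinj : Function.Injective o := fun v v' hv => by
    have e1 := (I.holds _ _).2 (ho v)
    have e2 := (I.holds _ _).2 (ho v')
    rw [hv, e2] at e1
    exact Fin.ext (by omega)
  obtain ⟨v, rfl⟩ := (Finite.injective_iff_surjective.1 hinj) u
  rw [(I.holds _ _).2 (ho v)]
  omega

end Auction

end Auction

namespace Imp

open Finset Classical

variable {N p q : ℕ} {H : SimpleGraph (Fin N)} {B : ℕ}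

/-- Clears an array below `N`. -/
def clearCmd (a : Fin 16) : Cmd := .loop 4 1 (.ite 1 (.put a (.var 4) 0) .skip)

theorem clearCmd_spec (N B : ℕ) (a : Fin 16) (s : Store) :
    EqArr 4 a s ((clearCmd a).run N B s) ∧ ∀ i < N, ((clearCmd a).run N B s).arr a i = 0 := by
  have := run_fill (N := N) (B := B) (d := 1) (v := 4) (a := a) (e := 1) (e' := 0) (s := s)
    (P := fun _ => True) (x := 0) (Nat.zero_le _) fun i hi s' _ _ => by simp
  refine ⟨this.1, fun i hi => ?_⟩
  exact (this.2 i (by simpa using hi)).trans (if_pos trivial)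

/-- Looks for a bidder without an item, in the variable `5`. -/
def findBidderCmd : Cmd :=
  .loop 4 1 (.ite (Exp.lt 0 (.arr 3 (.var 4)) * Exp.lt (.arr 3 (.var 4)) 3 * (Exp.arr 4 (.var 4)).not)
    (.set 5 (.var 4 + 1)) .skip)

/-- Looks for a cheapest item for the bidder in the variable `5`, in the variable `6`. -/
def findItemCmd : Cmd :=
  .loop 4 1 (.ite (mateE 4 (.var 5) (.var 4) * Exp.eq (.arr 3 (.var 4)) (.arr 3 (.var 5) + 1) *
    ((Exp.var 6).not + Exp.lt (.arr 6 (.var 4)) (.arr 6 (.var 6 - 1)))) (.set 6 (.var 4 + 1)) .skip)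

/-- The bidder in the variable `5` gets the item in the variable `6`. -/
def bidCmd : Cmd :=
  .seq (.ite (.arr 5 (.var 6)) (.put 4 (.arr 5 (.var 6) - 1) 0) .skip)
    (.seq (.put 5 (.var 6) (.var 5 + 1)) (.seq (.put 4 (.var 5) (.var 6 + 1))
      (.put 6 (.var 6) (.arr 6 (.var 6) + 1))))

/-- Matches every vertex of colour 1 or 2 to a mate of the next colour. The colours are in the
array `3`, the arrays `4, 5, 6` hold the partners and the prices. -/
def auctionCmd : Cmd :=
  .loop 3 2 (.seq (.set 5 0) (.seq findBidderCmd (.ite (.var 5) (.seq (.set 5 (.var 5 - 1))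
    (.seq (.set 6 0) (.seq findItemCmd
      (.ite (.var 6) (.seq (.set 6 (.var 6 - 1)) bidCmd) .skip)))) .skip)))

/-- The bidders are the vertices of colour 1 and 2. -/
def Bidder (col : ℕ → ℕ) (u : Fin N) : Prop := 0 < col u ∧ col u < 3

/-- A bidder may get the mates of the next colour. -/
def Allowed (H : SimpleGraph (Fin N)) (p q : ℕ) (col : ℕ → ℕ) (u v : Fin N) : Prop :=
  Mate H p q 4 u v ∧ col v = col u + 1

/-- `Auction` for the contents of the arrays. -/
def Auc (H : SimpleGraph (Fin N)) (p q : ℕ) (s : Store) : Prop :=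
  Auction (Bidder (s.arr 3)) (Allowed H p q (s.arr 3)) (fun u => s.arr 4 u) (fun u => s.arr 5 u)
    fun u => s.arr 6 u

theorem findItemCmd_spec (hB : N ≤ B) {s : Store} (h : Ctx H p q s) {u : Fin N} (h5 : s.var 5 = u)
    (h6 : s.var 6 = 0) :
    EqOff [4, 6] s (findItemCmd.run N B s) ∧
      (((findItemCmd.run N B s).var 6 = 0 ∧ ∀ v, ¬ Allowed H p q (s.arr 3) u v) ∨
        ∃ v : Fin N, (findItemCmd.run N B s).var 6 = v + 1 ∧ Allowed H p q (s.arr 3) u v ∧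
          ∀ v', Allowed H p q (s.arr 3) u v' → s.arr 6 v ≤ s.arr 6 v') := by
  have key := run_loop_inv (N := N) (B := B) (v := 4) (d := 1) (s := s)
    (c := .ite (mateE 4 (.var 5) (.var 4) * Exp.eq (.arr 3 (.var 4)) (.arr 3 (.var 5) + 1) *
    ((Exp.var 6).not + Exp.lt (.arr 6 (.var 4)) (.arr 6 (.var 6 - 1)))) (.set 6 (.var 4 + 1)) .skip)
    (fun i s' => EqOff [4, 6] s s' ∧
      ((s'.var 6 = 0 ∧ ∀ v : Fin N, (v : ℕ) < i → ¬ Allowed H p q (s.arr 3) u v) ∨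
        ∃ v : Fin N, s'.var 6 = v + 1 ∧ Allowed H p q (s.arr 3) u v ∧
          ∀ v' : Fin N, (v' : ℕ) < i → Allowed H p q (s.arr 3) u v' → s.arr 6 v ≤ s.arr 6 v'))
    ⟨⟨fun _ _ => rfl, rfl, rfl⟩, Or.inl ⟨h6, by simp⟩⟩ ?_
  · refine ⟨key.1, key.2.imp (fun h => ⟨h.1, fun v => h.2 v (by simp)⟩) ?_⟩
    rintro ⟨v, h1, h2, h3⟩
    exact ⟨v, h1, h2, fun v' => h3 v' (by simp)⟩
  rintro i hi s' ⟨h1, h2⟩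
  rw [pow_one] at hi
  have hoff : EqOff [4, 6] s (s'.setVar 4 i) := by
    refine ⟨fun w hw => ?_, h1.arr, h1.io⟩
    simp only [List.mem_cons, List.not_mem_nil, or_false, not_or] at hw
    simp [hw.1, h1.var w (by simp [hw])]
  have hC : Ctx H p q (s'.setVar 4 i) :=
    h.congr (hoff.var 0 (by decide)) (hoff.var 1 (by decide)) hoff.io (by rw [hoff.arr])
  have hv5 : (s'.setVar 4 i).var 5 = u := by rw [hoff.var 5 (by decide), h5]
  have hev : (mateE 4 (.var 5) (.var 4) * Exp.eq (.arr 3 (.var 4)) (.arr 3 (.var 5) + 1) *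
      ((Exp.var 6).not + Exp.lt (.arr 6 (.var 4)) (.arr 6 (.var 6 - 1)))).eval N B (s'.setVar 4 i) ≠ 0 ↔
      Allowed H p q (s.arr 3) u ⟨i, hi⟩ ∧ (s'.var 6 = 0 ∨ s.arr 6 i < s.arr 6 (s'.var 6 - 1)) := by
    rw [eval_mul, mul_ne_zero_iff, eval_mul, mul_ne_zero_iff,
      eval_mateE hC (u := u) (v := ⟨i, hi⟩) (by simpa using hv5) (by simp), ← hoff.arr]
    have h5' : s'.var 5 = u := by simpa using hv5
    simp [Allowed, h5']
    tauto
  -- the next state and the property of `i` that has been tested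
  by_cases hP : Allowed H p q (s.arr 3) u ⟨i, hi⟩ ∧ (s'.var 6 = 0 ∨ s.arr 6 i < s.arr 6 (s'.var 6 - 1))
  · rw [run_ite_pos _ _ _ _ _ (hev.2 hP), run_set _ _ _ _ _ (x := i + 1) (by simp) (by omega)]
    refine ⟨⟨fun w hw => ?_, hoff.arr, hoff.io⟩, Or.inr ⟨⟨i, hi⟩, by simp, hP.1, fun v' hv' ha => ?_⟩⟩
    · simp only [List.mem_cons, List.not_mem_nil, or_false, not_or] at hw
      simp [hw.1, hw.2, h1.var w (by simp [hw])]
    · rcases Nat.lt_succ_iff_lt_or_eq.1 hv' with hlt | heq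
      · rcases h2 with ⟨h2, h3⟩ | ⟨v, h2, h3, h4⟩
        · exact absurd ha (h3 v' hlt)
        · have h5 := hP.2.resolve_left (by omega)
          have := h4 v' hlt ha
          rw [h2, Nat.add_sub_cancel] at h5
          exact h5.le.trans this
      · simp [heq]
  · rw [run_ite_neg _ _ _ _ _ (by by_contra h; exact hP (hev.1 h)), Cmd.run]
    refine ⟨hoff, ?_⟩
    have hvar : (s'.setVar 4 i).var 6 = s'.var 6 := by simp
    rw [hvar]
    rcases h2 with ⟨h2, h3⟩ | ⟨v, h2, h3, h4⟩
    · refine Or.inl ⟨h2, fun v hv ha => ?_⟩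
      rcases Nat.lt_succ_iff_lt_or_eq.1 hv with hlt | heq
      · exact h3 v hlt ha
      · obtain rfl : v = ⟨i, hi⟩ := Fin.ext heq
        exact hP ⟨ha, Or.inl h2⟩
    · refine Or.inr ⟨v, h2, h3, fun v' hv' ha => ?_⟩
      rcases Nat.lt_succ_iff_lt_or_eq.1 hv' with hlt | heq
      · exact h4 v' hlt ha
      · obtain rfl : v' = ⟨i, hi⟩ := Fin.ext heq
        by_contra hlt
        refine hP ⟨ha, Or.inr ?_⟩
        rw [h2, Nat.add_sub_cancel]
        exact not_le.1 hlt

/-- A round of the auction. -/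
theorem bidCmd_spec (hB : N ≤ B) {s : Store} {u v : Fin N} (h5 : s.var 5 = u) (h6 : s.var 6 = v)
    (I : Auc H p q s) (hA : Bidder (s.arr 3) u) (hu : s.arr 4 u = 0) (hR : Allowed H p q (s.arr 3) u v)
    (hmin : ∀ v', Allowed H p q (s.arr 3) u v' → s.arr 6 v ≤ s.arr 6 v') (hlt : s.arr 6 v < N) :
    Auc H p q (bidCmd.run N B s) ∧
      ∑ w : Fin N, (bidCmd.run N B s).arr 6 w = (∑ w : Fin N, s.arr 6 w) + 1 := by
  have hv := v.isLt
  have hu' := u.isLt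
  have hclear : ∃ s1, (Cmd.ite (.arr 5 (.var 6)) (.put 4 (.arr 5 (.var 6) - 1) 0) .skip).run N B s = s1 ∧
      s1.var = s.var ∧ s1.arr 3 = s.arr 3 ∧ s1.arr 5 = s.arr 5 ∧ s1.arr 6 = s.arr 6 ∧
      ∀ w : Fin N, s1.arr 4 w = if s.arr 5 v = w + 1 then 0 else s.arr 4 w := by
    refine ⟨_, rfl, ?_⟩
    by_cases h0 : s.arr 5 v = 0
    · rw [run_ite_neg _ _ _ _ _ (by simp [h6, h0]), Cmd.run]
      exact ⟨rfl, rfl, rfl, rfl, fun w => by simp [h0]⟩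
    · obtain ⟨x, hx⟩ := I.owner v h0
      rw [run_ite_pos _ _ _ _ _ (by simp [h6, h0]), run_put _ _ _ _ _ _ (x := x) (y := 0)
        (by simp [h6, hx]) (by simp) (Nat.zero_le _)]
      refine ⟨rfl, ?_, ?_, ?_, fun w => ?_⟩
      · funext i; simp
      · funext i; simp
      · funext i; simp
      · simp only [setArr_arr, if_true, hx]
        have : (w : ℕ) = x ↔ (x : ℕ) + 1 = w + 1 := by omega
        simp only [this]
  obtain ⟨s1, e1, hvar, h3, h5', h6', h4⟩ := hclear
  have hlt' : s.arr 6 v + 1 ≤ B := by omega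
  rw [bidCmd, run_seq, e1, run_seq, run_put _ _ _ _ _ _ (x := v) (y := u + 1) (by simp [hvar, h6])
    (by simp [hvar, h5]) (by omega), run_seq, run_put _ _ _ 4 _ _ (x := u) (y := v + 1)
    (by simp [hvar, h5]) (by simp [hvar, h6]) (by omega), run_put _ _ _ _ _ _ (x := v)
    (y := s.arr 6 v + 1) (by simp [hvar, h6]) (by simp [hvar, h6, h6']) hlt']
  set s2 := ((s1.setArr 5 v (u + 1)).setArr 4 u (v + 1)).setArr 6 v (s.arr 6 v + 1) with hs2
  have a3 : s2.arr 3 = s.arr 3 := by funext i; simp [hs2, h3]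
  have a6 : ∀ w : Fin N, s2.arr 6 w = if w = v then s.arr 6 v + 1 else s.arr 6 w := fun w => by
    simp [hs2, h6', Fin.ext_iff]
  constructor
  · unfold Auc
    rw [a3]
    refine I.bid hA hu hR hmin hlt (fun w => ?_) (fun w => ?_) a6
    · simp [hs2, h4, Fin.ext_iff]
    · simp [hs2, h5', Fin.ext_iff]
  · rw [sum_congr rfl fun w _ => a6 w, ← add_sum_erase _ _ (mem_univ v),
      ← add_sum_erase (s := univ) (f := fun w : Fin N => s.arr 6 w) (a := v) (mem_univ v), if_pos rfl,
      sum_congr rfl fun w hw => if_neg (ne_of_mem_erase hw)]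
    ring

theorem auctionCmd_spec (hB : N ≤ B) {s : Store} (h : Ctx H p q s) (h4 : ∀ i < N, s.arr 4 i = 0)
    (h5 : ∀ i < N, s.arr 5 i = 0) (h6 : ∀ i < N, s.arr 6 i = 0) {M : Fin N → Fin N}
    (hM : ∀ u, Bidder (s.arr 3) u → Allowed H p q (s.arr 3) u (M u))
    (hinj : ∀ u u', Bidder (s.arr 3) u → Bidder (s.arr 3) u' → M u = M u' → u = u') :
    Auc H p q (auctionCmd.run N B s) ∧
      ∀ u : Fin N, Bidder (s.arr 3) u → (auctionCmd.run N B s).arr 4 u ≠ 0 := by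
  have key := run_loop_inv (N := N) (B := B) (v := 3) (d := 2) (s := s)
    (c := .seq (.set 5 0) (.seq findBidderCmd (.ite (.var 5) (.seq (.set 5 (.var 5 - 1))
    (.seq (.set 6 0) (.seq findItemCmd
      (.ite (.var 6) (.seq (.set 6 (.var 6 - 1)) bidCmd) .skip)))) .skip)))
    (fun k s' => Ctx H p q s' ∧ s'.arr 3 = s.arr 3 ∧ Auc H p q s' ∧
      (k ≤ ∑ v : Fin N, s'.arr 6 v ∨ ∀ u : Fin N, Bidder (s.arr 3) u → s'.arr 4 u ≠ 0))
    ⟨h, rfl, ⟨by simp [h4, h5], by simp [h4], by simp [h5], by simp [h4], by simp [h6], by simp [h6]⟩,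
      Or.inl (Nat.zero_le _)⟩ ?_
  · obtain ⟨-, -, k2, k3⟩ := key
    exact ⟨k2, fun u hu => k3.elim (fun hs => k2.matched_of_sum (by rwa [← sq]) u) fun h => h u hu⟩
  rintro k - s' ⟨hC, ha3, I, hk⟩
  rw [run_seq, run_set _ _ _ _ _ (x := 0) (by simp) (by omega), run_seq]
  set s1 := (s'.setVar 3 k).setVar 5 0 with hs1
  have hC1 : Ctx H p q s1 := (hC.setVar (by decide)).setVar (by decide)
  obtain ⟨f1, f2⟩ := run_find (N := N) (B := B) (d := 1) (by simpa) (v := 4) (c := 5) (by decide)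
    (e := Exp.lt 0 (.arr 3 (.var 4)) * Exp.lt (.arr 3 (.var 4)) 3 * (Exp.arr 4 (.var 4)).not) (s := s1)
    (by simp [hs1]) (P := fun i => (0 < s.arr 3 i ∧ s.arr 3 i < 3) ∧ s'.arr 4 i = 0)
    fun i hi s'' hs'' hv => by
      simp [hv, hs''.arr, hs1, ha3]
  change EqOff [4, 5] s1 (findBidderCmd.run N B s1) at f1
  change ((findBidderCmd.run N B s1).var 5 = 0 ∧ _) ∨ ∃ i < N ^ 1, (findBidderCmd.run N B s1).var 5 = _ ∧ _ at f2
  set s2 := findBidderCmd.run N B s1 with hs2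
  have ha2 : s2.arr = s'.arr := f1.arr
  have hC2 : Ctx H p q s2 :=
    hC1.congr (f1.var 0 (by decide)) (f1.var 1 (by decide)) f1.io (by rw [f1.arr])
  rcases f2 with ⟨hz, hall⟩ | ⟨i, hi, hv, hP⟩
  · rw [run_ite_neg _ _ _ _ _ (by simpa using hz), Cmd.run]
    refine ⟨hC2, by rw [ha2, ha3], by unfold Auc; rw [ha2]; exact I, Or.inr fun u hu h0 => ?_⟩
    exact hall u (by simp) ⟨hu, by rwa [← ha2]⟩
  rw [pow_one] at hi
  rw [run_ite_pos _ _ _ _ _ (by simp [hv]), run_seq, run_set _ _ _ _ _ (x := i) (by simp [hv])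
    (by omega), run_seq, run_set _ _ _ _ _ (x := 0) (by simp) (by omega), run_seq]
  set s3 := (s2.setVar 5 i).setVar 6 0 with hs3
  have hC3 : Ctx H p q s3 := (hC2.setVar (by decide)).setVar (by decide)
  have hs3a : s3.arr = s'.arr := ha2
  obtain ⟨g1, g2⟩ := findItemCmd_spec hB hC3 (u := ⟨i, hi⟩) (by simp [hs3]) (by simp [hs3])
  set s4 := findItemCmd.run N B s3 with hs4
  have ha4 : s4.arr = s'.arr := g1.arr.trans hs3a
  have hC4 : Ctx H p q s4 :=
    hC3.congr (g1.var 0 (by decide)) (g1.var 1 (by decide)) g1.io (by rw [g1.arr])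
  have hbid : Bidder (s'.arr 3) ⟨i, hi⟩ := by rw [ha3]; exact hP.1
  obtain ⟨x, hx, hxlt⟩ := I.exists_price_lt (by rwa [ha3]) (by rwa [ha3]) hbid hP.2
  rw [hs3a] at g2
  rcases g2 with ⟨-, hall⟩ | ⟨v, hv6, hR, hmin⟩
  · exact absurd hx (hall x)
  have hvlt := v.isLt
  rw [run_ite_pos _ _ _ _ _ (by simp [hv6]), run_seq, run_set _ _ _ _ _ (x := v) (by simp [hv6])
    (by omega)]
  set s5 := s4.setVar 6 v with hs5
  have ha5 : s5.arr = s'.arr := ha4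
  obtain ⟨I', hsum⟩ := bidCmd_spec (H := H) (p := p) (q := q) hB (s := s5) (u := ⟨i, hi⟩) (v := v)
    (by simp [hs5, g1.var 5 (by decide), hs3]) (by simp [hs5]) (by unfold Auc; rw [ha5]; exact I)
    (by rwa [ha5]) (by rw [ha5]; exact hP.2) (by rwa [ha5]) (by rwa [ha5])
    (by rw [ha5]; exact (hmin x hx).trans_lt hxlt)
  refine ⟨(hC4.setVar (by decide)).run (by rfl), ?_, I', ?_⟩
  · rw [bidCmd.arr_run _ (by rfl), ha5, ha3]
  · rw [hsum, ha5]
    rcases hk with hk | hk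
    · exact Or.inl (Nat.add_le_add_right hk 1)
    · exact absurd hP.2 (hk ⟨i, hi⟩ hP.1)

/-- Closes the paths of length two to triangles. -/
def closeCmd : Cmd :=
  .loop 4 1 (.ite (Exp.eq (.arr 3 (.var 4)) 1)
    (.put 4 (.arr 4 (.arr 4 (.var 4) - 1) - 1) (.var 4 + 1)) .skip)

theorem closeCmd_spec (hB : N ≤ B) {s : Store} {g : Fin N → Fin N}
    (hg : ∀ u : Fin N, Bidder (s.arr 3) u → s.arr 4 u = g u + 1 ∧ s.arr 3 (g u) = s.arr 3 u + 1)
    (hinj : ∀ u u' : Fin N, Bidder (s.arr 3) u → Bidder (s.arr 3) u' → g u = g u' → u = u') :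
    (∀ u : Fin N, Bidder (s.arr 3) u → (closeCmd.run N B s).arr 4 u = g u + 1) ∧
      ∀ x : Fin N, s.arr 3 x = 1 → (closeCmd.run N B s).arr 4 (g (g x)) = x + 1 := by
  have key := run_loop_inv (N := N) (B := B) (v := 4) (d := 1) (s := s)
    (c := .ite (Exp.eq (.arr 3 (.var 4)) 1)
      (.put 4 (.arr 4 (.arr 4 (.var 4) - 1) - 1) (.var 4 + 1)) .skip)
    (fun i s' => s'.arr 3 = s.arr 3 ∧ (∀ u : Fin N, Bidder (s.arr 3) u → s'.arr 4 u = g u + 1) ∧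
      ∀ x : Fin N, (x : ℕ) < i → s.arr 3 x = 1 → s'.arr 4 (g (g x)) = x + 1)
    ⟨rfl, fun u hu => (hg u hu).1, by simp⟩ ?_
  · exact ⟨key.2.1, fun x => key.2.2 x (by simp)⟩
  rintro i hi s' ⟨h1, h2, h3⟩
  rw [pow_one] at hi
  by_cases hx : s.arr 3 i = 1
  · have b0 : Bidder (s.arr 3) (⟨i, hi⟩ : Fin N) := by simp [Bidder, hx]
    have c0 := (hg _ b0).2
    rw [hx] at c0
    have b1 : Bidder (s.arr 3) (g ⟨i, hi⟩) := by simp [Bidder, c0]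
    have c1 := (hg _ b1).2
    rw [run_ite_pos _ _ _ _ _ (by simp [h1, hx]), run_put _ _ _ _ _ _ (x := g (g ⟨i, hi⟩)) (y := i + 1)
      (by simp [h2 _ b0, h2 _ b1]) (by simp) (by omega)]
    refine ⟨by funext j; simp [h1], fun u hu => ?_, fun x hxi hx' => ?_⟩
    · have hne : (u : ℕ) ≠ g (g ⟨i, hi⟩) := fun h => by
        have := hu.2
        rw [h, c1, c0] at this
        omega
      simp [hne, h2 u hu]
    · rcases Nat.lt_succ_iff_lt_or_eq.1 hxi with hlt | heq
      · have d0 : Bidder (s.arr 3) x := by simp [Bidder, hx']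
        have d1 : Bidder (s.arr 3) (g x) := by simp [Bidder, (hg _ d0).2, hx']
        have hne : ((g (g x) : Fin N) : ℕ) ≠ g (g ⟨i, hi⟩) := fun h => by
          have := hinj _ _ d0 b0 (hinj _ _ d1 b1 (Fin.ext h))
          rw [this] at hlt
          exact lt_irrefl _ hlt
        simp [hne, h3 x hlt hx']
      · obtain rfl : x = ⟨i, hi⟩ := Fin.ext heq
        simp
  · rw [run_ite_neg _ _ _ _ _ (by simp [h1, hx]), Cmd.run]
    refine ⟨h1, h2, fun x hxi hx' => ?_⟩
    rcases Nat.lt_succ_iff_lt_or_eq.1 hxi with hlt | heq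
    · exact h3 x hlt hx'
    · exact absurd (heq ▸ hx') hx

/-- Computes a permutation in the array `4` from the colours in the array `3`. -/
def matchCmd : Cmd :=
  .seq (clearCmd 4) (.seq (clearCmd 5) (.seq (clearCmd 6) (.seq auctionCmd closeCmd)))

theorem matchCmd_spec (hB : N ≤ B) {s : Store} (h : Ctx H p q s) {M : Fin N → Fin N}
    (hM : ∀ u, Bidder (s.arr 3) u → Allowed H p q (s.arr 3) u (M u))
    (hinj : ∀ u u', Bidder (s.arr 3) u → Bidder (s.arr 3) u' → M u = M u' → u = u') :
    ∃ g : Fin N → Fin N,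
      (∀ u, Bidder (s.arr 3) u → (matchCmd.run N B s).arr 4 u = g u + 1 ∧ Allowed H p q (s.arr 3) u (g u)) ∧
      ∀ x : Fin N, s.arr 3 x = 1 → (matchCmd.run N B s).arr 4 (g (g x)) = x + 1 := by
  rw [matchCmd, run_seq, run_seq, run_seq, run_seq]
  obtain ⟨a1, a2⟩ := clearCmd_spec N B 4 s
  set s1 := (clearCmd 4).run N B s with hs1
  obtain ⟨b1, b2⟩ := clearCmd_spec N B 5 s1
  set s2 := (clearCmd 5).run N B s1 with hs2
  obtain ⟨c1, c2⟩ := clearCmd_spec N B 6 s2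
  set s3 := (clearCmd 6).run N B s2 with hs3
  have hC : Ctx H p q s3 := ((h.run (by rfl)).run (by rfl)).run (by rfl)
  have e3 : s3.arr 3 = s.arr 3 := by rw [c1.arr 3 (by decide), b1.arr 3 (by decide), a1.arr 3 (by decide)]
  obtain ⟨I, hall⟩ := auctionCmd_spec hB hC
    (by rw [c1.arr 4 (by decide), b1.arr 4 (by decide)]; exact a2)
    (by rw [c1.arr 5 (by decide)]; exact b2) c2 (M := M) (by rwa [e3]) (by rwa [e3])
  set s4 := auctionCmd.run N B s3 with hs4
  have e4 : s4.arr 3 = s.arr 3 := by rw [hs4, auctionCmd.arr_run _ (by rfl), e3]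
  rw [e3] at hall
  have hex : ∀ u : Fin N, ∃ v : Fin N, Bidder (s.arr 3) u → s4.arr 4 u = v + 1 := fun u => by
    by_cases hu : Bidder (s.arr 3) u
    · obtain ⟨v, hv⟩ := I.item u (hall u hu)
      exact ⟨v, fun _ => hv⟩
    · exact ⟨u, fun h => absurd h hu⟩
  choose g hg using hex
  have hall' : ∀ u, Bidder (s.arr 3) u → Allowed H p q (s.arr 3) u (g u) := fun u hu => by
    have := (I.cheap u (g u) (hg u hu)).2.1
    rwa [e4] at this
  obtain ⟨k1, k2⟩ := closeCmd_spec (N := N) (B := B) hB (s := s4) (g := g)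
    (by rw [e4]; exact fun u hu => ⟨hg u hu, (hall' u hu).2⟩) (by
      rw [e4]
      intro u u' hu hu' he
      have h1 := (I.holds _ _).1 (hg u hu)
      have h2 := (I.holds _ _).1 (hg u' hu')
      rw [he, h2] at h1
      exact Fin.ext (by omega))
  rw [e4] at k1 k2
  exact ⟨g, fun u hu => ⟨k1 u hu, hall' u hu⟩, k2⟩

end Imp

/-! ### Colouring and testing a component -/

namespace Imp

open Finset Classical

variable {N p q : ℕ} {H : SimpleGraph (Fin N)} {B : ℕ}

/-- Colours the vertices of the triples with the label that is one more than the variable `2`, in the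
array `3`. -/
def colourCmd : Cmd :=
  .seq (clearCmd 3) (.loop 4 3 (.ite (Exp.eq (.arr 1 (.var 4)) (.var 2 + 1))
    (.seq (.put 3 (fstE (.var 4)) 1) (.seq (.put 3 (sndE (.var 4)) 2) (.put 3 (thdE (.var 4)) 3)))
    .skip))

theorem colourCmd_spec (hB : 3 ≤ B) (s : Store) :
    (∀ v : Fin N, (colourCmd.run N B s).arr 3 v ≠ 0 → ∃ t : Fin N × Fin N × Fin N,
      s.arr 1 (code t) = s.var 2 + 1 ∧ (((colourCmd.run N B s).arr 3 v = 1 ∧ v = t.1) ∨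
        ((colourCmd.run N B s).arr 3 v = 2 ∧ v = t.2.1) ∨
        ((colourCmd.run N B s).arr 3 v = 3 ∧ v = t.2.2))) ∧
    ∀ t : Fin N × Fin N × Fin N, s.arr 1 (code t) = s.var 2 + 1 →
      (colourCmd.run N B s).arr 3 t.1 ≠ 0 ∧ (colourCmd.run N B s).arr 3 t.2.1 ≠ 0 ∧
        (colourCmd.run N B s).arr 3 t.2.2 ≠ 0 := by
  rw [colourCmd, run_seq]
  obtain ⟨a1, a2⟩ := clearCmd_spec N B 3 s
  set s1 := (clearCmd 3).run N B s with hs1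
  have key := run_loop_inv (N := N) (B := B) (v := 4) (d := 3) (s := s1)
    (c := .ite (Exp.eq (.arr 1 (.var 4)) (.var 2 + 1))
    (.seq (.put 3 (fstE (.var 4)) 1) (.seq (.put 3 (sndE (.var 4)) 2) (.put 3 (thdE (.var 4)) 3)))
    .skip) (fun i s' => (s'.arr 1 = s.arr 1 ∧ s'.var 2 = s.var 2) ∧
      (∀ v : Fin N, s'.arr 3 v ≠ 0 → ∃ t : Fin N × Fin N × Fin N,
      s.arr 1 (code t) = s.var 2 + 1 ∧ ((s'.arr 3 v = 1 ∧ v = t.1) ∨ (s'.arr 3 v = 2 ∧ v = t.2.1) ∨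
        (s'.arr 3 v = 3 ∧ v = t.2.2))) ∧
    ∀ t : Fin N × Fin N × Fin N, code t < i → s.arr 1 (code t) = s.var 2 + 1 →
      s'.arr 3 t.1 ≠ 0 ∧ s'.arr 3 t.2.1 ≠ 0 ∧ s'.arr 3 t.2.2 ≠ 0)
    ⟨⟨a1.arr 1 (by decide), a1.var 2 (by decide)⟩, fun v hv => absurd (a2 v v.isLt) hv, by simp⟩ ?_
  · exact ⟨key.2.1, fun t => key.2.2 t (code_lt t)⟩
  rintro i hi s' ⟨⟨h1, h2⟩, h3, h4⟩
  obtain ⟨t, rfl⟩ := exists_code hi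
  by_cases ht : s.arr 1 (code t) = s.var 2 + 1
  · have ev : ∀ s'' : Store, s''.var 4 = code t → _ := fun s'' h =>
      eval_coords (B := B) (s := s'') (r := .var 4) (t := t) (by simpa using h)
    rw [run_ite_pos _ _ _ _ _ (by simp [h1, h2, ht]), run_seq, run_put _ _ _ _ _ _ (x := t.1) (y := 1)
      (ev _ (by simp)).1 (by simp) (by omega), run_seq, run_put _ _ _ 3 (sndE _) _ (x := t.2.1) (y := 2)
      (ev _ (by simp)).2.1 (by simp) (by omega), run_put _ _ _ 3 (thdE _) _ (x := t.2.2) (y := 3)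
      (ev _ (by simp)).2.2 (by simp) (by omega)]
    set s2 := (((s'.setVar 4 (code t)).setArr 3 t.1 1).setArr 3 t.2.1 2).setArr 3 t.2.2 3 with hs2
    have e : ∀ v : Fin N, s2.arr 3 v = if v = t.2.2 then 3 else if v = t.2.1 then 2 else
        if v = t.1 then 1 else s'.arr 3 v := fun v => by simp [hs2, Fin.ext_iff]
    refine ⟨⟨by funext j; simp [hs2, h1], by simp [hs2, h2]⟩, fun v hv => ?_, fun r hr hl => ?_⟩
    · by_cases c3 : v = t.2.2
      · exact ⟨t, ht, Or.inr (Or.inr ⟨by rw [e, if_pos c3], c3⟩)⟩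
      by_cases c2 : v = t.2.1
      · exact ⟨t, ht, Or.inr (Or.inl ⟨by rw [e, if_neg c3, if_pos c2], c2⟩)⟩
      by_cases c1 : v = t.1
      · exact ⟨t, ht, Or.inl ⟨by rw [e, if_neg c3, if_neg c2, if_pos c1], c1⟩⟩
      have e' := e v
      rw [if_neg c3, if_neg c2, if_neg c1] at e'
      rw [e'] at hv ⊢
      exact h3 v hv
    · have hne : ∀ v, s'.arr 3 (v : Fin N) ≠ 0 → s2.arr 3 v ≠ 0 := fun v hv => by
        rw [e]; split_ifs <;> simp_all
      rcases Nat.lt_succ_iff_lt_or_eq.1 hr with hlt | heq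
      · obtain ⟨x1, x2, x3⟩ := h4 r hlt hl
        exact ⟨hne _ x1, hne _ x2, hne _ x3⟩
      · obtain rfl := code_injective heq
        refine ⟨?_, ?_, ?_⟩ <;> rw [e] <;> split_ifs <;> simp_all
  · rw [run_ite_neg _ _ _ _ _ (by simp [h1, h2, ht]), Cmd.run]
    refine ⟨⟨h1, by simp [h2]⟩, h3, fun r hr hl => ?_⟩
    rcases Nat.lt_succ_iff_lt_or_eq.1 hr with hlt | heq
    · exact h4 r hlt hl
    · obtain rfl := code_injective heq
      exact absurd hl ht

/-- The colour of `v` and its successor satisfy the conditions of `Block`. -/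
def Good (H : SimpleGraph (Fin N)) (p q : ℕ) (s : Store) (v : Fin N) : Prop :=
  (∃ w : Fin N, s.arr 4 v = w + 1 ∧ s.arr 3 w = s.arr 3 v % 3 + 1 ∧
    s.arr 4 (s.arr 4 w - 1) - 1 = v ∧ Mate H p q 16 v w) ∧
  q * #{w : Fin N | H.Adj v w ∧ s.arr 3 w = 0} ≤ 8 * p * codeg H v v ∧
  #{w : Fin N | H.Adj v w ∧ s.arr 3 w = s.arr 3 v} = 0

/-- The test `Good` for the vertex in the variable `3`, when the variables `5` and `6` hold the numbers
of its neighbours without colour and of the same colour. -/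
def goodE : Exp :=
  Exp.lt 0 (.arr 4 (.var 3)) * Exp.lt (.arr 4 (.var 3)) (.n + 1) *
    Exp.eq (.arr 3 (.arr 4 (.var 3) - 1)) (.arr 3 (.var 3) - .arr 3 (.var 3) / 3 * 3 + 1) *
    Exp.eq (.arr 4 (.arr 4 (.arr 4 (.var 3) - 1) - 1) - 1) (.var 3) *
    mateE 16 (.var 3) (.arr 4 (.var 3) - 1) *
    (Exp.lt (8 * .var 0 * codegE (.var 3) (.var 3)) (.var 1 * .var 5)).not * (Exp.var 6).not

/-- Clears the variable `7` if the vertex in the variable `3` is not `Good`. -/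
def testVertexCmd : Cmd :=
  .seq (.set 5 0) (.seq
    (.loop 4 1 (.ite (adjE (.var 3) (.var 4) * Exp.eq (.arr 3 (.var 4)) 0) (.set 5 (.var 5 + 1)) .skip))
    (.seq (.set 6 0) (.seq
      (.loop 4 1 (.ite (adjE (.var 3) (.var 4) * Exp.eq (.arr 3 (.var 4)) (.arr 3 (.var 3)))
        (.set 6 (.var 6 + 1)) .skip))
      (.ite goodE .skip (.set 7 0)))))

/-- Tests whether the colours and the permutation form a block; the result is in the variable `7`. -/
def testCmd : Cmd :=
  .seq (.set 7 1) (.loop 3 1 (.ite (.arr 3 (.var 3)) testVertexCmd .skip))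

theorem EqOff.trans {l l' : List ℕ} {s s' s'' : Store} (h : EqOff l s s') (h' : EqOff l' s' s'')
    (hl : ∀ w ∈ l', w ∈ l) : EqOff l s s'' :=
  ⟨fun w hw => (h'.var w fun h => hw (hl w h)).trans (h.var w hw), h'.arr.trans h.arr, h'.io.trans h.io⟩

theorem EqOff.setVar {l : List ℕ} {s s' : Store} (h : EqOff l s s') {v x : ℕ} (hv : v ∈ l) :
    EqOff l s (s'.setVar v x) :=
  ⟨fun w hw => by
    have : w ≠ v := fun h => hw (h ▸ hv)
    simp [this, h.var w hw], h.arr, h.io⟩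

theorem EqOff.refl (l : List ℕ) (s : Store) : EqOff l s s := ⟨fun _ _ => rfl, rfl, rfl⟩

theorem EqOff.ctx {l : List ℕ} {s s' : Store} (h : EqOff l s s') (hC : Ctx H p q s) (h0 : 0 ∉ l)
    (h1 : 1 ∉ l) : Ctx H p q s' :=
  hC.congr (h.var 0 h0) (h.var 1 h1) h.io (by rw [h.arr])

theorem run_count_eqOff {v c : ℕ} {e : Exp} (s : Store) :
    EqOff [v, c] s ((Cmd.loop v 1 (.ite e (.set c (.var c + 1)) .skip)).run N B s) := by
  refine ⟨fun w hw => ?_, ?_, ?_⟩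
  · simp only [List.mem_cons, List.not_mem_nil, or_false, not_or] at hw
    exact Cmd.var_run _ _ (by simp [Cmd.keepsVar, Ne.symm hw.1, Ne.symm hw.2])
  · funext b; exact Cmd.arr_run _ _ (by simp [Cmd.keepsArr])
  · exact Cmd.io_run _ _ (by simp [Cmd.keepsIo])

theorem eval_goodE {s : Store} (h : Ctx H p q s) {v : Fin N} (h3 : s.var 3 = v)
    (h5 : s.var 5 = #{w : Fin N | H.Adj v w ∧ s.arr 3 w = 0})
    (h6 : s.var 6 = #{w : Fin N | H.Adj v w ∧ s.arr 3 w = s.arr 3 v}) :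
    goodE.eval N B s ≠ 0 ↔ Good H p q s v := by
  have hmod : s.arr 3 v - s.arr 3 v / 3 * 3 = s.arr 3 v % 3 := by omega
  unfold goodE Good
  simp only [eval_mul, mul_ne_zero_iff]
  by_cases hr : 0 < s.arr 4 v ∧ s.arr 4 v < N + 1
  · set w : Fin N := ⟨s.arr 4 v - 1, by omega⟩ with hw
    have hw1 : s.arr 4 v = w + 1 := by simp [hw]; omega
    rw [eval_mateE h (u := v) (v := w) (by simpa using h3) (by simp [h3, hw])]
    have hw' : ∀ w' : Fin N, s.arr 4 v = w' + 1 → w' = w := fun w' h' => Fin.ext (by simp [hw]; omega)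
    have hex : (∃ w : Fin N, s.arr 4 v = w + 1 ∧ s.arr 3 w = s.arr 3 v % 3 + 1 ∧
        s.arr 4 (s.arr 4 w - 1) - 1 = v ∧ Mate H p q 16 v w) ↔ (s.arr 3 w = s.arr 3 v % 3 + 1 ∧
        s.arr 4 (s.arr 4 w - 1) - 1 = v ∧ Mate H p q 16 v w) :=
      ⟨fun ⟨w', h1, h2⟩ => hw' w' h1 ▸ h2, fun h => ⟨w, hw1, h⟩⟩
    have e1 : s.arr 4 v - 1 = w := rfl
    rw [hex]
    simp [codegE, h3, h.p, h.q, h.codeg, hr, e1, h5, h6, hmod]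
    tauto
  · have : ¬ ∃ w : Fin N, s.arr 4 v = w + 1 ∧ s.arr 3 w = s.arr 3 v % 3 + 1 ∧
        s.arr 4 (s.arr 4 w - 1) - 1 = v ∧ Mate H p q 16 v w := fun ⟨w, hw, _⟩ => hr (by
      have := w.isLt; omega)
    simp only [this, false_and, iff_false]
    simp only [ne_eq, eval_lt_eq_zero, not_not, eval_arr, eval_var, h3, eval_add, eval_n, eval_lit]
    tauto

theorem testVertexCmd_spec (hB : N * N ≤ B) {s : Store} (h : Ctx H p q s) {v : Fin N}
    (h3 : s.var 3 = v) : EqOff [4, 5, 6, 7] s (testVertexCmd.run N B s) ∧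
      (testVertexCmd.run N B s).var 7 = if Good H p q s v then s.var 7 else 0 := by
  have hNB : N ≤ B := (Nat.le_mul_self N).trans hB
  rw [testVertexCmd, run_seq, run_set _ _ _ _ _ (x := 0) (by simp) (by omega), run_seq]
  set s1 := s.setVar 5 0 with hs1
  have o1 : EqOff [4, 5, 6, 7] s s1 := (EqOff.refl _ _).setVar (by decide)
  have h50 : s1.var 5 = 0 := by simp [hs1]
  have hc5 := run_count (N := N) (B := B) hNB (v := 4) (c := 5)
    (e := adjE (.var 3) (.var 4) * Exp.eq (.arr 3 (.var 4)) 0) (by decide) h50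
    (P := fun w => H.Adj v w ∧ s.arr 3 w = 0) fun w s' hs' hv => by
      have ho := o1.trans hs' (by decide)
      rw [eval_mul, mul_ne_zero_iff, eval_adjE hB (ho.ctx h (by decide) (by decide)).toHasInput (u := v)
        (v := w) (by simp [ho.var 3 (by decide), h3]) (by simp [hv])]
      simp [hv, ho.arr]
  have o2 := o1.trans (run_count_eqOff (N := N) (B := B) (v := 4) (c := 5)
    (e := adjE (.var 3) (.var 4) * Exp.eq (.arr 3 (.var 4)) 0) s1) (by decide)
  set s2 := (Cmd.loop 4 1 (.ite (adjE (.var 3) (.var 4) * Exp.eq (.arr 3 (.var 4)) 0)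
    (.set 5 (.var 5 + 1)) .skip)).run N B s1 with hs2
  rw [run_seq, run_set _ _ _ _ _ (x := 0) (by simp) (by omega), run_seq]
  set s3 := s2.setVar 6 0 with hs3
  have o3 : EqOff [4, 5, 6, 7] s s3 := o2.setVar (by decide)
  have h60 : s3.var 6 = 0 := by simp [hs3]
  have hc6 := run_count (N := N) (B := B) hNB (v := 4) (c := 6)
    (e := adjE (.var 3) (.var 4) * Exp.eq (.arr 3 (.var 4)) (.arr 3 (.var 3))) (by decide) h60
    (P := fun w => H.Adj v w ∧ s.arr 3 w = s.arr 3 v) fun w s' hs' hv => by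
      have ho := o3.trans hs' (by decide)
      rw [eval_mul, mul_ne_zero_iff, eval_adjE hB (ho.ctx h (by decide) (by decide)).toHasInput (u := v)
        (v := w) (by simp [ho.var 3 (by decide), h3]) (by simp [hv])]
      simp [hv, ho.arr, ho.var 3 (by decide), h3]
  have o34 := run_count_eqOff (N := N) (B := B) (v := 4) (c := 6)
    (e := adjE (.var 3) (.var 4) * Exp.eq (.arr 3 (.var 4)) (.arr 3 (.var 3))) s3
  have o4 := o3.trans o34 (by decide)
  set s4 := (Cmd.loop 4 1 (.ite (adjE (.var 3) (.var 4) * Exp.eq (.arr 3 (.var 4)) (.arr 3 (.var 3)))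
    (.set 6 (.var 6 + 1)) .skip)).run N B s3 with hs4
  have h45 : s4.var 5 = #{w : Fin N | H.Adj v w ∧ s.arr 3 w = 0} := by
    rw [o34.var 5 (by decide), hs3, setVar_var, if_neg (by decide), hc5]
  have h47 : s4.var 7 = s.var 7 := by
    rw [o34.var 7 (by decide), hs3, setVar_var, if_neg (by decide), hs2,
      Cmd.var_run _ _ (by rfl), hs1, setVar_var, if_neg (by decide)]
  have hg := eval_goodE (B := B) (o4.ctx h (by decide) (by decide)) (v := v)
    (by rw [o4.var 3 (by decide), h3]) (by rw [o4.arr]; exact h45) (by rw [o4.arr]; exact hc6)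
  have hGood : Good H p q s4 v ↔ Good H p q s v := by unfold Good; rw [o4.arr]
  rw [hGood] at hg
  by_cases hG : Good H p q s v
  · rw [run_ite_pos _ _ _ _ _ (hg.2 hG), if_pos hG]
    exact ⟨o4, h47⟩
  · rw [run_ite_neg _ _ _ _ _ (by by_contra h; exact hG (hg.1 h)), if_neg hG,
      run_set _ _ _ _ _ (x := 0) (by simp) (by omega)]
    exact ⟨o4.setVar (by decide), by simp⟩

theorem testCmd_spec (hB : N * N ≤ B) (hB1 : 1 ≤ B) {s : Store} (h : Ctx H p q s) :
    EqOff [3, 4, 5, 6, 7] s (testCmd.run N B s) ∧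
      ((testCmd.run N B s).var 7 ≠ 0 ↔ ∀ v : Fin N, s.arr 3 v ≠ 0 → Good H p q s v) := by
  rw [testCmd, run_seq, run_set _ _ _ _ _ (x := 1) (by simp) hB1]
  have key := run_loop_inv (N := N) (B := B) (v := 3) (d := 1) (s := s.setVar 7 1)
    (c := .ite (.arr 3 (.var 3)) testVertexCmd .skip)
    (fun i s' => EqOff [3, 4, 5, 6, 7] s s' ∧
      (s'.var 7 ≠ 0 ↔ ∀ v : Fin N, (v : ℕ) < i → s.arr 3 v ≠ 0 → Good H p q s v))
    ⟨(EqOff.refl _ _).setVar (by decide), by simp⟩ ?_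
  · refine ⟨key.1, key.2.trans ⟨fun h v => h v (by simp), fun h v _ => h v⟩⟩
  rintro i hi s' ⟨h1, h2⟩
  rw [pow_one] at hi
  have o1 : EqOff [3, 4, 5, 6, 7] s (s'.setVar 3 i) := h1.setVar (by decide)
  have hiff : (∀ v : Fin N, (v : ℕ) < i + 1 → s.arr 3 v ≠ 0 → Good H p q s v) ↔
      (∀ v : Fin N, (v : ℕ) < i → s.arr 3 v ≠ 0 → Good H p q s v) ∧
        (s.arr 3 i ≠ 0 → Good H p q s ⟨i, hi⟩) := by
    refine ⟨fun h => ⟨fun v hv => h v (by omega), h ⟨i, hi⟩ (by simp)⟩, fun h v hv => ?_⟩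
    rcases Nat.lt_succ_iff_lt_or_eq.1 hv with hlt | heq
    · exact h.1 v hlt
    · obtain rfl : v = ⟨i, hi⟩ := Fin.ext heq
      exact h.2
  rw [hiff, ← h2]
  by_cases h0 : s.arr 3 i = 0
  · rw [run_ite_neg _ _ _ _ _ (by simp [h1.arr, h0]), Cmd.run]
    exact ⟨o1, by simp [h0]⟩
  · rw [run_ite_pos _ _ _ _ _ (by simp [h1.arr, h0])]
    obtain ⟨t1, t2⟩ := testVertexCmd_spec hB (o1.ctx h (by decide) (by decide)) (v := ⟨i, hi⟩) (by simp)
    refine ⟨o1.trans t1 (by decide), ?_⟩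
    have hGood : Good H p q (s'.setVar 3 i) ⟨i, hi⟩ ↔ Good H p q s ⟨i, hi⟩ := by
      unfold Good; rw [o1.arr]
    rw [t2, hGood]
    by_cases hG : Good H p q s ⟨i, hi⟩ <;> simp [hG, h0]

/-- The successor of `v` according to the array `4`. -/
def succOf (s : Store) (v : Fin N) : Fin N :=
  if h : s.arr 4 v - 1 < N then ⟨s.arr 4 v - 1, h⟩ else v

theorem succOf_of_eq {s : Store} {v w : Fin N} (h : s.arr 4 v = w + 1) : succOf s v = w := by
  have : s.arr 4 v - 1 = w := by omega
  unfold succOf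
  rw [dif_pos (by omega)]
  exact Fin.ext this

/-- The test is sound. -/
theorem block_of_good {s : Store} (h : ∀ v : Fin N, s.arr 3 v ≠ 0 → Good H p q s v) :
    Block H p q (fun v => s.arr 3 v) (succOf s) ∧
      ∀ v : Fin N, s.arr 3 v ≠ 0 → s.arr 4 v = succOf s v + 1 := by
  have hs : ∀ v : Fin N, s.arr 3 v ≠ 0 → s.arr 4 v = succOf s v + 1 := fun v hv => by
    obtain ⟨⟨w, hw, -⟩, -⟩ := h v hv
    rw [succOf_of_eq hw, hw]
  have hn : ∀ v : Fin N, s.arr 3 v ≠ 0 → s.arr 3 (succOf s v) = s.arr 3 v % 3 + 1 := fun v hv => by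
    obtain ⟨⟨w, hw, h1, -⟩, -⟩ := h v hv
    rw [succOf_of_eq hw, h1]
  refine ⟨⟨hn, fun v hv => ?_, fun v hv => ?_, fun v hv => (h v hv).2.1, fun v w hv ha he => ?_⟩, hs⟩
  · have h1 : s.arr 3 (succOf s v) ≠ 0 := by rw [hn v hv]; omega
    have h2 : s.arr 3 (succOf s (succOf s v)) ≠ 0 := by rw [hn _ h1]; omega
    obtain ⟨⟨w, hw, -, h3, -⟩, -⟩ := h v hv
    rw [← succOf_of_eq hw, hs _ h1, Nat.add_sub_cancel, hs _ h2, Nat.add_sub_cancel] at h3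
    exact Fin.ext h3
  · obtain ⟨⟨w, hw, -, -, hm⟩, -⟩ := h v hv
    rwa [succOf_of_eq hw]
  · have := (h v hv).2.2
    rw [card_eq_zero, filter_eq_empty_iff] at this
    exact this (mem_univ w) ⟨ha, he⟩

/-- The test is complete. -/
theorem good_of_block {s : Store} {g : Fin N → Fin N} (b : Block H p q (fun v => s.arr 3 v) g)
    (hg : ∀ v : Fin N, s.arr 3 v ≠ 0 → s.arr 4 v = g v + 1) (v : Fin N) (hv : s.arr 3 v ≠ 0) :
    Good H p q s v := by
  have h1 : s.arr 3 (g v) ≠ 0 := b.col_g_ne hv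
  have h2 : s.arr 3 (g (g v)) ≠ 0 := b.col_g_ne h1
  refine ⟨⟨g v, hg v hv, b.col_next v hv, ?_, b.mate v hv⟩, b.leave v hv, ?_⟩
  · rw [hg _ h1, Nat.add_sub_cancel, hg _ h2, Nat.add_sub_cancel, b.cyc v hv]
  · rw [card_eq_zero, filter_eq_empty_iff]
    exact fun w _ hw => b.proper v w hv hw.1 hw.2

end Imp

/-! ### The test succeeds on the components of the true triples -/

namespace Near

open Finset Classical

variable {V β : Type*} [Fintype V] [Fintype β] {H : SimpleGraph V} {G : SimpleGraph β}
  {e : V ≃ Fin 3 × β} {p q : ℕ} {S : Set (V × V × V)} (N : Near H G e p q) (hpq : 540 * p < q)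
include N hpq

theorem exists_adj_of_snd_eq {u v : V} (huv : (e u).2 = (e v).2) (hu : ∃ w, H.Adj u w) :
    ∃ w, H.Adj v w := by
  obtain ⟨w, hw⟩ := hu
  have h1 := N.nbrs_pos hw
  rw [huv] at h1
  have h2 := N.deg_add_missing v
  have h3 : q * missing H G e v ≤ 2 * p * nbrs G (e v).2 := N.miss v
  have h4 : 0 < codeg H v v := by
    by_contra h0
    have h0' : codeg H v v = 0 := by omega
    rw [h0', zero_add] at h2
    rw [h2] at h3
    nlinarith
  rw [codeg_self] at h4
  obtain ⟨w, hw⟩ := card_pos.1 h4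
  exact ⟨w, (mem_filter.1 hw).2⟩

theorem rainbow_trueTriple {v : V} (hv : ∃ w, H.Adj v w) : Rainbow H e (trueTriple e (e v).2) :=
  ⟨by simp [trueTriple], by simp [trueTriple], by simp [trueTriple],
    N.exists_adj_of_snd_eq hpq (by simp [trueTriple]) hv⟩

/-- The colours that the triples of a component prescribe are the labels in `K₃ × G`, on the vertices
whose true triple belongs to the component. -/
theorem col_eq (hS : LinkClosed H p q S) (hn : ∀ t ∈ S, IsNode H p q t) (hr : ∀ t ∈ S, Rainbow H e t)
    {col : V → ℕ} (h1 : ∀ v, col v ≠ 0 → ∃ t ∈ S, (col v = 1 ∧ v = t.1) ∨ (col v = 2 ∧ v = t.2.1) ∨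
      (col v = 3 ∧ v = t.2.2))
    (h2 : ∀ t ∈ S, col t.1 ≠ 0 ∧ col t.2.1 ≠ 0 ∧ col t.2.2 ≠ 0) (v : V) :
    col v = if trueTriple e (e v).2 ∈ S then ((e v).1 : ℕ) + 1 else 0 := by
  have key : col v ≠ 0 → trueTriple e (e v).2 ∈ S ∧ col v = (e v).1 + 1 := fun hv => by
    obtain ⟨t, ht, h⟩ := h1 v hv
    obtain ⟨m1, m2, m3⟩ := N.trueTriple_mem hpq hS ht (hn t ht) (hr t ht)
    obtain ⟨r1, r2, r3, -⟩ := hr t ht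
    rcases h with ⟨hc, rfl⟩ | ⟨hc, rfl⟩ | ⟨hc, rfl⟩
    · exact ⟨m1, by rw [hc, r1]; rfl⟩
    · exact ⟨m2, by rw [hc, r2]; rfl⟩
    · exact ⟨m3, by rw [hc, r3]; rfl⟩
  by_cases hv : trueTriple e (e v).2 ∈ S
  · rw [if_pos hv]
    have h0 : ∀ i h, e v = (i, h) → col v ≠ 0 := fun i h hi => by
      obtain ⟨x0, x1, x2⟩ := h2 _ hv
      have hv' : v = e.symm (i, h) := by rw [← hi, e.symm_apply_apply]
      rw [hi] at x0 x1 x2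
      simp only [trueTriple] at x0 x1 x2
      rw [hv']
      fin_cases i
      · exact x0
      · exact x1
      · exact x2
    exact (key (h0 _ _ rfl)).2
  · rw [if_neg hv]
    by_contra h
    exact hv (key h).1

omit hpq N in
/-- The three colour classes have the same size, so that the matchings are onto. -/
theorem matching_surjective {col : V → ℕ}
    (hcol : ∀ v, col v = if trueTriple e (e v).2 ∈ S then ((e v).1 : ℕ) + 1 else 0) {g : V → V}
    (hg : ∀ v, col v = 1 ∨ col v = 2 → col (g v) = col v + 1)
    (hc : ∀ x, col x = 1 → g (g (g x)) = x) :
    (∀ y, col y = 2 → ∃ x, col x = 1 ∧ g x = y) ∧ ∀ z, col z = 3 → ∃ x, col x = 1 ∧ g (g x) = z := by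
  have hcard : ∀ j : Fin 3, #{v | col v = (j : ℕ) + 1} = #{h | trueTriple e h ∈ S} := fun j => by
    refine card_bij' (fun v _ => (e v).2) (fun h _ => e.symm (j, h)) ?_ ?_ ?_ ?_
    · intro v hv
      simp only [mem_filter, mem_univ, true_and, hcol] at hv ⊢
      by_contra h
      simp [h] at hv
    · intro h hh
      simp only [mem_filter, mem_univ, true_and] at hh
      simp [hcol, hh]
    · intro v hv
      simp only [mem_filter, mem_univ, true_and, hcol] at hv
      split at hv
      · have : (e v).1 = j := Fin.ext (by omega)
        rw [← this]; simp
      · simp at hv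
    · intro h hh; simp
  have key : ∀ f : V → V, ∀ k : Fin 3, (∀ x, col x = 1 → col (f x) = (k : ℕ) + 1) →
      (∀ x x', col x = 1 → col x' = 1 → f x = f x' → x = x') →
      ∀ y, col y = (k : ℕ) + 1 → ∃ x, col x = 1 ∧ f x = y := by
    intro f k hf hinj y hy
    have himg : (({x | col x = 1} : Finset V).image f) = ({y | col y = (k : ℕ) + 1} : Finset V) := by
      refine eq_of_subset_of_card_le (fun y hy => ?_) ?_
      · obtain ⟨x, hx, rfl⟩ := mem_image.1 hy
        simp only [mem_filter, mem_univ, true_and] at hx ⊢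
        exact hf x hx
      · rw [card_image_of_injOn, hcard k]
        · exact (hcard 0).ge
        · intro x hx x' hx' he
          simp only [coe_filter, mem_univ, true_and] at hx hx'
          exact hinj x x' hx hx' he
    have : y ∈ (({x | col x = 1} : Finset V).image f) := by rw [himg]; simp [hy]
    obtain ⟨x, hx, rfl⟩ := mem_image.1 this
    exact ⟨x, (mem_filter.1 hx).2, rfl⟩
  refine ⟨key g 1 (fun x hx => by rw [hg x (Or.inl hx), hx]; rfl) (fun x x' hx hx' he => ?_),
    key (fun x => g (g x)) 2 (fun x hx => ?_) (fun x x' hx hx' he => ?_)⟩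
  · rw [← hc x hx, he, hc x' hx']
  · have h1 := hg x (Or.inl hx)
    rw [hg (g x) (Or.inr (by rw [h1, hx])), h1, hx]; rfl
  · rw [← hc x hx, ← hc x' hx']; exact congrArg g he

end Near

namespace Imp

open Finset Classical

variable {N p q : ℕ} {H : SimpleGraph (Fin N)} {B : ℕ}

/-- Colours, matches and tests a component. -/
def classCmd : Cmd := .seq colourCmd (.seq matchCmd testCmd)

theorem classCmd_passes {β : Type*} [Fintype β] {G : SimpleGraph β} {e : Fin N ≃ Fin 3 × β}
    (hN : Near H G e p q) (hpq : 540 * p < q) (hB : N * N ≤ B) (hB3 : 3 ≤ B) {s : Store}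
    (h : Ctx H p q s)
    (hclosed : LinkClosed H p q {t | s.arr 1 (code t) = s.var 2 + 1})
    (hnode : ∀ t, s.arr 1 (code t) = s.var 2 + 1 → IsNode H p q t)
    (hconn : ∀ t t', s.arr 1 (code t) = s.var 2 + 1 → s.arr 1 (code t') = s.var 2 + 1 →
      ∀ C, LinkClosed H p q C → t ∈ C → t' ∈ C)
    {v : Fin N} (hv : ∃ w, H.Adj v w) (hmem : s.arr 1 (code (trueTriple e (e v).2)) = s.var 2 + 1) :
    (classCmd.run N B s).var 7 ≠ 0 ∧ (classCmd.run N B s).arr 3 v ≠ 0 := by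
  have hNB : N ≤ B := (Nat.le_mul_self N).trans hB
  rw [classCmd, run_seq, run_seq]
  obtain ⟨c1, c2⟩ := colourCmd_spec (N := N) hB3 s
  set s1 := colourCmd.run N B s with hs1
  have hC1 : Ctx H p q s1 := h.run (by rfl)
  set S : Set (Fin N × Fin N × Fin N) := {t | s.arr 1 (code t) = s.var 2 + 1} with hS
  have hrain : ∀ t ∈ S, Rainbow H e t := fun t ht =>
    hconn _ t hmem ht {t | Rainbow H e t} (fun a ha b _ hab => hN.rainbow_of_linked hab ha)
      (hN.rainbow_trueTriple hpq hv)
  have hcol := hN.col_eq hpq hclosed hnode hrain (col := fun v => s1.arr 3 v) c1 c2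
  have hbid : ∀ u, Bidder (s1.arr 3) u → trueTriple e (e u).2 ∈ S ∧ s1.arr 3 u = (e u).1 + 1 ∧
      ((e u).1 : ℕ) < 2 := fun u hu => by
    have := hcol u
    have h1 := hu.1
    have h2 := hu.2
    rw [this] at h1 h2
    split at this
    · next hm => rw [if_pos hm] at h2; exact ⟨hm, this, by omega⟩
    · next hm => rw [if_neg hm] at h1; omega
  obtain ⟨g, g1, g2⟩ := matchCmd_spec hNB hC1 (M := fun u => e.symm ((e u).1 + 1, (e u).2))
    (fun u hu => by
      obtain ⟨b1, b2, b3⟩ := hbid u hu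
      refine ⟨hN.mate_of_snd_eq (by omega) (by simp) (by simp), ?_⟩
      have := hcol (e.symm ((e u).1 + 1, (e u).2))
      simp only [e.apply_symm_apply, if_pos b1] at this
      rw [this, b2, Fin.val_add, Fin.val_one, Nat.mod_eq_of_lt (by omega)])
    (fun u u' _ _ he => by
      have := e.symm.injective he
      rw [Prod.mk.injEq, add_left_inj] at this
      exact e.injective (Prod.ext this.1 this.2))
  set s2 := matchCmd.run N B s1 with hs2
  have a3 : s2.arr 3 = s1.arr 3 := matchCmd.arr_run _ (by rfl)
  have hC2 : Ctx H p q s2 := hC1.run (by rfl)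
  obtain ⟨t1, t2⟩ := testCmd_spec hB (by omega) hC2
  rw [t1.arr]
  have hv0 : s2.arr 3 v ≠ 0 := by
    rw [a3]
    have := hcol v
    rw [this, if_pos (show _ ∈ S from hmem)]
    omega
  refine ⟨t2.2 ?_, hv0⟩
  -- the permutation is closed up to triangles
  let g' : Fin N → Fin N := succOf s2
  have hb : ∀ u : Fin N, s1.arr 3 u = 1 ∨ s1.arr 3 u = 2 → Bidder (s1.arr 3) u := fun u hu => by
    unfold Bidder; omega
  have e1 : ∀ u : Fin N, s1.arr 3 u = 1 ∨ s1.arr 3 u = 2 → g' u = g u := fun u hu =>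
    succOf_of_eq (g1 u (hb u hu)).1
  have hg' : ∀ u : Fin N, s1.arr 3 u = 1 ∨ s1.arr 3 u = 2 →
      s1.arr 3 (g' u) = s1.arr 3 u + 1 ∧ Mate H p q 4 u (g' u) := fun u hu => by
    rw [e1 u hu]
    exact ⟨(g1 u (hb u hu)).2.2, (g1 u (hb u hu)).2.1⟩
  have e2 : ∀ x : Fin N, s1.arr 3 x = 1 → g' (g' x) = g (g x) := fun x hx => by
    have := (hg' x (Or.inl hx)).1
    rw [e1 (g' x) (Or.inr (by rw [this, hx])), e1 x (Or.inl hx)]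
  have hc : ∀ x : Fin N, s1.arr 3 x = 1 → g' (g' (g' x)) = x := fun x hx => by
    rw [e2 x hx]; exact succOf_of_eq (g2 x hx)
  obtain ⟨k2, k3⟩ := Near.matching_surjective hcol (g := g') (fun u hu => (hg' u hu).1) hc
  have hblock := hN.block hpq hclosed hcol hg' hc k2 k3
  refine good_of_block (g := g') (by rw [a3]; exact hblock) fun u hu => ?_
  have hle : s1.arr 3 u ≤ 3 := by
    have := hcol u
    rw [this]; split <;> omega
  rw [a3] at hu
  by_cases h3 : s1.arr 3 u = 3
  · obtain ⟨x, hx, rfl⟩ := k3 u h3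
    rw [hc x hx, e2 x hx]
    exact g2 x hx
  · rw [e1 u (by omega)]
    exact (g1 u (hb u (by omega))).1

/-- The test is sound. -/
theorem classCmd_sound (hB : N * N ≤ B) (hB1 : 1 ≤ B) {s : Store} (h : Ctx H p q s)
    (ht : (classCmd.run N B s).var 7 ≠ 0) :
    Block H p q (fun v => (classCmd.run N B s).arr 3 v) (succOf (classCmd.run N B s)) ∧
      ∀ v : Fin N, (classCmd.run N B s).arr 3 v ≠ 0 →
        (classCmd.run N B s).arr 4 v = succOf (classCmd.run N B s) v + 1 := by
  rw [classCmd, run_seq, run_seq] at *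
  have hC2 : Ctx H p q (matchCmd.run N B (colourCmd.run N B s)) := (h.run (by rfl)).run (by rfl)
  obtain ⟨t1, t2⟩ := testCmd_spec hB hB1 hC2
  have := block_of_good (t2.1 ht)
  have e : succOf (N := N) (testCmd.run N B (matchCmd.run N B (colourCmd.run N B s))) =
      succOf (matchCmd.run N B (colourCmd.run N B s)) := by
    funext v; unfold succOf; simp only [t1.arr]
  rw [e, t1.arr]
  exact this

end Imp

/-! ### Placing the triples -/

section Layout

open Finset Classical

variable {V : Type*}

theorem stage_eq_of_forall {m : ℕ} {col : ℕ → V → ℕ} {v : V} {i : ℕ} (hi : i < m) (h : col i v ≠ 0)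
    (h' : ∀ j < i, col j v = 0) : stage m col v = i := by
  refine le_antisymm (stage_le_of_ne hi h) ?_
  by_contra hlt
  exact col_stage_ne (m := m) (by omega) (h' _ (by omega))

theorem stage_eq_self {m : ℕ} {col : ℕ → V → ℕ} {v : V} (h : ∀ j < m, col j v = 0) :
    stage m col v = m := by
  by_contra hne
  have := stage_le (m := m) (col := col) (v := v)
  exact col_stage_ne (v := v) (m := m) (by omega) (h _ (by omega))

/-- A block is added as the last one. -/
theorem stage_update {m : ℕ} {col : ℕ → V → ℕ} {nc : V → ℕ} {v : V} :
    (stage m col v < m → stage (m + 1) (Function.update col m nc) v = stage m col v) ∧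
    (stage m col v = m → nc v ≠ 0 → stage (m + 1) (Function.update col m nc) v = m) ∧
    (stage m col v = m → nc v = 0 → stage (m + 1) (Function.update col m nc) v = m + 1) := by
  have hlt : ∀ j < m, Function.update col m nc j = col j := fun j hj =>
    Function.update_of_ne (by omega) _ _
  have h0 : ∀ j < stage m col v, Function.update col m nc j v = 0 := fun j hj => by
    rw [hlt j (hj.trans_le stage_le)]
    exact col_eq_zero_of_lt hj
  refine ⟨fun h => ?_, fun h hc => ?_, fun h hc => ?_⟩
  · refine stage_eq_of_forall (by omega) ?_ h0
    rw [hlt _ h]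
    exact col_stage_ne h
  · refine stage_eq_of_forall (by omega) (by simpa using hc) ?_
    rwa [h] at h0
  · refine stage_eq_self fun j hj => ?_
    rcases Nat.lt_succ_iff_lt_or_eq.1 hj with hj | rfl
    · exact h0 j (by omega)
    · simpa using hc

/-- The positions `pos v` that have been assigned (`asg v ≠ 0`) respect the intact triples of a
sequence of blocks which cover the vertices with `used v ≠ 0`. -/
def Layout [Fintype V] (H : SimpleGraph V) (p q : ℕ) (used asg pos : V → ℕ) : Prop :=
  (∀ v, asg v ≠ 0 → used v ≠ 0) ∧ ∃ (m : ℕ) (col : ℕ → V → ℕ) (g : ℕ → V → V),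
    (∀ i < m, Block H p q (col i) (g i)) ∧ (∀ v, used v ≠ 0 ↔ stage m col v < m) ∧
    ∀ v, Intact m col g v → asg v ≠ 0 ∧ asg (g (stage m col v) v) ≠ 0 ∧
      pos v % 3 + 1 = col (stage m col v) v ∧ pos (g (stage m col v) v) / 3 = pos v / 3

theorem Layout.extend [Fintype V] {H : SimpleGraph V} {p q : ℕ} {used asg pos used' asg' pos' : V → ℕ}
    (L : Layout H p q used asg pos) {nc : V → ℕ} {ng : V → V} (b : Block H p q nc ng)
    (hused : ∀ v, used' v ≠ 0 ↔ used v ≠ 0 ∨ nc v ≠ 0)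
    (hasg : ∀ v, asg' v ≠ 0 → asg v ≠ 0 ∨ nc v ≠ 0)
    (hold : ∀ v, asg v ≠ 0 → asg' v ≠ 0 ∧ pos' v = pos v)
    (hnew : ∀ x, nc x = 1 → used x = 0 → used (ng x) = 0 → used (ng (ng x)) = 0 →
      (asg' x ≠ 0 ∧ asg' (ng x) ≠ 0 ∧ asg' (ng (ng x)) ≠ 0) ∧
      ∃ k, pos' x = 3 * k ∧ pos' (ng x) = 3 * k + 1 ∧ pos' (ng (ng x)) = 3 * k + 2) :
    Layout H p q used' asg' pos' := by
  obtain ⟨hau, m, col, g, hb, hu, hi⟩ := L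
  refine ⟨fun v hv => (hused v).2 ((hasg v hv).imp (hau v) id), m + 1, Function.update col m nc,
    Function.update g m ng, fun i him => ?_, fun v => ?_, fun v hv => ?_⟩
  · rcases Nat.lt_succ_iff_lt_or_eq.1 him with h | rfl
    · rw [Function.update_of_ne (by omega), Function.update_of_ne (by omega)]
      exact hb i h
    · simpa using b
  · obtain ⟨s1, s2, s3⟩ := stage_update (m := m) (col := col) (nc := nc) (v := v)
    rw [hused, hu]
    have hle := stage_le (m := m) (col := col) (v := v)
    by_cases h : stage m col v < m
    · rw [s1 h]; exact iff_of_true (Or.inl h) (by omega)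
    · by_cases hc : nc v = 0
      · rw [s3 (by omega) hc]; exact iff_of_false (by simp [h, hc]) (by omega)
      · rw [s2 (by omega) hc]; exact iff_of_true (Or.inr hc) (by omega)
  · obtain ⟨v1, v2, v3⟩ := hv
    have hst : ∀ w, stage (m + 1) (Function.update col m nc) w = stage m col w ∧ stage m col w < m ∨
        stage (m + 1) (Function.update col m nc) w = m ∧ stage m col w = m ∧ nc w ≠ 0 ∨
        stage (m + 1) (Function.update col m nc) w = m + 1 := fun w => by
      obtain ⟨s1, s2, s3⟩ := stage_update (m := m) (col := col) (nc := nc) (v := w)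
      have hle := stage_le (m := m) (col := col) (v := w)
      by_cases h : stage m col w < m
      · exact Or.inl ⟨s1 h, h⟩
      · by_cases hc : nc w = 0
        · exact Or.inr (Or.inr (s3 (by omega) hc))
        · exact Or.inr (Or.inl ⟨s2 (by omega) hc, by omega, hc⟩)
    rcases hst v with ⟨h, h'⟩ | ⟨h, h', hc⟩ | h
    · rw [h] at v2 v3 ⊢
      rw [Function.update_of_ne (by omega)] at v2 v3 ⊢
      rw [Function.update_of_ne (by omega)]
      have hint : Intact m col g v := by
        refine ⟨h', ?_, ?_⟩
        · rcases hst (g (stage m col v) v) with ⟨k, _⟩ | ⟨k, _⟩ | k <;> omega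
        · rcases hst (g (stage m col v) (g (stage m col v) v)) with ⟨k, _⟩ | ⟨k, _⟩ | k <;> omega
      obtain ⟨i1, i2, i3, i4⟩ := hi v hint
      refine ⟨(hold _ i1).1, (hold _ i2).1, ?_, ?_⟩
      · rw [(hold _ i1).2, i3]
      · rw [(hold _ i1).2, (hold _ i2).2, i4]
    · rw [h] at v2 v3 ⊢
      simp only [Function.update_self] at v2 v3 ⊢
      have hun : ∀ w, stage (m + 1) (Function.update col m nc) w = m → used w = 0 := fun w hw => by
        by_contra hne
        have := (hu w).1 hne
        rcases hst w with ⟨k, _⟩ | ⟨k, _⟩ | k <;> omega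
      have u1 := hun _ h
      have u2 := hun _ v2
      have u3 := hun _ v3
      have hcyc := b.cyc v hc
      have hcyc' : ng (ng (ng (ng v))) = ng v := congrArg ng hcyc
      have n1 := b.col_next v hc
      have hc1 := b.col_g_ne hc
      have n2 := b.col_next _ hc1
      have hle := b.col_le hc
      have h123 : nc v = 1 ∨ nc v = 2 ∨ nc v = 3 := by omega
      rcases h123 with h1 | h1 | h1
      · obtain ⟨⟨a1, a2, a3⟩, k, p1, p2, p3⟩ := hnew v h1 u1 u2 u3
        exact ⟨a1, a2, by omega, by omega⟩
      · obtain ⟨⟨a1, a2, a3⟩, k, p1, p2, p3⟩ := hnew (ng (ng v)) (by rw [n2, n1, h1]) u3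
          (by rwa [hcyc]) (by rwa [hcyc])
        rw [hcyc] at a2 a3 p2 p3
        exact ⟨a2, a3, by omega, by omega⟩
      · obtain ⟨⟨a1, a2, a3⟩, k, p1, p2, p3⟩ := hnew (ng v) (by rw [n1, h1]) u2 u3 (by rwa [hcyc])
        rw [hcyc] at a3 p3
        exact ⟨a3, a1, by omega, by omega⟩
    · omega

end Layout

namespace Imp

open Finset Classical

variable {N p q : ℕ} {H : SimpleGraph (Fin N)} {B : ℕ}

/-- The variable `8` counts the vertices that have been placed; the arrays `8, 9, 10` hold the vertex
at a position, the position of a vertex, and whether it has been placed. -/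
structure Placed (N : ℕ) (s : Store) : Prop where
  pos_lt : ∀ v : Fin N, s.arr 10 v ≠ 0 → s.arr 9 v < s.var 8
  inv : ∀ v : Fin N, s.arr 10 v ≠ 0 → s.arr 8 (s.arr 9 v) = v
  place : ∀ i < s.var 8, ∃ v : Fin N, s.arr 10 v ≠ 0 ∧ s.arr 9 v = i

theorem Placed.congr {s s' : Store} (h : Placed N s) (h8 : s'.var 8 = s.var 8)
    (ha : s'.arr 8 = s.arr 8) (hb : s'.arr 9 = s.arr 9) (hc : s'.arr 10 = s.arr 10) : Placed N s' := by
  obtain ⟨h1, h2, h3⟩ := h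
  constructor <;> simpa [h8, ha, hb, hc]

theorem Placed.card {s : Store} (h : Placed N s) :
    s.var 8 = #{v : Fin N | s.arr 10 v ≠ 0} := by
  rw [← card_range (s.var 8)]
  symm
  refine card_bij (fun v _ => s.arr 9 v) ?_ ?_ ?_
  · intro v hv
    exact mem_range.2 (h.pos_lt v (mem_filter.1 hv).2)
  · intro v hv w hw he
    have h1 := h.inv v (mem_filter.1 hv).2
    have h2 := h.inv w (mem_filter.1 hw).2
    rw [he, h2] at h1
    exact Fin.ext h1.symm
  · intro i hi
    obtain ⟨v, hv, rfl⟩ := h.place i (mem_range.1 hi)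
    exact ⟨v, by simp [hv], rfl⟩

theorem Placed.le {s : Store} (h : Placed N s) : s.var 8 ≤ N := by
  rw [h.card]; exact (card_le_univ _).trans (by simp)

/-- Places the vertex in the variable `9`. -/
def appendCmd : Cmd :=
  .seq (.put 8 (.var 8) (.var 9)) (.seq (.put 9 (.var 9) (.var 8)) (.seq (.put 10 (.var 9) 1)
    (.set 8 (.var 8 + 1))))

theorem appendCmd_spec (hB : N + 1 ≤ B) {s : Store} (P : Placed N s) {v : Fin N} (hv : s.var 9 = v)
    (h0 : s.arr 10 v = 0) : Placed N (appendCmd.run N B s) ∧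
      (appendCmd.run N B s).var 8 = s.var 8 + 1 ∧
      (∀ w : Fin N, (appendCmd.run N B s).arr 9 w = if w = v then s.var 8 else s.arr 9 w) ∧
      ∀ w : Fin N, (appendCmd.run N B s).arr 10 w = if w = v then 1 else s.arr 10 w := by
  have hle := P.le
  have hlt := v.isLt
  rw [appendCmd, run_seq, run_put _ _ _ _ _ _ (x := s.var 8) (y := v) (by simp) (by simp [hv]) (by omega),
    run_seq, run_put _ _ _ 9 _ _ (x := v) (y := s.var 8) (by simp [hv]) (by simp) (by omega),
    run_seq, run_put _ _ _ _ _ _ (x := v) (y := 1) (by simp [hv]) (by simp) (by omega),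
    run_set _ _ _ _ _ (x := s.var 8 + 1) (by simp) (by omega)]
  set s' := (((s.setArr 8 (s.var 8) v).setArr 9 v (s.var 8)).setArr 10 v 1).setVar 8 (s.var 8 + 1) with hs'
  have e8 : s'.var 8 = s.var 8 + 1 := by simp [hs']
  have e9 : ∀ w : Fin N, s'.arr 9 w = if w = v then s.var 8 else s.arr 9 w := fun w => by
    simp [hs', Fin.ext_iff]
  have e10 : ∀ w : Fin N, s'.arr 10 w = if w = v then 1 else s.arr 10 w := fun w => by
    simp [hs', Fin.ext_iff]
  have ei : ∀ i, s'.arr 8 i = if i = s.var 8 then (v : ℕ) else s.arr 8 i := fun i => by simp [hs']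
  refine ⟨⟨fun w hw => ?_, fun w hw => ?_, fun i hi => ?_⟩, e8, e9, e10⟩
  · rw [e8, e9]
    by_cases h : w = v
    · simp [h]
    · rw [e10, if_neg h] at hw
      have := P.pos_lt w hw
      rw [if_neg h]; omega
  · rw [ei, e9]
    by_cases h : w = v
    · simp [h]
    · rw [e10, if_neg h] at hw
      rw [if_neg h, if_neg (P.pos_lt w hw).ne, P.inv w hw]
  · rw [e8] at hi
    rcases Nat.lt_succ_iff_lt_or_eq.1 hi with h | rfl
    · obtain ⟨w, hw, hp⟩ := P.place i h
      have hne : w ≠ v := fun h' => hw (h' ▸ h0)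
      exact ⟨w, by rwa [e10, if_neg hne], by rwa [e9, if_neg hne]⟩
    · exact ⟨v, by simp [e10], by simp [e9]⟩

/-- Places the vertex in the variable `3` and its two successors. -/
def appendTripleCmd : Cmd :=
  .seq (.set 9 (.var 3)) (.seq appendCmd (.seq (.set 9 (.arr 4 (.var 9) - 1)) (.seq appendCmd
    (.seq (.set 9 (.arr 4 (.var 9) - 1)) appendCmd))))

theorem appendTripleCmd_spec (hB : N + 1 ≤ B) {s : Store} (P : Placed N s) {x y z : Fin N}
    (hx : s.var 3 = x) (hy : s.arr 4 x = y + 1) (hz : s.arr 4 y = z + 1) (hxy : x ≠ y) (hyz : y ≠ z)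
    (hxz : x ≠ z) (h0 : s.arr 10 x = 0) (h1 : s.arr 10 y = 0) (h2 : s.arr 10 z = 0) :
    Placed N (appendTripleCmd.run N B s) ∧ (appendTripleCmd.run N B s).var 8 = s.var 8 + 3 ∧
      ((appendTripleCmd.run N B s).arr 9 x = s.var 8 ∧
        (appendTripleCmd.run N B s).arr 9 y = s.var 8 + 1 ∧
        (appendTripleCmd.run N B s).arr 9 z = s.var 8 + 2) ∧
      (∀ w : Fin N, w ≠ x → w ≠ y → w ≠ z →
        (appendTripleCmd.run N B s).arr 9 w = s.arr 9 w) ∧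
      ∀ w : Fin N, (appendTripleCmd.run N B s).arr 10 w =
        if w = x ∨ w = y ∨ w = z then 1 else s.arr 10 w := by
  have hxl := x.isLt
  have hyl := y.isLt
  have hzl := z.isLt
  have hv9 : ∀ s : Store, (appendCmd.run N B s).var 9 = s.var 9 := fun s => appendCmd.var_run _ (by rfl)
  have ha4 : ∀ s : Store, (appendCmd.run N B s).arr 4 = s.arr 4 := fun s => appendCmd.arr_run _ (by rfl)
  rw [appendTripleCmd, run_seq, run_set _ _ _ _ _ (x := x) (by simp [hx]) (by omega), run_seq]
  set s1 := s.setVar 9 x with hs1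
  obtain ⟨P1, c1, p1, a1⟩ := appendCmd_spec hB (s := s1)
    (P.congr (by simp [hs1]) rfl rfl rfl) (v := x) (by simp [hs1]) (by simpa [hs1] using h0)
  rw [run_seq, run_set _ _ _ 9 _ (x := y) (by simp [hv9, ha4, hs1, hy]) (by omega), run_seq]
  set s2 := (appendCmd.run N B s1).setVar 9 y with hs2
  obtain ⟨P2, c2, p2, a2⟩ := appendCmd_spec hB (s := s2)
    (P1.congr (by simp [hs2]) rfl rfl rfl) (v := y) (by simp [hs2])
    (by simp only [hs2, setVar_arr, a1, if_neg hxy.symm]; simpa [hs1] using h1)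
  rw [run_seq, run_set _ _ _ 9 _ (x := z) (by simp [hv9, ha4, hs1, hs2, hz]) (by omega)]
  set s3 := (appendCmd.run N B s2).setVar 9 z with hs3
  obtain ⟨P3, c3, p3, a3⟩ := appendCmd_spec hB (s := s3)
    (P2.congr (by simp [hs3]) rfl rfl rfl) (v := z) (by simp [hs3])
    (by rw [hs3, setVar_arr, a2, if_neg hyz.symm, hs2, setVar_arr, a1, if_neg hxz.symm]; exact h2)
  have v1 : s1.var 8 = s.var 8 := by simp [hs1]
  have v2 : s2.var 8 = s.var 8 + 1 := by simp [hs2, c1, v1]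
  have v3 : s3.var 8 = s.var 8 + 2 := by simp [hs3, c2, v2]
  have q1 : s1.arr = s.arr := rfl
  have q2 : s2.arr = (appendCmd.run N B s1).arr := rfl
  have q3 : s3.arr = (appendCmd.run N B s2).arr := rfl
  refine ⟨P3, by rw [c3, v3], ⟨?_, ?_, ?_⟩, fun w w1 w2 w3 => ?_, fun w => ?_⟩
  · rw [p3, if_neg hxz, q3, p2, if_neg hxy, q2, p1, if_pos rfl, v1]
  · rw [p3, if_neg hyz, q3, p2, if_pos rfl, v2]
  · rw [p3, if_pos rfl, v3]
  · rw [p3, if_neg w3, q3, p2, if_neg w2, q2, p1, if_neg w1, q1]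
  · rw [a3, q3, a2, q2, a1, q1]
    split_ifs <;> simp_all

end Imp

/-! ### Treating the components -/

namespace Imp

open Finset Classical

variable {N p q : ℕ} {H : SimpleGraph (Fin N)} {B : ℕ}

/-- Places the triples of a block that avoid the earlier blocks. -/
def placeCmd : Cmd :=
  .loop 3 1 (.ite (Exp.eq (.arr 3 (.var 3)) 1 * (Exp.arr 7 (.var 3)).not *
    (Exp.arr 7 (.arr 4 (.var 3) - 1)).not * (Exp.arr 7 (.arr 4 (.arr 4 (.var 3) - 1) - 1)).not)
    appendTripleCmd .skip)

/-- Adds the block that is given by the colours in the array `3` and the permutation in the array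
`4`. The vertices of the earlier blocks are marked in the array `7`. -/
def commitCmd : Cmd :=
  .seq placeCmd (.loop 4 1 (.ite (.arr 3 (.var 4)) (.put 7 (.var 4) 1) .skip))

/-- `Layout` for the contents of the arrays. -/
def Lay (H : SimpleGraph (Fin N)) (p q : ℕ) (s : Store) : Prop :=
  Layout H p q (fun v => s.arr 7 v) (fun v => s.arr 10 v) fun v => s.arr 9 v

theorem orbit_eq {V : Type*} {H : SimpleGraph V} [Fintype V] {col : V → ℕ} {g : V → V}
    (b : Block H p q col g) {x x' v : V} (hx : col x = 1) (hx' : col x' = 1)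
    (hv : v = x ∨ v = g x ∨ v = g (g x)) (hv' : v = x' ∨ v = g x' ∨ v = g (g x')) : x = x' := by
  have key : ∀ y, col y = 1 → col (g y) = 2 ∧ col (g (g y)) = 3 ∧ g (g (g y)) = y := fun y hy => by
    have h1 := b.col_next y (by omega)
    have h2 := b.col_next (g y) (by omega)
    exact ⟨by omega, by omega, b.cyc y (by omega)⟩
  obtain ⟨a1, a2, a3⟩ := key x hx
  obtain ⟨b1, b2, b3⟩ := key x' hx'
  rcases hv with rfl | rfl | rfl <;> rcases hv' with h | h | h <;> have h' := congrArg col h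
  · exact h
  · omega
  · omega
  · omega
  · rw [← a3, h, b3]
  · omega
  · omega
  · omega
  · rw [← a3, h, b3]

theorem placeCmd_spec (hB : N + 1 ≤ B) {s : Store} (P : Placed N s) (h3 : 3 ∣ s.var 8)
    {g : Fin N → Fin N} (b : Block H p q (fun v => s.arr 3 v) g)
    (hg : ∀ v : Fin N, s.arr 3 v ≠ 0 → s.arr 4 v = g v + 1)
    (hu : ∀ v : Fin N, s.arr 10 v ≠ 0 → s.arr 7 v ≠ 0) :
    Placed N (placeCmd.run N B s) ∧ 3 ∣ (placeCmd.run N B s).var 8 ∧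
      (∀ v : Fin N, (placeCmd.run N B s).arr 10 v ≠ 0 → s.arr 10 v ≠ 0 ∨ s.arr 3 v ≠ 0) ∧
      (∀ v : Fin N, s.arr 10 v ≠ 0 → (placeCmd.run N B s).arr 10 v ≠ 0 ∧
        (placeCmd.run N B s).arr 9 v = s.arr 9 v) ∧
      ∀ x : Fin N, s.arr 3 x = 1 → s.arr 7 x = 0 → s.arr 7 (g x) = 0 → s.arr 7 (g (g x)) = 0 →
        ((placeCmd.run N B s).arr 10 x ≠ 0 ∧ (placeCmd.run N B s).arr 10 (g x) ≠ 0 ∧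
          (placeCmd.run N B s).arr 10 (g (g x)) ≠ 0) ∧
        ∃ k, (placeCmd.run N B s).arr 9 x = 3 * k ∧ (placeCmd.run N B s).arr 9 (g x) = 3 * k + 1 ∧
          (placeCmd.run N B s).arr 9 (g (g x)) = 3 * k + 2 := by
  have hcol : ∀ x : Fin N, s.arr 3 x = 1 → s.arr 3 (g x) = 2 ∧ s.arr 3 (g (g x)) = 3 := fun x hx => by
    have h1 := b.col_next x (by simp [hx])
    have h2 := b.col_next (g x) (by rw [h1]; omega)
    omega
  have hnx : ∀ x : Fin N, s.arr 3 x = 1 → s.arr 4 x = g x + 1 ∧ s.arr 4 (g x) = g (g x) + 1 := fun x hx =>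
    ⟨hg _ (by omega), hg _ (by rw [(hcol x hx).1]; omega)⟩
  have key := run_loop_inv (N := N) (B := B) (v := 3) (d := 1) (s := s)
    (c := .ite (Exp.eq (.arr 3 (.var 3)) 1 * (Exp.arr 7 (.var 3)).not *
    (Exp.arr 7 (.arr 4 (.var 3) - 1)).not * (Exp.arr 7 (.arr 4 (.arr 4 (.var 3) - 1) - 1)).not)
    appendTripleCmd .skip)
    (fun i s' => (s'.arr 3 = s.arr 3 ∧ s'.arr 4 = s.arr 4 ∧ s'.arr 7 = s.arr 7) ∧
      Placed N s' ∧ 3 ∣ s'.var 8 ∧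
      (∀ v : Fin N, s'.arr 10 v ≠ 0 → s.arr 10 v ≠ 0 ∨
        ∃ x : Fin N, (x : ℕ) < i ∧ s.arr 3 x = 1 ∧ (v = x ∨ v = g x ∨ v = g (g x))) ∧
      (∀ v : Fin N, s.arr 10 v ≠ 0 → s'.arr 10 v ≠ 0 ∧ s'.arr 9 v = s.arr 9 v) ∧
      ∀ x : Fin N, (x : ℕ) < i → s.arr 3 x = 1 → s.arr 7 x = 0 → s.arr 7 (g x) = 0 →
        s.arr 7 (g (g x)) = 0 →
        (s'.arr 10 x ≠ 0 ∧ s'.arr 10 (g x) ≠ 0 ∧ s'.arr 10 (g (g x)) ≠ 0) ∧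
        ∃ k, s'.arr 9 x = 3 * k ∧ s'.arr 9 (g x) = 3 * k + 1 ∧ s'.arr 9 (g (g x)) = 3 * k + 2)
    ⟨⟨rfl, rfl, rfl⟩, P, h3, fun v hv => Or.inl hv, fun v hv => ⟨hv, rfl⟩, by simp⟩ ?_
  · obtain ⟨-, k1, k2, k3, k4, k5⟩ := key
    refine ⟨k1, k2, fun v hv => ?_, k4, fun x => k5 x (by simp)⟩
    rcases k3 v hv with h | ⟨x, -, hx, hv'⟩
    · exact Or.inl h
    · obtain ⟨c1, c2⟩ := hcol x hx
      rcases hv' with rfl | rfl | rfl <;> right <;> omega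
  rintro i hi s' ⟨⟨e3, e4, e7⟩, k1, k2, k3, k4, k5⟩
  rw [pow_one] at hi
  set x : Fin N := ⟨i, hi⟩ with hxdef
  have hP0 : Placed N (s'.setVar 3 i) := k1.congr (by simp) rfl rfl rfl
  by_cases hcond : s.arr 3 x = 1 ∧ s.arr 7 x = 0 ∧ s.arr 7 (g x) = 0 ∧ s.arr 7 (g (g x)) = 0
  · obtain ⟨hx, hu0, hu1, hu2⟩ := hcond
    obtain ⟨n1, n2⟩ := hnx x hx
    obtain ⟨c1, c2⟩ := hcol x hx
    have hfresh : ∀ v : Fin N, v = x ∨ v = g x ∨ v = g (g x) → s'.arr 10 v = 0 := fun v hv => by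
      by_contra hne
      rcases k3 v hne with h | ⟨x', hx'i, hx', hv'⟩
      · have := hu v h
        rcases hv with rfl | rfl | rfl <;> contradiction
      · have := orbit_eq b hx hx' hv hv'
        rw [← this] at hx'i
        exact lt_irrefl _ hx'i
    have i1 : s.arr 3 i = 1 := hx
    have i2 : s.arr 4 i = g x + 1 := n1
    have i3 : s.arr 7 i = 0 := hu0
    rw [run_ite_pos _ _ _ _ _ (by simp [e3, e4, e7, i1, i2, i3, n2, hu1, hu2])]
    have hxy : x ≠ g x := fun h => by rw [← h] at c1; omega
    have hyz : g x ≠ g (g x) := fun h => by rw [← h] at c2; omega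
    have hxz : x ≠ g (g x) := fun h => by rw [← h] at c2; omega
    obtain ⟨P', v8, ⟨p0, p1, p2⟩, po, pa⟩ := appendTripleCmd_spec hB hP0 (x := x) (y := g x) (z := g (g x))
      (by simp [hxdef]) (by simp [e4, n1]) (by simp [e4, n2]) hxy hyz hxz
      (hfresh _ (by simp)) (hfresh _ (by simp)) (hfresh _ (by simp))
    have hother : ∀ v : Fin N, s'.arr 10 v ≠ 0 →
        (appendTripleCmd.run N B (s'.setVar 3 i)).arr 10 v ≠ 0 ∧
        (appendTripleCmd.run N B (s'.setVar 3 i)).arr 9 v = s'.arr 9 v := fun v hv => by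
      have hn : ¬ (v = x ∨ v = g x ∨ v = g (g x)) := fun h => hv (hfresh v h)
      rw [pa, if_neg hn]
      rw [not_or, not_or] at hn
      exact ⟨hv, po v hn.1 hn.2.1 hn.2.2⟩
    refine ⟨⟨?_, ?_, ?_⟩, P', ?_, fun v hv => ?_, fun v hv => ?_, fun x' hx' hc' u0 u1 u2 => ?_⟩
    · rw [appendTripleCmd.arr_run _ (by rfl)]; exact e3
    · rw [appendTripleCmd.arr_run _ (by rfl)]; exact e4
    · rw [appendTripleCmd.arr_run _ (by rfl)]; exact e7
    · rw [v8]; simpa using k2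
    · rw [pa] at hv
      by_cases hn : v = x ∨ v = g x ∨ v = g (g x)
      · exact Or.inr ⟨x, by simp [hxdef], hx, hn⟩
      · rw [if_neg hn] at hv
        exact (k3 v hv).imp id fun ⟨x', h1, h2⟩ => ⟨x', by omega, h2⟩
    · obtain ⟨h1, h2⟩ := k4 v hv
      obtain ⟨h3, h4⟩ := hother v h1
      exact ⟨h3, h4.trans h2⟩
    · rcases Nat.lt_succ_iff_lt_or_eq.1 hx' with hlt | heq
      · obtain ⟨⟨a0, a1, a2⟩, k, h0, h1, h2⟩ := k5 x' hlt hc' u0 u1 u2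
        refine ⟨⟨(hother _ a0).1, (hother _ a1).1, (hother _ a2).1⟩, k, ?_, ?_, ?_⟩
        · rw [(hother _ a0).2, h0]
        · rw [(hother _ a1).2, h1]
        · rw [(hother _ a2).2, h2]
      · obtain rfl : x' = x := Fin.ext heq
        obtain ⟨k, hk⟩ := k2
        have hk' : (s'.setVar 3 i).var 8 = 3 * k := by simpa using hk
        refine ⟨⟨?_, ?_, ?_⟩, k, ?_, ?_, ?_⟩
        · rw [pa]; simp
        · rw [pa]; simp
        · rw [pa]; simp
        · rw [p0, hk']
        · rw [p1, hk']
        · rw [p2, hk']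
  · rw [run_ite_neg, Cmd.run]
    · refine ⟨⟨e3, e4, e7⟩, hP0, by simpa using k2, fun v hv => ?_, k4, fun x' hx' hc' u0 u1 u2 => ?_⟩
      · exact (k3 v hv).imp id fun ⟨x', h1, h2⟩ => ⟨x', by omega, h2⟩
      · rcases Nat.lt_succ_iff_lt_or_eq.1 hx' with hlt | heq
        · exact k5 x' hlt hc' u0 u1 u2
        · obtain rfl : x' = x := Fin.ext heq
          exact absurd ⟨hc', u0, u1, u2⟩ hcond
    · by_cases hx : s.arr 3 x = 1
      · obtain ⟨n1, n2⟩ := hnx x hx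
        have i2 : s.arr 4 i = g x + 1 := n1
        have i1 : s.arr 3 i = 1 := hx
        by_contra hne
        refine hcond ⟨hx, ?_⟩
        have h := hne
        simp [e3, e4, e7, i1, i2, n2] at h
        exact ⟨h.1.1, h.1.2, h.2⟩
      · have i1 : ¬ s.arr 3 i = 1 := hx
        simp [e3, i1]

theorem commitCmd_spec (hB : N + 1 ≤ B) {s : Store} (P : Placed N s) (h3 : 3 ∣ s.var 8)
    {g : Fin N → Fin N} (b : Block H p q (fun v => s.arr 3 v) g)
    (hg : ∀ v : Fin N, s.arr 3 v ≠ 0 → s.arr 4 v = g v + 1) (L : Lay H p q s) :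
    Placed N (commitCmd.run N B s) ∧ 3 ∣ (commitCmd.run N B s).var 8 ∧
      Lay H p q (commitCmd.run N B s) ∧
      ∀ v : Fin N, (commitCmd.run N B s).arr 7 v ≠ 0 ↔ s.arr 7 v ≠ 0 ∨ s.arr 3 v ≠ 0 := by
  obtain ⟨k1, k2, k3, k4, k5⟩ := placeCmd_spec hB P h3 b hg L.1
  rw [commitCmd, run_seq]
  set s1 := placeCmd.run N B s with hs1
  have e3 : s1.arr 3 = s.arr 3 := placeCmd.arr_run _ (by rfl)
  have e7 : s1.arr 7 = s.arr 7 := placeCmd.arr_run _ (by rfl)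
  have key := run_fill (N := N) (B := B) (d := 1) (v := 4) (a := 7) (e := .arr 3 (.var 4)) (e' := 1)
    (s := s1) (P := fun i => s.arr 3 i ≠ 0) (x := 1) (by omega) fun i hi s' hs' hv => by
      simp [hs'.arr 3 (by decide), hv, e3]
  obtain ⟨f1, f2⟩ := key
  set s2 := (Cmd.loop 4 1 (.ite (.arr 3 (.var 4)) (.put 7 (.var 4) 1) .skip)).run N B s1 with hs2
  change EqArr 4 7 s1 s2 at f1
  have f2' : ∀ v : Fin N, s2.arr 7 v = if s.arr 3 v ≠ 0 then 1 else s1.arr 7 v := fun v =>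
    (f2 v (by simp)).trans (by congr)
  have hused : ∀ v : Fin N, s2.arr 7 v ≠ 0 ↔ s.arr 7 v ≠ 0 ∨ s.arr 3 v ≠ 0 := fun v => by
    rw [f2', e7]; split_ifs <;> simp_all
  have a9 : s2.arr 9 = s1.arr 9 := f1.arr 9 (by decide)
  have a10 : s2.arr 10 = s1.arr 10 := f1.arr 10 (by decide)
  refine ⟨k1.congr (f1.var 8 (by decide)) (f1.arr 8 (by decide)) a9 a10, by rwa [f1.var 8 (by decide)], ?_,
    hused⟩
  unfold Lay
  rw [a9, a10]
  exact Layout.extend L b hused k3 k4 k5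

/-- Treats all components. -/
def componentsCmd : Cmd := .loop 2 3 (.seq classCmd (.ite (.var 7) commitCmd .skip))

theorem componentsCmd_spec {β : Type*} [Fintype β] {G : SimpleGraph β} {e : Fin N ≃ Fin 3 × β}
    (hN : Near H G e p q) (hB : N * N ≤ B) (hB3 : N + 3 ≤ B) {s : Store} (h : Ctx H p q s)
    (I : Lab H p q (N ^ 3) s) (hall : ∀ t, IsNode H p q t → s.arr 2 (code t) ≠ 0)
    (h8 : s.var 8 = 0) (h7 : ∀ i, s.arr 7 i = 0) (h10 : ∀ i, s.arr 10 i = 0) :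
    Placed N (componentsCmd.run N B s) ∧ 3 ∣ (componentsCmd.run N B s).var 8 ∧
      Lay H p q (componentsCmd.run N B s) ∧
      (540 * p < q → ∀ v : Fin N, (∃ w, H.Adj v w) → (componentsCmd.run N B s).arr 7 v ≠ 0) := by
  have hlab : ∀ t, IsNode H p q t → s.arr 1 (code t) ≠ 0 := fun t ht => I.reached t (hall t ht)
  have key := run_loop_inv (N := N) (B := B) (v := 2) (d := 3) (s := s)
    (c := .seq classCmd (.ite (.var 7) commitCmd .skip))
    (fun c s' => Ctx H p q s' ∧ s'.arr 1 = s.arr 1 ∧ Placed N s' ∧ 3 ∣ s'.var 8 ∧ Lay H p q s' ∧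
      (540 * p < q → ∀ v : Fin N, (∃ w, H.Adj v w) →
        s.arr 1 (code (trueTriple e (e v).2)) ≤ c → s'.arr 7 v ≠ 0))
    ⟨h, rfl, ⟨by simp [h10], by simp [h10], by simp [h8]⟩, by simp [h8],
      ⟨by simp [h10], 0, fun _ _ => 0, fun _ v => v, by simp, by simp [h7],
        fun v hv => absurd hv.1 (by simp)⟩,
      fun hpq v _ hle => absurd (Nat.le_zero.1 hle) (hlab _ (hN.isNode_trueTriple hpq _))⟩ ?_
  · obtain ⟨-, -, k1, k2, k3, k4⟩ := key
    exact ⟨k1, k2, k3, fun hpq v hv => k4 hpq v hv (I.le _)⟩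
  rintro c hc s' ⟨hC, e1, P, hd, L, hcov⟩
  rw [run_seq]
  set s1 := s'.setVar 2 c with hs1
  have hC1 : Ctx H p q s1 := hC.setVar (by decide)
  set s2 := classCmd.run N B s1 with hs2
  have hC2 : Ctx H p q s2 := hC1.run (by rfl)
  have v8 : s2.var 8 = s'.var 8 := by rw [hs2, classCmd.var_run _ (by rfl)]; simp [hs1]
  have b1 : s2.arr 1 = s'.arr 1 := by rw [hs2, classCmd.arr_run _ (by rfl)]; simp [hs1]
  have b7 : s2.arr 7 = s'.arr 7 := by rw [hs2, classCmd.arr_run _ (by rfl)]; simp [hs1]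
  have b8 : s2.arr 8 = s'.arr 8 := by rw [hs2, classCmd.arr_run _ (by rfl)]; simp [hs1]
  have b9 : s2.arr 9 = s'.arr 9 := by rw [hs2, classCmd.arr_run _ (by rfl)]; simp [hs1]
  have b10 : s2.arr 10 = s'.arr 10 := by rw [hs2, classCmd.arr_run _ (by rfl)]; simp [hs1]
  have P2 : Placed N s2 := P.congr v8 b8 b9 b10
  have L2 : Lay H p q s2 := by unfold Lay; rw [b7, b9, b10]; exact L
  -- a vertex of the component that is treated in this round gets covered
  have hpass : 540 * p < q → ∀ v : Fin N, (∃ w, H.Adj v w) →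
      s.arr 1 (code (trueTriple e (e v).2)) = c + 1 → s2.var 7 ≠ 0 ∧ s2.arr 3 v ≠ 0 := by
    intro hpq v hv hl
    have e12 : s1.var 2 = c := by simp [hs1]
    have e11 : s1.arr 1 = s.arr 1 := e1
    refine classCmd_passes hN hpq hB (by omega) hC1 ?_ ?_ ?_ hv (by rw [e11, e12, hl])
    · intro t ht t' hn hl
      simp only [Set.mem_ofPred_eq, e11, e12] at ht ⊢
      rw [← ht]
      exact I.closed t t' (hall t (I.isNode t (by omega))) hn hl
    · intro t ht
      rw [e11] at ht
      exact I.isNode t (by omega)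
    · intro t t' ht ht' C hC' hm
      rw [e11] at ht ht'
      exact I.conn t t' (by omega) (by omega) C hC' hm
  by_cases h7' : s2.var 7 = 0
  · rw [run_ite_neg _ _ _ _ _ (by simpa using h7'), Cmd.run]
    refine ⟨hC2, b1.trans e1, P2, by rwa [v8], L2, fun hpq v hv hle => ?_⟩
    rcases Nat.le_succ_iff.1 hle with hle | heq
    · rw [b7]; exact hcov hpq v hv hle
    · exact absurd h7' (hpass hpq v hv heq).1
  · rw [run_ite_pos _ _ _ _ _ (by simpa using h7')]
    obtain ⟨bl, hg⟩ := classCmd_sound hB (by omega) hC1 h7'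
    obtain ⟨m1, m2, m3, m4⟩ := commitCmd_spec (B := B) (by omega) P2 (by rwa [v8]) bl hg L2
    refine ⟨hC2.run (by rfl), ?_, m1, m2, m3, fun hpq v hv hle => (m4 v).2 ?_⟩
    · rw [commitCmd.arr_run _ (by rfl), b1, e1]
    · rcases Nat.le_succ_iff.1 hle with hle | heq
      · rw [b7]; exact Or.inl (hcov hpq v hv hle)
      · exact Or.inr (hpass hpq v hv heq).2

end Imp

/-! ### The output -/

namespace Imp

open Finset Classical

variable {N p q : ℕ} {H : SimpleGraph (Fin N)} {B : ℕ}

/-- Places the vertices that have not been placed. -/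
def leftoverCmd : Cmd :=
  .loop 3 1 (.ite (.arr 10 (.var 3)) .skip (.seq (.set 9 (.var 3)) appendCmd))

theorem leftoverCmd_spec (hB : N + 1 ≤ B) {s : Store} (P : Placed N s) :
    Placed N (leftoverCmd.run N B s) ∧ (∀ v : Fin N, (leftoverCmd.run N B s).arr 10 v ≠ 0) ∧
      ∀ v : Fin N, s.arr 10 v ≠ 0 → (leftoverCmd.run N B s).arr 9 v = s.arr 9 v := by
  have key := run_loop_inv (N := N) (B := B) (v := 3) (d := 1) (s := s)
    (c := .ite (.arr 10 (.var 3)) .skip (.seq (.set 9 (.var 3)) appendCmd))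
    (fun i s' => Placed N s' ∧ (∀ v : Fin N, (v : ℕ) < i → s'.arr 10 v ≠ 0) ∧
      ∀ v : Fin N, s.arr 10 v ≠ 0 → s'.arr 10 v ≠ 0 ∧ s'.arr 9 v = s.arr 9 v)
    ⟨P, by simp, fun v hv => ⟨hv, rfl⟩⟩ ?_
  · exact ⟨key.1, fun v => key.2.1 v (by simp), fun v hv => (key.2.2 v hv).2⟩
  rintro i hi s' ⟨k1, k2, k3⟩
  rw [pow_one] at hi
  by_cases h0 : s'.arr 10 i = 0
  · rw [run_ite_neg _ _ _ _ _ (by simpa using h0), run_seq, run_set _ _ _ _ _ (x := i) (by simp)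
      (by omega)]
    obtain ⟨a1, -, a3, a4⟩ := appendCmd_spec hB (s := (s'.setVar 3 i).setVar 9 i)
      (k1.congr (by simp) rfl rfl rfl) (v := ⟨i, hi⟩) (by simp) h0
    refine ⟨a1, fun v hv => ?_, fun v hv => ?_⟩
    · rw [a4]
      split
      · omega
      · next hne =>
        refine k2 v ?_
        have : (v : ℕ) ≠ i := fun h => hne (Fin.ext h)
        omega
    · obtain ⟨h1, h2⟩ := k3 v hv
      have hne : v ≠ ⟨i, hi⟩ := fun h => h1 (by rw [h]; exact h0)
      rw [a3, a4, if_neg hne, if_neg hne]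
      exact ⟨h1, h2⟩
  · rw [run_ite_pos _ _ _ _ _ (by simpa using h0), Cmd.run]
    refine ⟨k1.congr (by simp) rfl rfl rfl, fun v hv => ?_, k3⟩
    rcases Nat.lt_succ_iff_lt_or_eq.1 hv with hlt | heq
    · exact k2 v hlt
    · rw [heq]; exact h0

/-- The two stores agree except for the variable `v` and the cells `b, …, b + n - 1` of the
input/output area. -/
structure EqIo (v b n : ℕ) (s s' : Store) : Prop where
  var : ∀ w, w ≠ v → s'.var w = s.var w
  arr : s'.arr = s.arr
  io : ∀ i, i < b ∨ b + n ≤ i → s'.io i = s.io i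

/-- A loop that writes the values of `f` into consecutive cells. -/
theorem run_write {d v b : ℕ} {a e : Exp} {s : Store} {f : ℕ → ℕ} (hb : b + N ^ d ≤ B)
    (he : ∀ k < N ^ d, ∀ s', EqIo v b (N ^ d) s s' → s'.var v = k →
      a.eval N B s' = b + k ∧ e.eval N B s' = f k) (hf : ∀ k < N ^ d, f k ≤ B) :
    EqIo v b (N ^ d) s ((Cmd.loop v d (.out a e)).run N B s) ∧
      ∀ k < N ^ d, ((Cmd.loop v d (.out a e)).run N B s).io (b + k) = f k := by
  refine run_loop_inv (fun i s' => EqIo v b (N ^ d) s s' ∧ ∀ k < i, s'.io (b + k) = f k)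
    ⟨⟨fun _ _ => rfl, rfl, fun _ _ => rfl⟩, by simp⟩ ?_
  rintro i hi s' ⟨h1, h2⟩
  have h1' : EqIo v b (N ^ d) s (s'.setVar v i) :=
    ⟨fun w hw => by simp [hw, h1.var w hw], h1.arr, h1.io⟩
  obtain ⟨e1, e2⟩ := he i hi _ h1' (by simp)
  rw [run_out _ _ _ _ _ e1 e2 (by omega) (hf i hi)]
  refine ⟨⟨h1'.var, h1.arr, fun j hj => ?_⟩, fun k hk => ?_⟩
  · have : j ≠ b + i := by omega
    simp [this, h1.io j hj]
  · rcases Nat.lt_succ_iff_lt_or_eq.1 hk with hlt | rfl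
    · have : k ≠ i := by omega
      simp [this, h2 k hlt]
    · simp

/-- The remainder modulo 3. -/
def mod3E (a : Exp) : Exp := a - a / 3 * 3

/-- The position of a vertex. -/
def posE (a : Exp) : Exp := .arr 9 a

/-- Writes the first coordinates. -/
def outFstCmd : Cmd := .loop 3 1 (.out (.n * .n + .var 3) (mod3E (posE (.var 3))))

/-- Writes the second coordinates. -/
def outSndCmd : Cmd := .loop 3 1 (.out (.n * .n + .n + .var 3) (posE (.var 3) / 3))

/-- The number of triples. -/
def triplesE : Exp := .n / 3

/-- Adjacency of the vertices at two positions. -/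
def adjPosE (a b : Exp) : Exp := adjE (.arr 8 a) (.arr 8 b)

/-- Adjacency of two triples. -/
def adjTripleE (i j : Exp) : Exp :=
  (Exp.eq i j).not * (adjPosE (3 * i) (3 * j + 1) * adjPosE (3 * i) (3 * j + 2) *
    adjPosE (3 * i + 1) (3 * j) * adjPosE (3 * i + 1) (3 * j + 2) * adjPosE (3 * i + 2) (3 * j) *
    adjPosE (3 * i + 2) (3 * j + 1))

/-- Writes the adjacency matrix of the graph on the triples. -/
def outTriplesCmd : Cmd :=
  .loop 3 2 (.out (.n * .n + 2 * .n + .var 3) ((Exp.lt (.var 3) (triplesE * triplesE) *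
    adjTripleE (.var 3 / triplesE) (.var 3 - .var 3 / triplesE * triplesE)).not.not))

/-- Writes the adjacency matrix of the new graph. -/
def outGraphCmd : Cmd :=
  .loop 3 2 (.out (.var 3) (((Exp.eq (mod3E (posE (.var 3 / .n)))
    (mod3E (posE (.var 3 - .var 3 / .n * .n)))).not *
      Exp.io (.n * .n + 2 * .n + (posE (.var 3 / .n) / 3 * triplesE +
        posE (.var 3 - .var 3 / .n * .n) / 3))).not.not))

/-- Writes the output. -/
def outputCmd : Cmd := .seq outFstCmd (.seq outSndCmd (.seq outTriplesCmd outGraphCmd))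

theorem eval_not_not {s : Store} {a : Exp} {P : Prop} [Decidable P] (h : a.eval N B s ≠ 0 ↔ P) :
    a.not.not.eval N B s = if P then 1 else 0 := by
  simp only [Exp.not, eval_sub, eval_lit, ← h]
  split <;> omega

/-- The vertices of the triples `i` and `j` with different remainders are adjacent. -/
def TripleAdj (H : SimpleGraph (Fin N)) (pos : Fin N → ℕ) (i j : ℕ) : Prop :=
  i ≠ j ∧ ∀ a b : Fin N, pos a / 3 = i → pos b / 3 = j → pos a % 3 ≠ pos b % 3 → H.Adj a b

theorem eval_adjTripleE (hB : N * N ≤ B) {s : Store} (hC : HasInput H p q s) (P : Placed N s)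
    (hall : ∀ v : Fin N, s.arr 10 v ≠ 0) (hN : 3 ∣ N) {i j : Exp} (hi : i.eval N B s < N / 3)
    (hj : j.eval N B s < N / 3) : (adjTripleE i j).eval N B s ≠ 0 ↔
      TripleAdj H (fun v => s.arr 9 v) (i.eval N B s) (j.eval N B s) := by
  obtain ⟨n, rfl⟩ := hN
  rw [Nat.mul_div_cancel_left _ (by omega)] at hi hj
  have h8 : s.var 8 = 3 * n := by
    rw [P.card]
    simp [hall]
  have hplace : ∀ k < 3 * n, ∃ v : Fin (3 * n), s.arr 9 v = k ∧ s.arr 8 k = v := fun k hk => by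
    obtain ⟨v, hv, he⟩ := P.place k (by omega)
    exact ⟨v, he, by rw [← he, P.inv v hv]⟩
  have hinj : ∀ v w : Fin (3 * n), s.arr 9 v = s.arr 9 w → v = w := fun v w he => by
    have h1 := P.inv v (hall v)
    rw [he, P.inv w (hall w)] at h1
    exact Fin.ext h1.symm
  set x := i.eval (3 * n) B s with hx
  set y := j.eval (3 * n) B s with hy
  obtain ⟨u0, p0, w0⟩ := hplace (3 * x) (by omega)
  obtain ⟨u1, p1, w1⟩ := hplace (3 * x + 1) (by omega)
  obtain ⟨u2, p2, w2⟩ := hplace (3 * x + 2) (by omega)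
  obtain ⟨v0, q0, z0⟩ := hplace (3 * y) (by omega)
  obtain ⟨v1, q1, z1⟩ := hplace (3 * y + 1) (by omega)
  obtain ⟨v2, q2, z2⟩ := hplace (3 * y + 2) (by omega)
  have hev : ∀ {a b : Exp} {u v : Fin (3 * n)}, s.arr 8 (a.eval (3 * n) B s) = u →
      s.arr 8 (b.eval (3 * n) B s) = v → ((adjPosE a b).eval (3 * n) B s ≠ 0 ↔ H.Adj u v) :=
    fun ha hb => eval_adjE hB hC (by simpa using ha) (by simpa using hb)
  have a0 : s.arr 8 ((3 * i).eval (3 * n) B s) = u0 := by simpa [← hx] using w0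
  have a1 : s.arr 8 ((3 * i + 1).eval (3 * n) B s) = u1 := by simpa [← hx] using w1
  have a2 : s.arr 8 ((3 * i + 2).eval (3 * n) B s) = u2 := by simpa [← hx] using w2
  have b0 : s.arr 8 ((3 * j).eval (3 * n) B s) = v0 := by simpa [← hy] using z0
  have b1 : s.arr 8 ((3 * j + 1).eval (3 * n) B s) = v1 := by simpa [← hy] using z1
  have b2 : s.arr 8 ((3 * j + 2).eval (3 * n) B s) = v2 := by simpa [← hy] using z2
  simp only [adjTripleE, eval_mul, mul_ne_zero_iff, hev a0 b1, hev a0 b2, hev a1 b0, hev a1 b2,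
    hev a2 b0, hev a2 b1]
  have hne : (Exp.eq i j).not.eval (3 * n) B s ≠ 0 ↔ x ≠ y := by simp [← hx, ← hy]
  rw [hne, TripleAdj]
  refine and_congr_right fun _ => ⟨?_, fun h => ?_⟩
  · rintro ⟨⟨⟨⟨⟨h1, h2⟩, h3⟩, h4⟩, h5⟩, h6⟩ a b ha hb hab
    have ca : a = u0 ∧ s.arr 9 a % 3 = 0 ∨ a = u1 ∧ s.arr 9 a % 3 = 1 ∨ a = u2 ∧ s.arr 9 a % 3 = 2 := by
      have : s.arr 9 a = 3 * x ∨ s.arr 9 a = 3 * x + 1 ∨ s.arr 9 a = 3 * x + 2 := by omega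
      rcases this with h | h | h
      · exact Or.inl ⟨hinj _ _ (h.trans p0.symm), by omega⟩
      · exact Or.inr (Or.inl ⟨hinj _ _ (h.trans p1.symm), by omega⟩)
      · exact Or.inr (Or.inr ⟨hinj _ _ (h.trans p2.symm), by omega⟩)
    have cb : b = v0 ∧ s.arr 9 b % 3 = 0 ∨ b = v1 ∧ s.arr 9 b % 3 = 1 ∨ b = v2 ∧ s.arr 9 b % 3 = 2 := by
      have : s.arr 9 b = 3 * y ∨ s.arr 9 b = 3 * y + 1 ∨ s.arr 9 b = 3 * y + 2 := by omega
      rcases this with h | h | h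
      · exact Or.inl ⟨hinj _ _ (h.trans q0.symm), by omega⟩
      · exact Or.inr (Or.inl ⟨hinj _ _ (h.trans q1.symm), by omega⟩)
      · exact Or.inr (Or.inr ⟨hinj _ _ (h.trans q2.symm), by omega⟩)
    rcases ca with ⟨rfl, ca⟩ | ⟨rfl, ca⟩ | ⟨rfl, ca⟩ <;> rcases cb with ⟨rfl, cb⟩ | ⟨rfl, cb⟩ | ⟨rfl, cb⟩ <;>
      first | assumption | exact absurd (ca.trans cb.symm) hab
  · refine ⟨⟨⟨⟨⟨?_, ?_⟩, ?_⟩, ?_⟩, ?_⟩, ?_⟩ <;> refine h _ _ ?_ ?_ ?_ <;> omega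

theorem outputCmd_spec (hB : N * N + 2 * N + N * N ≤ B) (hB2 : N + 2 ≤ B) {s : Store}
    (hC : HasInput H p q s) (P : Placed N s) (hall : ∀ v : Fin N, s.arr 10 v ≠ 0) (hN : 3 ∣ N) :
    (∀ v : Fin N, (outputCmd.run N B s).io (N * N + v) = s.arr 9 v % 3) ∧
    (∀ v : Fin N, (outputCmd.run N B s).io (N * N + N + v) = s.arr 9 v / 3) ∧
    (∀ i < N / 3, ∀ j < N / 3, (outputCmd.run N B s).io (N * N + 2 * N + (i * (N / 3) + j)) =
      if TripleAdj H (fun v => s.arr 9 v) i j then 1 else 0) ∧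
    ∀ u v : Fin N, (outputCmd.run N B s).io (u * N + v) =
      if s.arr 9 u % 3 ≠ s.arr 9 v % 3 ∧ TripleAdj H (fun v => s.arr 9 v) (s.arr 9 u / 3) (s.arr 9 v / 3)
        then 1 else 0 := by
  have h8 : s.var 8 = N := by
    rw [P.card]; simp [hall]
  have hpos : ∀ v : Fin N, s.arr 9 v < N := fun v => h8 ▸ P.pos_lt v (hall v)
  have hsq : N ^ 2 = N * N := sq N
  have hp1 : N ^ 1 = N := pow_one N
  rw [outputCmd, run_seq, run_seq, run_seq]
  -- the first coordinates
  obtain ⟨o1, f1⟩ := run_write (N := N) (B := B) (d := 1) (v := 3) (b := N * N) (s := s)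
    (a := .n * .n + .var 3) (e := mod3E (posE (.var 3))) (f := fun k => s.arr 9 k % 3) (by omega)
    (fun k hk s' hs' hv => by
      simp only [mod3E, posE, eval_add, eval_mul, eval_sub, eval_div, eval_n, eval_var, eval_arr, eval_lit,
        hv, hs'.arr, true_and]
      omega) (fun k hk => by omega)
  change EqIo 3 (N * N) (N ^ 1) s (outFstCmd.run N B s) at o1
  change ∀ k < N ^ 1, (outFstCmd.run N B s).io (N * N + k) = _ at f1
  set s1 := outFstCmd.run N B s with hs1
  -- the second coordinates
  obtain ⟨o2, f2⟩ := run_write (N := N) (B := B) (d := 1) (v := 3) (b := N * N + N) (s := s1)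
    (a := .n * .n + .n + .var 3) (e := posE (.var 3) / 3) (f := fun k => s.arr 9 k / 3) (by omega)
    (fun k hk s' hs' hv => by simp [posE, hv, hs'.arr, o1.arr])
    (fun k hk => by
      have := hpos ⟨k, by simpa using hk⟩
      simp only at this ⊢
      omega)
  change EqIo 3 (N * N + N) (N ^ 1) s1 (outSndCmd.run N B s1) at o2
  change ∀ k < N ^ 1, (outSndCmd.run N B s1).io (N * N + N + k) = _ at f2
  set s2 := outSndCmd.run N B s1 with hs2
  have a2 : s2.arr = s.arr := o2.arr.trans o1.arr
  rw [pow_one] at o1 f1 o2 f2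
  -- the graph on the triples
  obtain ⟨o3, f3⟩ := run_write (N := N) (B := B) (d := 2) (v := 3) (b := N * N + 2 * N) (s := s2)
    (a := .n * .n + 2 * .n + .var 3) (e := ((Exp.lt (.var 3) (triplesE * triplesE) *
    adjTripleE (.var 3 / triplesE) (.var 3 - .var 3 / triplesE * triplesE)).not.not))
    (f := fun k => if k < N / 3 * (N / 3) ∧
      TripleAdj H (fun v => s.arr 9 v) (k / (N / 3)) (k - k / (N / 3) * (N / 3)) then 1 else 0) (by omega)
    (fun k hk s' hs' hv => by
      have a3 : s'.arr = s.arr := hs'.arr.trans a2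
      have hC' : HasInput H p q s' := by
        refine ⟨?_, ?_, fun u v => ?_⟩
        · rw [hs'.var 0 (by decide), o2.var 0 (by decide), o1.var 0 (by decide), hC.p]
        · rw [hs'.var 1 (by decide), o2.var 1 (by decide), o1.var 1 (by decide), hC.q]
        · have := mul_add_lt_sq u.isLt v.isLt
          rw [hs'.io _ (by omega), o2.io _ (by omega), o1.io _ (by omega), hC.adj]
      have P' : Placed N s' := P.congr (by
        rw [hs'.var 8 (by decide), o2.var 8 (by decide), o1.var 8 (by decide)]) (by rw [a3]) (by rw [a3])
        (by rw [a3])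
      refine ⟨by simp [hv], eval_not_not ?_⟩
      rw [eval_mul, mul_ne_zero_iff]
      by_cases hk3 : k < N / 3 * (N / 3)
      · have h0 : 0 < N / 3 := by
          by_contra h0
          rw [Nat.eq_zero_of_not_pos h0] at hk3
          omega
        have e1 : (Exp.var 3 / triplesE).eval N B s' = k / (N / 3) := by simp [triplesE, hv]
        have e2 : (Exp.var 3 - .var 3 / triplesE * triplesE).eval N B s' = k - k / (N / 3) * (N / 3) := by
          simp [triplesE, hv]
        have l1 : k / (N / 3) < N / 3 := Nat.div_lt_of_lt_mul hk3
        have l2 : k - k / (N / 3) * (N / 3) < N / 3 := by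
          rw [mul_comm, ← Nat.mod_eq_sub_mul_div]; exact Nat.mod_lt _ h0
        have := eval_adjTripleE (B := B) (by omega) hC' P' (by rwa [a3]) hN (i := .var 3 / triplesE)
          (j := .var 3 - .var 3 / triplesE * triplesE) (by rwa [e1]) (by rwa [e2])
        rw [this, e1, e2, a3]
        have hlt : (Exp.lt (.var 3) (triplesE * triplesE)).eval N B s' ≠ 0 := by simp [triplesE, hv, hk3]
        simp only [hlt, hk3, ne_eq, not_false_eq_true, true_and]
      · have hlt : (Exp.lt (.var 3) (triplesE * triplesE)).eval N B s' = 0 := by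
          simp only [eval_lt_eq_zero, eval_var, eval_mul, triplesE, eval_div, eval_n, eval_lit, hv]
          exact hk3
        simp only [hlt, hk3, ne_eq, not_true_eq_false, false_and])
    (fun k hk => by split <;> omega)
  change EqIo 3 (N * N + 2 * N) (N ^ 2) s2 (outTriplesCmd.run N B s2) at o3
  change ∀ k < N ^ 2, (outTriplesCmd.run N B s2).io (N * N + 2 * N + k) = _ at f3
  set s3 := outTriplesCmd.run N B s2 with hs3
  have a3 : s3.arr = s.arr := o3.arr.trans a2
  rw [hsq] at o3 f3
  have g3 : ∀ i < N / 3, ∀ j < N / 3, s3.io (N * N + 2 * N + (i * (N / 3) + j)) =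
      if TripleAdj H (fun v => s.arr 9 v) i j then 1 else 0 := fun i hi j hj => by
    have hlt := mul_add_lt_sq hi hj
    have hlt' : i * (N / 3) + j < N * N :=
      hlt.trans_le (Nat.mul_le_mul (Nat.div_le_self _ _) (Nat.div_le_self _ _))
    have hd : (i * (N / 3) + j) / (N / 3) = i := by
      rw [add_comm, Nat.add_mul_div_right _ _ (by omega), Nat.div_eq_of_lt hj, zero_add]
    rw [f3 _ hlt']
    simp only [hlt, hd, true_and, Nat.add_sub_cancel_left]
  -- the new graph
  obtain ⟨o4, f4⟩ := run_write (N := N) (B := B) (d := 2) (v := 3) (b := 0) (s := s3)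
    (a := .var 3) (e := (((Exp.eq (mod3E (posE (.var 3 / .n)))
    (mod3E (posE (.var 3 - .var 3 / .n * .n)))).not *
      Exp.io (.n * .n + 2 * .n + (posE (.var 3 / .n) / 3 * triplesE +
        posE (.var 3 - .var 3 / .n * .n) / 3))).not.not))
    (f := fun k => if s.arr 9 (k / N) % 3 ≠ s.arr 9 (k - k / N * N) % 3 ∧
      TripleAdj H (fun v => s.arr 9 v) (s.arr 9 (k / N) / 3) (s.arr 9 (k - k / N * N) / 3) then 1 else 0)
    (by omega)
    (fun k hk s' hs' hv => by
      have a4 : s'.arr = s.arr := hs'.arr.trans a3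
      have h0 : 0 < N := by
        by_contra h0
        rw [Nat.eq_zero_of_not_pos h0] at hk
        simp at hk
      have l1 : k / N < N := Nat.div_lt_of_lt_mul (by omega)
      have l2 : k - k / N * N < N := by
        rw [mul_comm, ← Nat.mod_eq_sub_mul_div]; exact Nat.mod_lt _ h0
      have p1 := hpos ⟨_, l1⟩
      have p2 := hpos ⟨_, l2⟩
      simp only at p1 p2
      set x := s.arr 9 (k / N) with hx
      set y := s.arr 9 (k - k / N * N) with hy
      have e1 : (posE (.var 3 / .n)).eval N B s' = x := by simp [posE, hv, a4, hx]
      have e2 : (posE (.var 3 - .var 3 / .n * .n)).eval N B s' = y := by simp [posE, hv, a4, hy]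
      refine ⟨by simp [hv], eval_not_not ?_⟩
      have hx3 : x / 3 < N / 3 := by omega
      have hy3 : y / 3 < N / 3 := by omega
      have hlt : x / 3 * (N / 3) + y / 3 < N * N := (mul_add_lt_sq hx3 hy3).trans_le
        (Nat.mul_le_mul (Nat.div_le_self _ _) (Nat.div_le_self _ _))
      have hio : (Exp.io (.n * .n + 2 * .n + (posE (.var 3 / .n) / 3 * triplesE +
          posE (.var 3 - .var 3 / .n * .n) / 3))).eval N B s' =
          if TripleAdj H (fun v => s.arr 9 v) (x / 3) (y / 3) then 1 else 0 := by
        have ea : (.n * .n + 2 * .n + (posE (.var 3 / .n) / 3 * triplesE +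
          posE (.var 3 - .var 3 / .n * .n) / 3) : Exp).eval N B s' =
          N * N + 2 * N + (x / 3 * (N / 3) + y / 3) := by
          simp only [eval_add, eval_mul, eval_div, e1, e2, eval_n, eval_lit, triplesE]
        rw [Exp.eval, ea, if_pos (by omega), hs'.io _ (by omega)]
        exact g3 _ hx3 _ hy3
      have hm : (Exp.eq (mod3E (posE (.var 3 / .n)))
          (mod3E (posE (.var 3 - .var 3 / .n * .n)))).not.eval N B s' ≠ 0 ↔ x % 3 ≠ y % 3 := by
        simp only [ne_eq, eval_not_eq_zero, not_not, eval_eq_eq_zero, mod3E, eval_sub, eval_mul, eval_div,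
          e1, e2, eval_lit]
        omega
      rw [eval_mul, mul_ne_zero_iff, hm, hio]
      simp only [ne_eq, ite_eq_right_iff, one_ne_zero, imp_false, not_not])
    (fun k hk => by split <;> omega)
  change EqIo 3 0 (N ^ 2) s3 (outGraphCmd.run N B s3) at o4
  change ∀ k < N ^ 2, (outGraphCmd.run N B s3).io (0 + k) = _ at f4
  set s4 := outGraphCmd.run N B s3 with hs4
  rw [hsq] at o4 f4
  refine ⟨fun v => ?_, fun v => ?_, fun i hi j hj => ?_, fun u v => ?_⟩
  · rw [o4.io _ (by omega), o3.io _ (by omega), o2.io _ (by omega), f1 _ v.isLt]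
  · rw [o4.io _ (by omega), o3.io _ (by omega), f2 _ v.isLt]
  · rw [o4.io _ (by omega), g3 i hi j hj]
  · have hd : (u * N + v : ℕ) / N = u := by
      rw [add_comm, Nat.add_mul_div_right _ _ u.pos, Nat.div_eq_of_lt v.isLt, zero_add]
    have := f4 _ (mul_add_lt_sq u.isLt v.isLt)
    simp only [zero_add, hd, Nat.add_sub_cancel_left] at this
    exact this

end Imp

/-! ### The algorithm -/

namespace Imp

open Finset Classical WordRAM

/-- The whole algorithm. -/
def mainCmd : Cmd :=
  .seq codegCmd (.seq labelCmd (.seq componentsCmd (.seq leftoverCmd outputCmd)))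

/-- An exponent of a polynomial bound on the running time. -/
def Cmd.depth : Cmd → ℕ
  | .seq c c' => max c.depth c'.depth
  | .ite _ c c' => max c.depth c'.depth
  | .loop _ d c => d + c.depth
  | _ => 0

theorem Cmd.exists_maxCost_le (c : Cmd) : ∃ C, ∀ N, c.maxCost N ≤ C * (N + 1) ^ c.depth := by
  induction c with
  | seq c c' ih ih' =>
    obtain ⟨C, h⟩ := ih
    obtain ⟨C', h'⟩ := ih'
    refine ⟨C + C', fun N => ?_⟩
    have h1 := Nat.pow_le_pow_right (Nat.succ_pos N) (le_max_left c.depth c'.depth)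
    have h2 := Nat.pow_le_pow_right (Nat.succ_pos N) (le_max_right c.depth c'.depth)
    rw [Cmd.maxCost, Cmd.depth, add_mul]
    exact Nat.add_le_add ((h N).trans (Nat.mul_le_mul_left _ h1)) ((h' N).trans (Nat.mul_le_mul_left _ h2))
  | ite e c c' ih ih' =>
    obtain ⟨C, h⟩ := ih
    obtain ⟨C', h'⟩ := ih'
    refine ⟨1 + (C + C'), fun N => ?_⟩
    have h1 := Nat.pow_le_pow_right (Nat.succ_pos N) (le_max_left c.depth c'.depth)
    have h2 := Nat.pow_le_pow_right (Nat.succ_pos N) (le_max_right c.depth c'.depth)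
    rw [Cmd.maxCost, Cmd.depth, add_mul, add_mul, one_mul]
    exact Nat.add_le_add (Nat.one_le_pow _ _ (Nat.succ_pos N))
      (Nat.add_le_add ((h N).trans (Nat.mul_le_mul_left _ h1)) ((h' N).trans (Nat.mul_le_mul_left _ h2)))
  | loop v d c ih =>
    obtain ⟨C, h⟩ := ih
    refine ⟨2 + C, fun N => ?_⟩
    have h1 : N ^ d ≤ (N + 1) ^ d := Nat.pow_le_pow_left (Nat.le_succ N) d
    have h2 : 1 ≤ (N + 1) ^ c.depth := Nat.one_le_pow _ _ (Nat.succ_pos N)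
    have h3 : 1 ≤ (N + 1) ^ d := Nat.one_le_pow _ _ (Nat.succ_pos N)
    rw [Cmd.maxCost, Cmd.depth, pow_add]
    calc 1 + N ^ d * (1 + c.maxCost N)
        ≤ (N + 1) ^ d * (N + 1) ^ c.depth +
            (N + 1) ^ d * ((N + 1) ^ c.depth + C * (N + 1) ^ c.depth) :=
          Nat.add_le_add (Nat.one_le_iff_ne_zero.2 (by positivity))
            (Nat.mul_le_mul h1 (Nat.add_le_add h2 (h N)))
      _ = (2 + C) * ((N + 1) ^ d * (N + 1) ^ c.depth) := by ring
  | _ => exact ⟨1, fun N => by simp [Cmd.maxCost, Cmd.depth]⟩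

theorem mainCmd_wf : mainCmd.Wf := by
  simp [mainCmd, codegCmd, labelCmd, findPendingCmd, findSeedCmd, expandCmd, componentsCmd, classCmd,
    colourCmd, clearCmd, matchCmd, auctionCmd, findBidderCmd, findItemCmd, bidCmd, closeCmd, testCmd,
    testVertexCmd, commitCmd, placeCmd, appendTripleCmd, appendCmd, leftoverCmd, outputCmd, outFstCmd,
    outSndCmd, outTriplesCmd, outGraphCmd, Cmd.Wf]

theorem Exec.mono {W W' : ℕ} (h : W ≤ W') {A : Prog} {s s' : State} {t : ℕ} (hE : Exec W A s t s') :
    Exec W' A s t s' := by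
  induction hE with
  | skip s => exact .skip s
  | const s r k hk => exact .const s r k (hk.trans h)
  | op s o r a b hv => exact .op s o r a b (hv.trans h)
  | load s r a => exact .load s r a
  | store s a b => exact .store s a b
  | seq _ _ ih ih' => exact .seq ih ih'
  | branch_pos hr _ ih => exact .branch_pos hr ih
  | branch_zero hr _ ih => exact .branch_zero hr ih
  | loop_step hr _ _ ih ih' => exact .loop_step hr ih ih'
  | loop_done hr => exact .loop_done hr

/-- The properties of the positions that the algorithm computes, and what it writes. -/
theorem mainCmd_spec {N p q : ℕ} {H : SimpleGraph (Fin N)} {β : Type*} [Fintype β] {G : SimpleGraph β}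
    {e : Fin N ≃ Fin 3 × β} (hN : Near H G e p q) (hq : 0 < q) (h3 : 3 ∣ N) :
    ∃ pos : Fin N → ℕ, Function.Injective pos ∧ (∀ v, pos v < N) ∧
      (540 * p < q → q * #{x : Fin N × Fin N | H.Adj x.1 x.2 ∧ ¬ Kept H pos x.1 x.2} ≤
        496 * p * (∑ v, codeg H v v) + 2 * q * N) ∧
      ∃ io : ℕ → ℕ, (mainCmd.run N (bound N p q) (inputStore H p q)).io = io ∧
        (∀ v : Fin N, io (N * N + v) = pos v % 3) ∧ (∀ v : Fin N, io (N * N + N + v) = pos v / 3) ∧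
        (∀ i < N / 3, ∀ j < N / 3, io (N * N + 2 * N + (i * (N / 3) + j)) =
          if TripleAdj H pos i j then 1 else 0) ∧
        ∀ u v : Fin N, io (u * N + v) =
          if pos u % 3 ≠ pos v % 3 ∧ TripleAdj H pos (pos u / 3) (pos v / 3) then 1 else 0 := by
  have hb := mul_self_le_bound N p q
  have hb3 := pow_three_le_bound N p q
  have hb' := le_bound N p q
  set B := bound N p q
  have hNN : N * N ≤ B := by omega
  set s := inputStore H p q with hs
  have hin : HasInput H p q s := ⟨rfl, rfl, inputState_mem H p q⟩
  have hB16 : N + 3 ≤ B := by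
    have : N + p + q + 2 ≤ B := hb'
    omega
  rw [mainCmd, run_seq, run_seq, run_seq, run_seq]
  set s1 := codegCmd.run N B s with hs1
  have C1 : Ctx H p q s1 := codegCmd_spec hNN hin
  set s2 := labelCmd.run N B s1 with hs2
  obtain ⟨I2, hall2⟩ := labelCmd_spec hNN hb3 C1
    (by rw [hs1, codegCmd.arr_run _ (by rfl)]; exact fun _ => rfl)
    (by rw [hs1, codegCmd.arr_run _ (by rfl)]; exact fun _ => rfl)
  rw [← hs2] at I2 hall2
  have C2 : Ctx H p q s2 := C1.run (by rfl)
  set s3 := componentsCmd.run N B s2 with hs3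
  obtain ⟨P3, -, L3, hcov⟩ := componentsCmd_spec hN hNN hB16 C2 I2 hall2
    (by rw [hs2, labelCmd.var_run _ (by rfl), hs1, codegCmd.var_run _ (by rfl)]; rfl)
    (by rw [hs2, labelCmd.arr_run _ (by rfl), hs1, codegCmd.arr_run _ (by rfl)]; exact fun _ => rfl)
    (by rw [hs2, labelCmd.arr_run _ (by rfl), hs1, codegCmd.arr_run _ (by rfl)]; exact fun _ => rfl)
  rw [← hs3] at P3 L3 hcov
  have C3 : Ctx H p q s3 := C2.run (by rfl)
  set s4 := leftoverCmd.run N B s3 with hs4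
  obtain ⟨P4, hall4, hold⟩ := leftoverCmd_spec (N := N) (B := B) (by omega) P3
  rw [← hs4] at P4 hall4 hold
  have C4 : Ctx H p q s4 := C3.run (by rfl)
  obtain ⟨o1, o2, o3, o4⟩ := outputCmd_spec hb (by omega) C4.toHasInput P4 hall4 h3
  have hinj : Function.Injective fun v : Fin N => s4.arr 9 v := fun v w he => by
    have h1 := P4.inv v (hall4 v)
    have he' : s4.arr 9 v = s4.arr 9 w := he
    rw [he', P4.inv w (hall4 w)] at h1
    exact Fin.ext h1.symm
  have h8 : s4.var 8 = N := by
    rw [P4.card]; simp [hall4]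
  refine ⟨fun v => s4.arr 9 v, hinj, fun v => (P4.pos_lt v (hall4 v)).trans_eq h8,
    fun hpq => ?_, _, rfl, o1, o2, o3, o4⟩
  obtain ⟨-, m, col, g, hbl, hu, hint⟩ := L3
  have := card_not_kept_le (m := m) (col := col) (g := g) hpq hbl
    (fun u v huv => (hu u).1 (hcov hpq u ⟨v, huv⟩)) hinj fun v hv => by
      obtain ⟨i1, i2, i3, i4⟩ := hint v hv
      simp only at i3 i4 ⊢
      rw [hold v i1, hold _ i2]
      exact ⟨i3, i4⟩
  simpa using this

end Imp

/-! ### Reading the output -/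

section Final

open Finset Classical

theorem two_mul_ncard_edgeSet {N : ℕ} (D : SimpleGraph (Fin N)) :
    2 * D.edgeSet.ncard = ∑ v, #{w | D.Adj v w} := by
  rw [Set.ncard_eq_toFinset_card', ← SimpleGraph.edgeFinset, ← D.sum_degrees_eq_twice_card_edges]
  refine sum_congr rfl fun v _ => ?_
  rw [← SimpleGraph.card_neighborFinset_eq_degree]
  congr 1
  ext w
  simp

theorem exists_near {N n p q : ℕ} {H : SimpleGraph (Fin N)} {G : SimpleGraph (Fin n)} (hq : 0 < q)
    (h : IsNearTriangleTensor ((p : ℝ) / q) H G) : ∃ e : Fin N ≃ Fin 3 × Fin n, Near H G e p q := by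
  obtain ⟨E', -, hE', ⟨f⟩⟩ := h
  have hadj : ∀ u v, H.Adj u v ↔ (triangleTensor G).Adj (f u) (f v) ∧ s(f u, f v) ∉ E' := fun u v => by
    rw [← f.map_adj_iff, SimpleGraph.deleteEdges_adj]
  have hT : ∀ x y, (triangleTensor G).Adj x y ↔ x.1 ≠ y.1 ∧ G.Adj x.2 y.2 := fun x y => by
    simp [tensorProd]
  refine ⟨f.toEquiv, fun u v huv => (hT _ _).1 ((hadj u v).1 huv).1, fun v => ?_⟩
  have h1 : #{w | ((f v).1 ≠ (f w).1 ∧ G.Adj (f v).2 (f w).2) ∧ ¬ H.Adj v w} ≤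
      ((triangleTensor G).incidenceSet (f v) ∩ E').ncard := by
    rw [← Set.ncard_coe_finset]
    refine Set.ncard_le_ncard_of_injOn (fun w => s(f v, f w)) (fun w hw => ?_) (fun w _ w' _ he => ?_)
      (Set.toFinite _)
    · simp only [coe_filter, mem_univ, true_and, Set.mem_ofPred_eq, hadj, hT] at hw
      refine ⟨(SimpleGraph.mk'_mem_incidenceSet_left_iff _).2 ((hT _ _).2 hw.1), ?_⟩
      by_contra hne
      exact hw.2 ⟨hw.1, hne⟩
    · exact f.injective (Sym2.congr_right.1 he)
  have h2 : ((triangleTensor G).incidenceSet (f v)).ncard ≤ 2 * nbrs G (f v).2 := by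
    rw [Set.ncard_eq_toFinset_card', Set.toFinset_card, SimpleGraph.card_incidenceSet_eq_degree,
      ← SimpleGraph.card_neighborFinset_eq_degree]
    have : (triangleTensor G).neighborFinset (f v) ⊆
        (univ.erase (f v).1) ×ˢ ({k | G.Adj (f v).2 k} : Finset (Fin n)) := fun x hx => by
      rw [SimpleGraph.mem_neighborFinset, hT] at hx
      simp [hx.1.symm, hx.2]
    refine (card_le_card this).trans ?_
    rw [card_product, card_erase_of_mem (mem_univ _)]
    simp [nbrs]
  have h3 := hE' (f v)
  have hq' : (0 : ℝ) < q := by exact_mod_cast hq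
  rw [div_mul_eq_mul_div, le_div_iff₀ hq'] at h3
  have h4 : ((triangleTensor G).incidenceSet (f v) ∩ E').ncard * q ≤
      p * ((triangleTensor G).incidenceSet (f v)).ncard := by exact_mod_cast h3
  calc q * _ ≤ q * ((triangleTensor G).incidenceSet (f v) ∩ E').ncard := Nat.mul_le_mul_left q h1
    _ ≤ p * ((triangleTensor G).incidenceSet (f v)).ncard := by rw [mul_comm]; exact h4
    _ ≤ p * (2 * nbrs G (f v).2) := Nat.mul_le_mul_left p h2
    _ = _ := by simp only [RelIso.coe_fn_toEquiv]; ring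

/-- The graph that consists of the kept edges. -/
def keptGraph {N : ℕ} (H : SimpleGraph (Fin N)) (pos : Fin N → ℕ) : SimpleGraph (Fin N) where
  Adj u v := pos u % 3 ≠ pos v % 3 ∧ Imp.TripleAdj H pos (pos u / 3) (pos v / 3)
  symm := ⟨fun _ _ h => ⟨h.1.symm, h.2.1.symm, fun a b ha hb hab => (h.2.2 b a hb ha hab.symm).symm⟩⟩
  loopless := ⟨fun _ h => h.1 rfl⟩

/-- The graph on the triples. -/
def tripleGraph {N : ℕ} (H : SimpleGraph (Fin N)) (pos : Fin N → ℕ) (n : ℕ) : SimpleGraph (Fin n) where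
  Adj i j := Imp.TripleAdj H pos i j
  symm := ⟨fun _ _ h => ⟨h.1.symm, fun a b ha hb hab => (h.2 b a hb ha hab.symm).symm⟩⟩
  loopless := ⟨fun _ h => h.1 rfl⟩

theorem keptGraph_le {N : ℕ} (H : SimpleGraph (Fin N)) (pos : Fin N → ℕ) : keptGraph H pos ≤ H :=
  fun _ _ h => h.2.2 _ _ rfl rfl h.1

theorem keptGraph_adj {N : ℕ} {H : SimpleGraph (Fin N)} {pos : Fin N → ℕ} {u v : Fin N} :
    (keptGraph H pos).Adj u v ↔ Kept H pos u v := by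
  simp only [keptGraph, Kept, Imp.TripleAdj]
  tauto

/-- The kept graph is the tensor product of the triangle and the graph on the triples. -/
noncomputable def keptIso {n : ℕ} (H : SimpleGraph (Fin (3 * n))) {pos : Fin (3 * n) → ℕ}
    (hinj : Function.Injective pos) (hlt : ∀ v, pos v < 3 * n) :
    keptGraph H pos ≃g triangleTensor (tripleGraph H pos n) where
  toEquiv := Equiv.ofBijective
    (fun v => (⟨pos v % 3, Nat.mod_lt _ (by omega)⟩, ⟨pos v / 3, Nat.div_lt_of_lt_mul (hlt v)⟩)) <| by
      refine (Fintype.bijective_iff_injective_and_card _).2 ⟨fun u v h => hinj ?_, by simp⟩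
      simp only [Prod.mk.injEq, Fin.mk.injEq] at h
      omega
  map_rel_iff' := by
    intro u v
    simp [tensorProd, keptGraph, tripleGraph]

theorem ncard_symmDiff_keptGraph_le {N p q : ℕ} {H : SimpleGraph (Fin N)} {pos : Fin N → ℕ} (hq : 0 < q)
    (h : 540 * p < q → q * #{x : Fin N × Fin N | H.Adj x.1 x.2 ∧ ¬ Kept H pos x.1 x.2} ≤
        496 * p * (∑ v, codeg H v v) + 2 * q * N) {c : ℝ} (hc : 0 < c)
    (hcN : c * N ≤ ((p : ℝ) / q) * H.edgeSet.ncard) :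
    ((symmDiff H.edgeSet (keptGraph H pos).edgeSet).ncard : ℝ) ≤
      (540 + 1 / c) * (((p : ℝ) / q) * H.edgeSet.ncard) := by
  have hq' : (0 : ℝ) < q := by exact_mod_cast hq
  have hsub : (keptGraph H pos).edgeSet ⊆ H.edgeSet := SimpleGraph.edgeSet_mono (keptGraph_le H pos)
  have hdiff : symmDiff H.edgeSet (keptGraph H pos).edgeSet = (H \ keptGraph H pos).edgeSet := by
    rw [SimpleGraph.edgeSet_sdiff, Set.symmDiff_def, Set.sdiff_eq_empty.2 hsub, Set.union_empty]
  set E := H.edgeSet.ncard with hE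
  set X := (symmDiff H.edgeSet (keptGraph H pos).edgeSet).ncard with hX
  set r : ℝ := ((p : ℝ) / q) * E with hr
  have hr0 : 0 ≤ r := by positivity
  have hrc : (N : ℝ) ≤ 1 / c * r := by
    rw [one_div, inv_mul_eq_div, le_div_iff₀ hc, mul_comm]; exact hcN
  have h1c : 0 ≤ 1 / c * r := by positivity
  rw [add_mul]
  by_cases hpq : 540 * p < q
  · have h1 : 2 * X = #{x : Fin N × Fin N | H.Adj x.1 x.2 ∧ ¬ Kept H pos x.1 x.2} := by
      rw [hX, hdiff, two_mul_ncard_edgeSet, card_filter, Fintype.sum_prod_type]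
      simp only [card_filter, SimpleGraph.sdiff_adj, keptGraph_adj]
    have h2 : 2 * E = ∑ v, codeg H v v := by
      rw [hE, two_mul_ncard_edgeSet]
      simp only [codeg_self]
    have h3 := h hpq
    rw [← h1, ← h2] at h3
    have h4 : (q : ℝ) * (2 * X) ≤ 496 * p * (2 * E) + 2 * q * N := by exact_mod_cast h3
    have h5 : (p : ℝ) * E = q * r := by rw [hr]; field_simp
    have h6 : (X : ℝ) ≤ 496 * r + N := by
      refine le_of_mul_le_mul_left ?_ hq'
      linear_combination h4 / 2 + 496 * h5
    linarith
  -- for `ε ≥ 1 / 540` it suffices that the kept graph is a subgraph of `H`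
  · have h1 : X ≤ E := by
      rw [hX, hdiff, hE]
      refine Set.ncard_le_ncard ?_ (Set.toFinite _)
      rw [SimpleGraph.edgeSet_sdiff]
      exact Set.sdiff_subset
    have h2 : (X : ℝ) ≤ E := by exact_mod_cast h1
    have h3 : (q : ℝ) ≤ 540 * p := by exact_mod_cast not_lt.1 hpq
    have h4 : (E : ℝ) ≤ 540 * r := by
      rw [hr, div_mul_eq_mul_div, mul_div_assoc', le_div_iff₀ hq']
      have := mul_le_mul_of_nonneg_right h3 (Nat.cast_nonneg (α := ℝ) E)
      linarith
    linarith

theorem theorem1 :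
    ∃ (A : WordRAM.Prog) (K : ℕ),
      ∀ (n N p q : ℕ) (G : SimpleGraph (Fin n)) (H : SimpleGraph (Fin N)),
        0 < q → IsNearTriangleTensor ((p : ℝ) / q) H G →
        ∃ (t : ℕ) (s : WordRAM.State),
          WordRAM.Exec (K * (N + p + q + 1) ^ K) A (inputState H p q) t s ∧
          t ≤ K * (n ^ 6 + 1) ∧
          ∃ (Gt : SimpleGraph (Fin n)) (Ht : SimpleGraph (Fin N)) (φ : Ht ≃g triangleTensor Gt),
            IsOutput s Ht Gt φ ∧
            ∀ c : ℝ, 0 < c → c * N ≤ ((p : ℝ) / q) * H.edgeSet.ncard →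
              ((symmDiff H.edgeSet Ht.edgeSet).ncard : ℝ)
                ≤ (540 + 1 / c) * (((p : ℝ) / q) * H.edgeSet.ncard) := by
  obtain ⟨A, K, hA⟩ := Imp.exists_prog Imp.mainCmd Imp.mainCmd_wf
  obtain ⟨C, hC⟩ := Imp.mainCmd.exists_maxCost_le
  refine ⟨A, K + K * (C * 4 ^ 6), fun n N p q G H hq hnear => ?_⟩
  obtain ⟨e, hN⟩ := exists_near hq hnear
  have hcard : N = 3 * n := by simpa using Fintype.card_congr e
  subst hcard
  obtain ⟨t, st, hE, ht, hmem⟩ := hA (3 * n) p q H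
  obtain ⟨pos, hinj, hlt, hcount, io, hio, o1, o2, o3, o4⟩ := Imp.mainCmd_spec hN hq ⟨n, rfl⟩
  rw [Nat.mul_div_cancel_left n (by omega)] at o3
  have hb := Imp.mul_self_le_bound (3 * n) p q
  have hmem' : ∀ i < 3 * n * (3 * n) + 2 * (3 * n) + 3 * n * (3 * n), st.mem i = io i := fun i hi => by
    rw [hmem i (by omega), hio]
  refine ⟨t, st, Imp.Exec.mono ?_ hE, ?_, tripleGraph H pos n, keptGraph H pos, keptIso H hinj hlt,
    ⟨fun u v => ?_, fun v => ?_, fun v => ?_, fun i j => ?_⟩,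
    fun c hc hcN => ncard_symmDiff_keptGraph_le hq hcount hc hcN⟩
  · exact Nat.mul_le_mul (Nat.le_add_right _ _) (Nat.pow_le_pow_right (by omega) (Nat.le_add_right _ _))
  · have h1 : (3 * n + 1) ^ 6 ≤ 4 ^ 6 * (n ^ 6 + 1) := by
      rcases Nat.eq_zero_or_pos n with rfl | hn
      · norm_num
      · calc (3 * n + 1) ^ 6 ≤ (4 * n) ^ 6 := Nat.pow_le_pow_left (by omega) 6
          _ = 4 ^ 6 * n ^ 6 := mul_pow _ _ _
          _ ≤ _ := Nat.mul_le_mul_left _ (Nat.le_succ _)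
    calc t ≤ K * (C * (3 * n + 1) ^ 6) :=
          ht.trans (Nat.mul_le_mul_left K ((Imp.Cmd.cost_le _ _).trans (hC _)))
      _ ≤ K * (C * (4 ^ 6 * (n ^ 6 + 1))) := Nat.mul_le_mul_left K (Nat.mul_le_mul_left C h1)
      _ = K * (C * 4 ^ 6) * (n ^ 6 + 1) := by ring
      _ ≤ _ := Nat.mul_le_mul_right _ (Nat.le_add_left _ _)
  · have := Imp.mul_add_lt_sq u.isLt v.isLt
    rw [hmem' _ (by omega), o4, adjBit]
    congr
  · have := v.isLt
    have : 3 * n ≤ 3 * n * (3 * n) := Nat.le_mul_self _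
    rw [hmem' _ (by omega), o1]
    rfl
  · have := v.isLt
    have : 3 * n ≤ 3 * n * (3 * n) := Nat.le_mul_self _
    rw [hmem' _ (by omega), o2]
    rfl
  · have h1 := Imp.mul_add_lt_sq i.isLt j.isLt
    have h2 : n * n ≤ 3 * n * (3 * n) := Nat.mul_le_mul (by omega) (by omega)
    rw [add_assoc, hmem' _ (by omega), o3 _ i.isLt _ j.isLt, adjBit]
    congr

end Final
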